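/- Let $N\ge 1$, let $\omega\in\mathbb{C}$ be a primitive $N$-th root of unity and $\mathbb{Z}_N=\mathbb{Z}/N\mathbb{Z}$. Let $X=\mathrm{C}(\mathrm{S}_N^+(\mathrm{R}))$ be the universal unital $\mathrm{C}^*$-algebra with generators $q_{ij}$, $i,j\in\mathbb{Z}_N$, and relations $$q_{0i}=q_{i0}=\delta_{i0},\qquad q_{ij}^*=\omega^{-i(i-j)}q_{-i,-j},$$ $$q_{k,i+j}=\sum_{l}\omega^{-l(i-k+l)}q_{k-l,i}\,q_{lj},\qquad q_{i+j,k}=\sum_{l}\omega^{-i(l-j)}q_{jl}\,q_{i,k-l},$$ with the $\mathbb{Z}_N$-action $\rho_t(q_{ij})=\omega^{t(j-i)}q_{ij}$. Let $\mathrm{C}(\mathbb{Z}_N)$ carry the action $\rho_t(f)(s)=f(s+t)$, and let $z\in\mathrm{C}(\mathbb{Z}_N)$, $z(t)=\omega^t$. For $\mathbb{Z}_N$-$\mathrm{C}^*$-algebras $A$, $B$ represented faithfully and equivariantly on Hilbert spaces $H_A$, $H_B$ with unitary $\mathbb{Z}_N$-representations, let $c:H_A\otimes H_B\to H_B\otimes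 H_A$ be the unitary with $c(\xi\otimes\eta)=\omega^{mn}\,\eta\otimes\xi$ whenever $\mathbb{Z}_N$ acts on $\xi$, $\eta$ by $t\mapsto\omega^{tm}$, $t\mapsto\omega^{tn}$. The braided tensor product $A\boxtimes_{\mathrm R}B$ is the $\mathrm{C}^*$-algebra of operators on $H_A\otimes H_B$ generated by $j_1(x)=x\otimes 1$, $x\in A$, and $j_2(y)=c^*(y\otimes 1)c$, $y\in B$, with the action implemented by the tensor product of the two representations. Here $\mathrm{C}(\mathbb{Z}_N)$ is represented on $\ell^2(\mathbb{Z}_N)$ by multiplication, and $X$ by an arbitrary faithful equivariant representation. Let $\otimes$ be the minimal tensor product and $$A_{\rtimes}=\mathrm{C}(\mathrm{S}_N^+(\mathrm{R})\rtimes\mathbb{Z}_N)=\mathrm{C}(\mathbb{Z}_N)\boxtimes_{\mathrm R}X .$$ There is exactly one unital $*$-homomorphism $\Delta_{\rtimes}:A_{\rtimes}\to A_{\rtimes}\otimes A_{\rtimes}$ of the form $\Delta_{\rtimes}=\psi\circ(\mathrm{id}\boxtimes_{\mathrm R}\Delta)$, where $\Delta:X\to X\boxtimes_{\mathrm R}X$,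 $\mathrm{id}\boxtimes_{\mathrm R}\Delta:A_{\rtimes}\to\mathrm{C}(\mathbb{Z}_N)\boxtimes_{\mathrm R}X\boxtimes_{\mathrm R}X$ and $\psi:\mathrm{C}(\mathbb{Z}_N)\boxtimes_{\mathrm R}X\boxtimes_{\mathrm R}X\to A_{\rtimes}\otimes A_{\rtimes}$ are unital $*$-homomorphisms with $\Delta(q_{ij})=\sum_k j_1(q_{ik})j_2(q_{kj})$, $(\mathrm{id}\boxtimes_{\mathrm R}\Delta)(j_1(x)j_2(a))=j_1(x)j_2(\Delta(a))$, and $$\psi(j_1(x))=(j_1\otimes j_1)(\Delta_{\mathbb{Z}_N}(x)),\quad \psi(j_2(a))=(j_2\otimes j_1)(\rho^X(a)),\quad \psi(j_3(b))=1\otimes j_2(b)$$ for $x\in\mathrm{C}(\mathbb{Z}_N)$, $a,b\in X$, where $\Delta_{\mathbb{Z}_N}(x)=\sum_{s,t}x(s+t)\,\delta_s\otimes\delta_t$ and $\rho^X(a)=\sum_t\rho_t(a)\otimes\delta_t$. This $\Delta_{\rtimes}$ is the comultiplication of the bosonization $\mathrm{S}_N^+(\mathrm{R})\rtimes\mathbb{Z}_N$.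 Put $t_{ij}=j_1(z^i)j_2(q_{ij})\in A_{\rtimes}$ for $i,j\in\mathbb{Z}_N$. Then the matrix $t=(t_{ij})$ is a finite-dimensional unitary representation of the bosonization, i.e. $t$ is unitary in $M_N(A_{\rtimes})$ and $\Delta_{\rtimes}(t_{ij})=\sum_k t_{ik}\otimes t_{kj}$. Moreover, writing $z$ for $j_1(z)$, the pair $(A_{\rtimes},\,z\oplus t)$ is a compact matrix quantum group with comultiplication $\Delta_{\rtimes}$: the entries of $u=z\oplus t\in M_{1+N}(A_{\rtimes})$ generate a dense $*$-subalgebra of $A_{\rtimes}$, $\Delta_{\rtimes}(u_{kl})=\sum_m u_{km}\otimes u_{ml}$, and $u$ and $\overline u=(u_{kl}^*)$ are invertible. -/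

import Mathlib

open scoped TensorProduct

universe u v

noncomputable section

/-! ### The free unital complex `*`-algebra -/

/-- The free unital complex `*`-algebra on a set `G` of generators: noncommutative polynomials in
the letters `Sum.inl g` (the generator `g`) and `Sum.inr g` (its formal adjoint). -/
def FreeStarAlg (G : Type) : Type := FreeAlgebra ℂ (G ⊕ G)

namespace FreeStarAlg

variable {G : Type}

instance : Ring (FreeStarAlg G) := inferInstanceAs (Ring (FreeAlgebra ℂ (G ⊕ G)))

instance : Algebra ℂ (FreeStarAlg G) := inferInstanceAs (Algebra ℂ (FreeAlgebra ℂ (G ⊕ G)))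

/-- The letters: generators and their formal adjoints. -/
def letter (x : G ⊕ G) : FreeStarAlg G := FreeAlgebra.ι ℂ x

/-- The generators. -/
def gen (g : G) : FreeStarAlg G := letter (Sum.inl g)

theorem induction {motive : FreeStarAlg G → Prop}
    (scalar : ∀ r : ℂ, motive (algebraMap ℂ (FreeStarAlg G) r))
    (letter : ∀ x, motive (letter x))
    (mul : ∀ a b, motive a → motive b → motive (a * b))
    (add : ∀ a b, motive a → motive b → motive (a + b)) (a : FreeStarAlg G) : motive a :=
  FreeAlgebra.induction (R := ℂ) (X := G ⊕ G) (motive := motive) scalar letter mul add a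

/-- The opposite ring, on which a scalar acts through its complex conjugate. -/
abbrev conjAlgebra : Algebra ℂ (FreeStarAlg G)ᵐᵒᵖ :=
  Algebra.compHom (FreeStarAlg G)ᵐᵒᵖ (starRingEnd ℂ)

/-- The involution as a ring homomorphism into the opposite ring: it is conjugate-linear and swaps
the generators with their formal adjoints. -/
def starHom : FreeStarAlg G →+* (FreeStarAlg G)ᵐᵒᵖ :=
  letI := conjAlgebra (G := G)
  (FreeAlgebra.lift ℂ (fun x : G ⊕ G => MulOpposite.op (letter x.swap))).toRingHom

theorem starHom_letter (x : G ⊕ G) : starHom (letter x) = MulOpposite.op (letter x.swap) :=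
  letI := conjAlgebra (G := G)
  FreeAlgebra.lift_ι_apply (R := ℂ) (fun x : G ⊕ G => MulOpposite.op (letter x.swap)) x

theorem starHom_algebraMap (r : ℂ) : starHom (algebraMap ℂ (FreeStarAlg G) r)
    = MulOpposite.op (algebraMap ℂ (FreeStarAlg G) (starRingEnd ℂ r)) :=
  letI := conjAlgebra (G := G)
  (FreeAlgebra.lift ℂ (fun x : G ⊕ G => MulOpposite.op (letter x.swap))).commutes r

instance : StarRing (FreeStarAlg G) where
  star a := (starHom a).unop
  star_involutive a := by
    induction a using induction with
    | scalar r => simp [starHom_algebraMap]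
    | letter x => simp [starHom_letter]
    | mul a b ha hb => simp [ha, hb]
    | add a b ha hb => simp [ha, hb]
  star_mul a b := by simp
  star_add a b := by simp

theorem star_letter (x : G ⊕ G) : star (letter x) = letter x.swap := by
  change (starHom (letter x)).unop = _
  simp [starHom_letter]

theorem star_algebraMap' (r : ℂ) :
    star (algebraMap ℂ (FreeStarAlg G) r) = algebraMap ℂ (FreeStarAlg G) (star r) := by
  change (starHom _).unop = _
  simp [starHom_algebraMap]

instance : StarModule ℂ (FreeStarAlg G) where
  star_smul r a := by
    rw [Algebra.smul_def, star_mul, star_algebraMap', Algebra.smul_def, Algebra.commutes]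

end FreeStarAlg

/-! ### `C*`-seminorms and their completions -/

/-- A `C*`-seminorm on a complex `*`-algebra. -/
structure CStarSeminorm (F : Type) [Ring F] [StarRing F] [Algebra ℂ F] extends Seminorm ℂ F where
  mul_le' : ∀ a b : F, toFun (a * b) ≤ toFun a * toFun b
  star_mul_self' : ∀ a : F, toFun (star a * a) = toFun a * toFun a

namespace CStarSeminorm

variable {F : Type} [Ring F] [StarRing F] [Algebra ℂ F] (p : CStarSeminorm F)

theorem star_mul_self (a : F) : p.toSeminorm (star a * a) = p.toSeminorm a * p.toSeminorm a :=
  p.star_mul_self' a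

theorem mul_le (a b : F) : p.toSeminorm (a * b) ≤ p.toSeminorm a * p.toSeminorm b := p.mul_le' a b

theorem le_star (a : F) : p.toSeminorm a ≤ p.toSeminorm (star a) := by
  rcases (apply_nonneg p.toSeminorm a).eq_or_lt with h | h
  · rw [← h]; exact apply_nonneg _ _
  · have := p.mul_le (star a) a
    rw [p.star_mul_self] at this
    exact le_of_mul_le_mul_right this h

theorem map_star (a : F) : p.toSeminorm (star a) = p.toSeminorm a :=
  le_antisymm (by simpa using p.le_star (star a)) (p.le_star a)

/-- The `*`-algebra `F`, seminormed by `p`. -/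
@[nolint unusedArguments]
def Space (_ : CStarSeminorm F) : Type := F

instance : Ring p.Space := inferInstanceAs (Ring F)
instance : StarRing p.Space := inferInstanceAs (StarRing F)
instance : Algebra ℂ p.Space := inferInstanceAs (Algebra ℂ F)

instance : SeminormedRing p.Space where
  __ : Ring p.Space := inferInstance
  __ : SeminormedAddCommGroup p.Space :=
    p.toSeminorm.toAddGroupSeminorm.toSeminormedAddCommGroup
  norm_mul_le a b := p.mul_le a b

theorem norm_def (a : p.Space) : ‖a‖ = p.toSeminorm (show F from a) := rfl

instance : NormedAlgebra ℂ p.Space where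
  norm_smul_le r a := (map_smul_eq_mul p.toSeminorm r (show F from a)).le

instance : NormedStarGroup p.Space where
  norm_star_le a := (p.map_star (show F from a)).le

/-- The separated completion of `F` with respect to `p`. -/
def Compl : Type := UniformSpace.Completion p.Space

instance : NormedRing p.Compl := inferInstanceAs (NormedRing (UniformSpace.Completion p.Space))
instance : NormedSpace ℂ p.Compl :=
  inferInstanceAs (NormedSpace ℂ (UniformSpace.Completion p.Space))
instance : Algebra ℂ p.Compl := inferInstanceAs (Algebra ℂ (UniformSpace.Completion p.Space))
instance : CompleteSpace p.Compl :=
  inferInstanceAs (CompleteSpace (UniformSpace.Completion p.Space))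

instance : NormedAlgebra ℂ p.Compl where
  norm_smul_le := norm_smul_le (α := ℂ) (β := UniformSpace.Completion p.Space)

/-- The canonical map from `F` to the completion. -/
def toCompl (a : F) : p.Compl := ((show p.Space from a : p.Space) : UniformSpace.Completion p.Space)

@[elab_as_elim]
theorem induction_on {motive : p.Compl → Prop} (x : p.Compl) (hc : IsClosed {x | motive x})
    (h : ∀ a : F, motive (p.toCompl a)) : motive x :=
  UniformSpace.Completion.induction_on x hc h

theorem norm_toCompl (a : F) : ‖p.toCompl a‖ = p.toSeminorm a :=
  UniformSpace.Completion.norm_coe (E := p.Space) _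

theorem toCompl_mul (a b : F) : p.toCompl (a * b) = p.toCompl a * p.toCompl b :=
  UniformSpace.Completion.coe_mul (α := p.Space) _ _

theorem toCompl_add (a b : F) : p.toCompl (a + b) = p.toCompl a + p.toCompl b :=
  UniformSpace.Completion.coe_add (α := p.Space) _ _

theorem toCompl_sub (a b : F) : p.toCompl (a - b) = p.toCompl a - p.toCompl b :=
  UniformSpace.Completion.coe_sub (α := p.Space) _ _

theorem toCompl_one : p.toCompl 1 = 1 := rfl

theorem toCompl_zero : p.toCompl 0 = 0 := rfl

theorem toCompl_smul (r : ℂ) (a : F) : p.toCompl (r • a) = r • p.toCompl a := by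
  rw [Algebra.smul_def, Algebra.smul_def, toCompl_mul]
  rfl

instance : Star p.Compl := ⟨UniformSpace.Completion.map (star : p.Space → p.Space)⟩

theorem uniformContinuous_star_space : UniformContinuous (star : p.Space → p.Space) :=
  (star_isometry (E := p.Space)).uniformContinuous

theorem star_toCompl (a : F) : star (p.toCompl a) = p.toCompl (star a) :=
  UniformSpace.Completion.map_coe p.uniformContinuous_star_space _

theorem continuous_star_compl : Continuous (star : p.Compl → p.Compl) :=
  UniformSpace.Completion.continuous_map

instance : ContinuousStar p.Compl := ⟨p.continuous_star_compl⟩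

instance : StarRing p.Compl where
  star_involutive x := by
    induction x using p.induction_on with
    | hc => exact isClosed_eq (by fun_prop) (by fun_prop)
    | h a => rw [star_toCompl, star_toCompl, star_star]
  star_mul x y := by
    induction x using p.induction_on with
    | hc => exact isClosed_eq (by fun_prop) (by fun_prop)
    | h a =>
      induction y using p.induction_on with
      | hc => exact isClosed_eq (by fun_prop) (by fun_prop)
      | h b => simp only [← toCompl_mul, star_toCompl, star_mul]
  star_add x y := by
    induction x using p.induction_on with
    | hc => exact isClosed_eq (by fun_prop) (by fun_prop)
    | h a =>
      induction y using p.induction_on with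
      | hc => exact isClosed_eq (by fun_prop) (by fun_prop)
      | h b => simp only [← toCompl_add, star_toCompl, star_add]

instance [StarModule ℂ F] : StarModule ℂ p.Compl where
  star_smul r x := by
    have h : star (algebraMap ℂ p.Compl r) = algebraMap ℂ p.Compl (star r) := by
      change star (p.toCompl (algebraMap ℂ F r)) = p.toCompl (algebraMap ℂ F (star r))
      rw [star_toCompl, algebraMap_star_comm]
    rw [Algebra.smul_def, star_mul, h, Algebra.smul_def, Algebra.commutes]

instance : CStarRing p.Compl where
  norm_mul_self_le x := by
    induction x using p.induction_on with
    | hc => exact isClosed_le (by fun_prop) (by fun_prop)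
    | h a => rw [star_toCompl, ← toCompl_mul, norm_toCompl, norm_toCompl, star_mul_self]

/-- The separated completion of a complex `*`-algebra in a `C*`-seminorm is a `C*`-algebra. -/
instance [StarModule ℂ F] : CStarAlgebra p.Compl where

end CStarSeminorm

/-! ### The `C*`-algebra of the anyonic quantum permutation group -/

/-- `ω ^ a` for a residue `a` modulo `N` (meaningful since `ω ^ N = 1`). -/
def zpw {N : ℕ} (ω : ℂ) (a : ZMod N) : ℂ := ω ^ a.val

/-- The free `*`-algebra on letters `q i j`, `i j ∈ ℤ/N`. -/
abbrev FreeQ (N : ℕ) : Type := FreeStarAlg (ZMod N × ZMod N)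

/-- The letter `q i j`. -/
def fq {N : ℕ} (i j : ZMod N) : FreeQ N := FreeStarAlg.gen (i, j)

/-- The defining relations of the anyonic quantum permutation group; `AnyonicRel N ω x y` says
that `x = y` is one of them. -/
inductive AnyonicRel (N : ℕ) [NeZero N] (ω : ℂ) : FreeQ N → FreeQ N → Prop
  | zero_left (i : ZMod N) : AnyonicRel N ω (fq 0 i) (if i = 0 then 1 else 0)
  | zero_right (i : ZMod N) : AnyonicRel N ω (fq i 0) (if i = 0 then 1 else 0)
  | adj (i j : ZMod N) :
      AnyonicRel N ω (star (fq i j)) (zpw ω (-(i * (i - j))) • fq (-i) (-j))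
  | right (i j k : ZMod N) :
      AnyonicRel N ω (fq k (i + j))
        (∑ l : ZMod N, zpw ω (-(l * (i - k + l))) • (fq (k - l) i * fq l j))
  | left (i j k : ZMod N) :
      AnyonicRel N ω (fq (i + j) k)
        (∑ l : ZMod N, zpw ω (-(i * (l - j))) • (fq j l * fq i (k - l)))

/-- The `C*`-seminorms on the universal `*`-algebra with generators `q i j` and the defining
relations, i.e. those on the free `*`-algebra that respect the relations. -/
def AnyonicSeminorm (N : ℕ) [NeZero N] (ω : ℂ) : Type :=
  {p : CStarSeminorm (FreeQ N) // ∀ x y, AnyonicRel N ω x y → p.toSeminorm (x - y) = 0}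

namespace AnyonicSeminorm

theorem one_le_one {N : ℕ} (p : CStarSeminorm (FreeQ N)) : p.toSeminorm 1 ≤ 1 := by
  have h := p.star_mul_self 1
  rw [star_one, one_mul] at h
  nlinarith [apply_nonneg p.toSeminorm 1]

variable {N : ℕ} [NeZero N] {ω : ℂ}

theorem toCompl_eq (p : AnyonicSeminorm N ω) {x y : FreeQ N} (h : AnyonicRel N ω x y) :
    p.1.toCompl x = p.1.toCompl y := by
  rw [← sub_eq_zero, ← CStarSeminorm.toCompl_sub, ← norm_eq_zero, CStarSeminorm.norm_toCompl]
  exact p.2 x y h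

theorem toCompl_sum (p : CStarSeminorm (FreeQ N)) (f : ZMod N → FreeQ N) :
    p.toCompl (∑ l, f l) = ∑ l, p.toCompl (f l) :=
  map_sum (⟨⟨p.toCompl, p.toCompl_zero⟩, p.toCompl_add⟩ : FreeQ N →+ p.Compl) f Finset.univ

/-- The columns of `q` have length one. -/
theorem sum_star_mul (p : AnyonicSeminorm N ω) (i : ZMod N) :
    ∑ k, star (p.1.toCompl (fq k i)) * p.1.toCompl (fq k i) = 1 := by
  have h := p.toCompl_eq (AnyonicRel.right (ω := ω) (-i) i 0)
  rw [neg_add_cancel, p.toCompl_eq (AnyonicRel.zero_left 0), if_pos rfl, toCompl_sum] at h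
  rw [← p.1.toCompl_one, h]
  refine Finset.sum_congr rfl fun k _ => ?_
  rw [CStarSeminorm.star_toCompl, p.toCompl_eq (AnyonicRel.adj k i), ← CStarSeminorm.toCompl_mul,
    smul_mul_assoc]
  congr 4 <;> ring

theorem norm_le_one_of_sum {A : Type} [CStarAlgebra A] (a : ZMod N → A)
    (h : ∑ k, star (a k) * a k = 1) (k : ZMod N) : ‖a k‖ ≤ 1 := by
  let _ := CStarAlgebra.spectralOrder A
  have := CStarAlgebra.spectralOrderedRing A
  have h1 : star (a k) * a k ≤ 1 := by
    rw [← h]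
    exact Finset.single_le_sum (f := fun k => star (a k) * a k)
      (fun i _ => star_mul_self_nonneg (a i)) (Finset.mem_univ k)
  have h2 : ‖star (a k) * a k‖ ≤ 1 :=
    (CStarAlgebra.norm_le_one_iff_of_nonneg _ (star_mul_self_nonneg (a k))).mpr h1
  rw [CStarRing.norm_star_mul_self] at h2
  nlinarith [norm_nonneg (a k)]

theorem fq_le_one (p : AnyonicSeminorm N ω) (i j : ZMod N) : p.1.toSeminorm (fq i j) ≤ 1 := by
  rw [← CStarSeminorm.norm_toCompl]
  exact norm_le_one_of_sum (fun k => p.1.toCompl (fq k j)) (p.sum_star_mul j) i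

theorem bddAbove (x : FreeQ N) :
    BddAbove (Set.range fun p : AnyonicSeminorm N ω => p.1.toSeminorm x) := by
  suffices h : ∃ C : ℝ, ∀ p : AnyonicSeminorm N ω, p.1.toSeminorm x ≤ C by
    obtain ⟨C, hC⟩ := h
    exact ⟨C, by rintro _ ⟨p, rfl⟩; exact hC p⟩
  induction x using FreeStarAlg.induction with
  | scalar r =>
    refine ⟨‖r‖, fun p => ?_⟩
    rw [Algebra.algebraMap_eq_smul_one, map_smul_eq_mul]
    exact mul_le_of_le_one_right (norm_nonneg r) (one_le_one p.1)
  | letter x =>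
    refine ⟨1, fun p => ?_⟩
    rcases x with x | x
    · exact p.fq_le_one x.1 x.2
    · have h : FreeStarAlg.letter (Sum.inr x) = star (fq x.1 x.2) :=
        (FreeStarAlg.star_letter (Sum.inl x)).symm
      rw [h, p.1.map_star]
      exact p.fq_le_one x.1 x.2
  | mul a b ha hb =>
    obtain ⟨A, hA⟩ := ha
    obtain ⟨B, hB⟩ := hb
    exact ⟨A * B, fun p => (p.1.mul_le a b).trans (mul_le_mul (hA p) (hB p) (apply_nonneg _ _)
      ((apply_nonneg _ _).trans (hA p)))⟩
  | add a b ha hb =>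
    obtain ⟨A, hA⟩ := ha
    obtain ⟨B, hB⟩ := hb
    exact ⟨A + B, fun p => (map_add_le_add p.1.toSeminorm a b).trans (add_le_add (hA p) (hB p))⟩

/-- The zero seminorm. -/
instance : Nonempty (AnyonicSeminorm N ω) :=
  ⟨⟨{ (0 : Seminorm ℂ (FreeQ N)) with
      mul_le' := fun _ _ => (mul_zero (0 : ℝ)).ge
      star_mul_self' := fun _ => (mul_zero (0 : ℝ)).symm }, fun _ _ _ => rfl⟩⟩

end AnyonicSeminorm

/-- The largest `C*`-seminorm on the universal `*`-algebra with generators `q i j` and the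
defining relations of the anyonic quantum permutation group. -/
def maxSeminorm (N : ℕ) [NeZero N] (ω : ℂ) : CStarSeminorm (FreeQ N) where
  toFun x := ⨆ p : AnyonicSeminorm N ω, p.1.toSeminorm x
  map_zero' := by simp
  add_le' x y := ciSup_le fun p => (map_add_le_add p.1.toSeminorm x y).trans
    (add_le_add (le_ciSup (AnyonicSeminorm.bddAbove x) p) (le_ciSup (AnyonicSeminorm.bddAbove y) p))
  neg' x := by simp
  smul' r x := by
    simp only [map_smul_eq_mul]
    exact (Real.mul_iSup_of_nonneg (norm_nonneg r) _).symm
  mul_le' x y := ciSup_le fun p => (p.1.mul_le x y).trans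
    (mul_le_mul (le_ciSup (AnyonicSeminorm.bddAbove x) p) (le_ciSup (AnyonicSeminorm.bddAbove y) p)
      (apply_nonneg _ _) (Real.iSup_nonneg fun p => apply_nonneg _ _))
  star_mul_self' x := by
    have h0 : 0 ≤ ⨆ p : AnyonicSeminorm N ω, p.1.toSeminorm x :=
      Real.iSup_nonneg fun p => apply_nonneg _ _
    apply le_antisymm
    · refine ciSup_le fun p => ?_
      rw [p.1.star_mul_self]
      have h := le_ciSup (AnyonicSeminorm.bddAbove (ω := ω) x) p
      exact mul_le_mul h h (apply_nonneg _ _) h0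
    · rw [Real.mul_iSup_of_nonneg h0]
      refine ciSup_le fun p => ?_
      rw [mul_comm, Real.mul_iSup_of_nonneg (apply_nonneg _ _)]
      refine ciSup_le fun p' => ?_
      rcases le_total (p.1.toSeminorm x) (p'.1.toSeminorm x) with h | h
      · refine le_trans (mul_le_mul_of_nonneg_right h (apply_nonneg _ _)) ?_
        rw [← p'.1.star_mul_self]
        exact le_ciSup (AnyonicSeminorm.bddAbove (ω := ω) (star x * x)) p'
      · refine le_trans (mul_le_mul_of_nonneg_left h (apply_nonneg _ _)) ?_
        rw [← p.1.star_mul_self]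
        exact le_ciSup (AnyonicSeminorm.bddAbove (ω := ω) (star x * x)) p

/-- The universal unital `C*`-algebra `C(S_N⁺(R))` with generators `q i j` and the defining
relations of the anyonic quantum permutation group. -/
def CS (N : ℕ) [NeZero N] (ω : ℂ) : Type := (maxSeminorm N ω).Compl

instance (N : ℕ) [NeZero N] (ω : ℂ) : CStarAlgebra (CS N ω) :=
  inferInstanceAs (CStarAlgebra (maxSeminorm N ω).Compl)

/-- The canonical generators `q i j` of `C(S_N⁺(R))`. -/
def q {N : ℕ} [NeZero N] (ω : ℂ) (i j : ZMod N) : CS N ω := (maxSeminorm N ω).toCompl (fq i j)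

theorem CS.induction {N : ℕ} [NeZero N] {ω : ℂ} (S : StarSubalgebra ℂ (CS N ω))
    (hc : IsClosed (S : Set (CS N ω))) (hq : ∀ i j, q ω i j ∈ S) (a : CS N ω) : a ∈ S := by
  refine (maxSeminorm N ω).induction_on (motive := fun a => a ∈ S) a hc fun x => ?_
  induction x using FreeStarAlg.induction with
  | scalar r => exact S.algebraMap_mem r
  | letter x =>
    rcases x with x | x
    · exact hq x.1 x.2
    · have h : FreeStarAlg.letter (Sum.inr x) = star (fq x.1 x.2) :=
        (FreeStarAlg.star_letter (Sum.inl x)).symm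
      rw [h, ← CStarSeminorm.star_toCompl]
      have h' : star (q ω x.1 x.2) ∈ S := star_mem (hq x.1 x.2)
      exact h'
  | mul a b ha hb =>
    rw [CStarSeminorm.toCompl_mul]
    exact mul_mem ha hb
  | add a b ha hb =>
    rw [CStarSeminorm.toCompl_add]
    exact add_mem ha hb

/-! ### Tensor products of Hilbert spaces, of operators and of concrete `C*`-algebras -/

/-- The tensor product of two Hilbert spaces: the completion of the algebraic tensor product. -/
def HTensor (H : Type u) (K : Type v) [NormedAddCommGroup H] [InnerProductSpace ℂ H]
    [NormedAddCommGroup K] [InnerProductSpace ℂ K] : Type (max u v) :=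
  UniformSpace.Completion (H ⊗[ℂ] K)

section OpTensor

variable {H H' H'' : Type*} {K K' K'' : Type*}
  [NormedAddCommGroup H] [InnerProductSpace ℂ H]
  [NormedAddCommGroup H'] [InnerProductSpace ℂ H']
  [NormedAddCommGroup H''] [InnerProductSpace ℂ H'']
  [NormedAddCommGroup K] [InnerProductSpace ℂ K]
  [NormedAddCommGroup K'] [InnerProductSpace ℂ K']
  [NormedAddCommGroup K''] [InnerProductSpace ℂ K'']

instance : NormedAddCommGroup (HTensor H K) :=
  inferInstanceAs (NormedAddCommGroup (UniformSpace.Completion (H ⊗[ℂ] K)))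

instance : InnerProductSpace ℂ (HTensor H K) :=
  inferInstanceAs (InnerProductSpace ℂ (UniformSpace.Completion (H ⊗[ℂ] K)))

instance : CompleteSpace (HTensor H K) :=
  inferInstanceAs (CompleteSpace (UniformSpace.Completion (H ⊗[ℂ] K)))

/-- The isometric inclusion of the algebraic tensor product. -/
def HTensor.incl (H K : Type*) [NormedAddCommGroup H] [InnerProductSpace ℂ H]
    [NormedAddCommGroup K] [InnerProductSpace ℂ K] : H ⊗[ℂ] K →ₗᵢ[ℂ] HTensor H K :=
  (UniformSpace.Completion.toComplₗᵢ :
    H ⊗[ℂ] K →ₗᵢ[ℂ] UniformSpace.Completion (H ⊗[ℂ] K))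

/-- The elementary tensor `x ⊗ y`. -/
def HTensor.tmul (x : H) (y : K) : HTensor H K := HTensor.incl H K (x ⊗ₜ[ℂ] y)

/-- The tensor product `a ⊗ b` of two bounded operators. -/
def opTensor (a : H →L[ℂ] H') (b : K →L[ℂ] K') : HTensor H K →L[ℂ] HTensor H' K' :=
  ((TensorProduct.mapL a b).completion :
    UniformSpace.Completion (H ⊗[ℂ] K) →L[ℂ] UniformSpace.Completion (H' ⊗[ℂ] K'))

/-- The flip `ξ ⊗ η ↦ η ⊗ ξ`. -/
def flipOp (H K : Type*) [NormedAddCommGroup H] [InnerProductSpace ℂ H]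
    [NormedAddCommGroup K] [InnerProductSpace ℂ K] : HTensor H K →L[ℂ] HTensor K H :=
  ((TensorProduct.commIsometry ℂ H K).toLinearIsometry.toContinuousLinearMap.completion :
    UniformSpace.Completion (H ⊗[ℂ] K) →L[ℂ] UniformSpace.Completion (K ⊗[ℂ] H))

@[elab_as_elim]
theorem HTensor.induction {motive : HTensor H K → Prop} (v : HTensor H K)
    (closed : IsClosed {v | motive v}) (zero : motive 0)
    (tmul : ∀ (x : H) (y : K), motive (HTensor.tmul x y))
    (add : ∀ v w, motive v → motive w → motive (v + w)) : motive v := by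
  refine UniformSpace.Completion.induction_on (α := H ⊗[ℂ] K) v closed fun v => ?_
  change motive (HTensor.incl H K v)
  induction v with
  | zero => rw [map_zero]; exact zero
  | tmul x y => exact tmul x y
  | add v w hv hw => rw [map_add]; exact add _ _ hv hw

theorem HTensor.inner_tmul (x x' : H) (y y' : K) :
    inner ℂ (HTensor.tmul x y) (HTensor.tmul x' y') = inner ℂ x x' * inner ℂ y y' := by
  rw [HTensor.tmul, HTensor.tmul, LinearIsometry.inner_map_map, TensorProduct.inner_tmul]

theorem HTensor.ext {L : Type*} [NormedAddCommGroup L] [InnerProductSpace ℂ L]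
    {S T : HTensor H K →L[ℂ] L}
    (h : ∀ (x : H) (y : K), S (HTensor.tmul x y) = T (HTensor.tmul x y)) : S = T := by
  refine ContinuousLinearMap.ext fun v => ?_
  induction v using HTensor.induction with
  | closed => exact isClosed_eq S.continuous T.continuous
  | zero => simp
  | tmul x y => exact h x y
  | add v w hv hw => rw [map_add, map_add, hv, hw]

@[simp] theorem opTensor_tmul (a : H →L[ℂ] H') (b : K →L[ℂ] K') (x : H) (y : K) :
    opTensor a b (HTensor.tmul x y) = HTensor.tmul (a x) (b y) :=
  (TensorProduct.mapL a b).completion_apply_coe (x ⊗ₜ[ℂ] y)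

@[simp] theorem flipOp_tmul (x : H) (y : K) :
    flipOp H K (HTensor.tmul x y) = HTensor.tmul y x :=
  (TensorProduct.commIsometry ℂ H K).toLinearIsometry.toContinuousLinearMap.completion_apply_coe
    (x ⊗ₜ[ℂ] y)

theorem opTensor_comp (a : H' →L[ℂ] H'') (a' : H →L[ℂ] H') (b : K' →L[ℂ] K'') (b' : K →L[ℂ] K') :
    opTensor a b ∘L opTensor a' b' = opTensor (a ∘L a') (b ∘L b') :=
  HTensor.ext fun x y => by simp

theorem opTensor_mul (a a' : H →L[ℂ] H) (b b' : K →L[ℂ] K) :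
    opTensor a b * opTensor a' b' = opTensor (a * a') (b * b') :=
  opTensor_comp a a' b b'

theorem opTensor_one : opTensor (1 : H →L[ℂ] H) (1 : K →L[ℂ] K) = 1 :=
  HTensor.ext fun x y => by simp

theorem opTensor_flipOp (a : H →L[ℂ] H') (b : K →L[ℂ] K') :
    flipOp H' K' ∘L opTensor a b = opTensor b a ∘L flipOp H K :=
  HTensor.ext fun x y => by simp

theorem star_opTensor [CompleteSpace H] [CompleteSpace K] (a : H →L[ℂ] H) (b : K →L[ℂ] K) :
    star (opTensor a b) = opTensor (star a) (star b) := by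
  symm
  rw [ContinuousLinearMap.star_eq_adjoint (opTensor a b), ContinuousLinearMap.eq_adjoint_iff]
  intro v w
  induction v using HTensor.induction with
  | closed => exact isClosed_eq (by fun_prop) (by fun_prop)
  | zero => simp
  | add v v' hv hv' => rw [map_add, inner_add_left, inner_add_left, hv, hv']
  | tmul x y =>
    induction w using HTensor.induction with
    | closed => exact isClosed_eq (by fun_prop) (by fun_prop)
    | zero => simp
    | add w w' hw hw' => rw [map_add, inner_add_right, inner_add_right, hw, hw']
    | tmul x' y' =>
      simp [ContinuousLinearMap.star_eq_adjoint, ContinuousLinearMap.adjoint_inner_left,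
        HTensor.inner_tmul]

/-- The tensor product of two unitaries. -/
def unitaryTensor [CompleteSpace H] [CompleteSpace K] (u : unitary (H →L[ℂ] H))
    (w : unitary (K →L[ℂ] K)) : unitary (HTensor H K →L[ℂ] HTensor H K) :=
  ⟨opTensor (u : H →L[ℂ] H) (w : K →L[ℂ] K), by
    rw [Unitary.mem_iff, star_opTensor, opTensor_mul, opTensor_mul,
      Unitary.star_mul_self_of_mem u.2, Unitary.star_mul_self_of_mem w.2,
      Unitary.mul_star_self_of_mem u.2, Unitary.mul_star_self_of_mem w.2, opTensor_one]
    exact ⟨rfl, rfl⟩⟩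

/-- The minimal tensor product `A ⊗ B` of two concrete unital `C*`-algebras: the `C*`-algebra of
operators generated by the elementary tensors `a ⊗ b`. -/
def minTensor [CompleteSpace H] [CompleteSpace K] (A : StarSubalgebra ℂ (H →L[ℂ] H))
    (B : StarSubalgebra ℂ (K →L[ℂ] K)) : StarSubalgebra ℂ (HTensor H K →L[ℂ] HTensor H K) :=
  (StarAlgebra.adjoin ℂ
    {T | ∃ a ∈ A, ∃ b ∈ B, T = opTensor a b}).topologicalClosure

/-- The elementary tensor `a ⊗ b` as an element of the minimal tensor product. -/
def minTensor.tmul [CompleteSpace H] [CompleteSpace K] {A : StarSubalgebra ℂ (H →L[ℂ] H)}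
    {B : StarSubalgebra ℂ (K →L[ℂ] K)} (a : A) (b : B) : minTensor A B :=
  ⟨opTensor (a : H →L[ℂ] H) (b : K →L[ℂ] K), StarSubalgebra.le_topologicalClosure _
    (StarAlgebra.subset_adjoin ℂ _ ⟨a, a.2, b, b.2, rfl⟩)⟩

end OpTensor

/-! ### `ℤ/N`-`C*`-algebras and the braided tensor product -/

theorem conj_mem_closure {A : Type*} [CStarAlgebra A] (S : Set A) (w : unitary A)
    (h : ∀ a ∈ S, Unitary.conjStarAlgAut ℂ A w a ∈
      (StarAlgebra.adjoin ℂ S).topologicalClosure) (a : A)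
    (ha : a ∈ (StarAlgebra.adjoin ℂ S).topologicalClosure) :
    Unitary.conjStarAlgAut ℂ A w a ∈ (StarAlgebra.adjoin ℂ S).topologicalClosure := by
  have hφ : Continuous ((Unitary.conjStarAlgAut ℂ A w : A →⋆ₐ[ℂ] A)) := by
    change Continuous fun a : A => (w : A) * a * ((star w : unitary A) : A)
    fun_prop
  suffices h' : (StarAlgebra.adjoin ℂ S).topologicalClosure ≤
      ((StarAlgebra.adjoin ℂ S).topologicalClosure).comap
        (Unitary.conjStarAlgAut ℂ A w : A →⋆ₐ[ℂ] A) from h' ha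
  exact StarSubalgebra.topologicalClosure_minimal (StarAlgebra.adjoin_le h)
    ((StarSubalgebra.isClosed_topologicalClosure _).preimage hφ)

/-- A `ℤ/N`-`C*`-algebra, given together with a faithful equivariant representation: a unital
`C*`-algebra `A` of operators on a Hilbert space `H` and a unitary representation `U` of `ℤ/N` on
`H` with `U t A (U t)* ⊆ A`. The `ℤ/N`-action is `ρ_t(a) = U t a (U t)*`. -/
structure ZNAlg (N : ℕ) where
  H : Type u
  [normedAddCommGroup : NormedAddCommGroup H]
  [innerProductSpace : InnerProductSpace ℂ H]
  [completeSpace : CompleteSpace H]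
  U : Multiplicative (ZMod N) →* unitary (H →L[ℂ] H)
  A : StarSubalgebra ℂ (H →L[ℂ] H)
  isClosed : IsClosed (A : Set (H →L[ℂ] H))
  conj_mem : ∀ t, ∀ a ∈ A, Unitary.conjStarAlgAut ℂ (H →L[ℂ] H) (U t) a ∈ A

attribute [instance] ZNAlg.normedAddCommGroup ZNAlg.innerProductSpace ZNAlg.completeSpace

namespace ZNAlg

variable {N : ℕ}

/-- The action `ρ_t(a) = U t a (U t)*` of `t ∈ ℤ/N`. -/
def act (X : ZNAlg.{u} N) (t : ZMod N) (a : X.A) : X.A :=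
  ⟨Unitary.conjStarAlgAut ℂ (X.H →L[ℂ] X.H) (X.U (Multiplicative.ofAdd t)) a,
    X.conj_mem _ a a.2⟩

/-- The operator `j₁(x) = x ⊗ 1`. -/
def opj₁ (X : ZNAlg.{u} N) (Y : ZNAlg.{v} N) (x : X.H →L[ℂ] X.H) :
    HTensor X.H Y.H →L[ℂ] HTensor X.H Y.H :=
  opTensor x 1

theorem conj_opj₁ (X : ZNAlg.{u} N) (Y : ZNAlg.{v} N) (t : Multiplicative (ZMod N))
    (x : X.H →L[ℂ] X.H) :
    Unitary.conjStarAlgAut ℂ _ (unitaryTensor (X.U t) (Y.U t)) (opj₁ X Y x)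
      = opj₁ X Y (Unitary.conjStarAlgAut ℂ _ (X.U t) x) := by
  rw [Unitary.conjStarAlgAut_apply, Unitary.conjStarAlgAut_apply]
  simp only [opj₁, unitaryTensor, star_opTensor, opTensor_mul, mul_one,
    Unitary.mul_star_self_of_mem (Y.U t).2]

variable [NeZero N] (ω : ℂ)

/-- The orthogonal projection of `H` onto the eigenspace
`{ξ | U t ξ = ω ^ (t * m) ξ for all t}`. -/
def proj (X : ZNAlg.{u} N) (m : ZMod N) : X.H →L[ℂ] X.H :=
  (N : ℂ)⁻¹ • ∑ t : ZMod N, zpw ω (-(t * m)) •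
    (X.U (Multiplicative.ofAdd t) : X.H →L[ℂ] X.H)

/-- The braiding unitary `c : H_X ⊗ H_Y → H_Y ⊗ H_X`, `ξ ⊗ η ↦ ω ^ (m * n) η ⊗ ξ` for eigenvectors
`ξ`, `η` of weights `m`, `n`. -/
def braid (X : ZNAlg.{u} N) (Y : ZNAlg.{v} N) : HTensor X.H Y.H →L[ℂ] HTensor Y.H X.H :=
  (∑ m : ZMod N, ∑ n : ZMod N, zpw ω (m * n) • opTensor (Y.proj ω n) (X.proj ω m)) ∘L
    flipOp X.H Y.H

/-- The dual braiding unitary `H_Y ⊗ H_X → H_X ⊗ H_Y`, `η ⊗ ξ ↦ ω ^ (-(m * n)) ξ ⊗ η` for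
eigenvectors `ξ`, `η` of weights `m`, `n`. -/
def dualBraid (X : ZNAlg.{u} N) (Y : ZNAlg.{v} N) : HTensor Y.H X.H →L[ℂ] HTensor X.H Y.H :=
  (∑ m : ZMod N, ∑ n : ZMod N, zpw ω (-(m * n)) • opTensor (X.proj ω m) (Y.proj ω n)) ∘L
    flipOp Y.H X.H

/-- The operator `j₂(y) = c* (y ⊗ 1) c`. -/
def opj₂ (X : ZNAlg.{u} N) (Y : ZNAlg.{v} N) (y : Y.H →L[ℂ] Y.H) :
    HTensor X.H Y.H →L[ℂ] HTensor X.H Y.H :=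
  dualBraid ω X Y ∘L opTensor y 1 ∘L braid ω X Y

/-- The operators generating the braided tensor product. -/
def boxGens (X : ZNAlg.{u} N) (Y : ZNAlg.{v} N) : Set (HTensor X.H Y.H →L[ℂ] HTensor X.H Y.H) :=
  {T | (∃ x ∈ X.A, T = opj₁ X Y x) ∨ ∃ y ∈ Y.A, T = opj₂ ω X Y y}

theorem proj_comm (X : ZNAlg.{u} N) (t : Multiplicative (ZMod N)) (m : ZMod N) :
    (X.U t : X.H →L[ℂ] X.H) * X.proj ω m = X.proj ω m * (X.U t : X.H →L[ℂ] X.H) := by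
  simp only [proj, mul_smul_comm, smul_mul_assoc, Finset.mul_sum, Finset.sum_mul]
  congr 1
  refine Finset.sum_congr rfl fun s _ => ?_
  rw [← Submonoid.coe_mul, ← Submonoid.coe_mul, ← map_mul, ← map_mul,
    mul_comm t (Multiplicative.ofAdd s)]

theorem dualBraid_comm (X : ZNAlg.{u} N) (Y : ZNAlg.{v} N) (t : Multiplicative (ZMod N)) :
    opTensor (X.U t : X.H →L[ℂ] X.H) (Y.U t : Y.H →L[ℂ] Y.H) ∘L dualBraid ω X Y
      = dualBraid ω X Y ∘L opTensor (Y.U t : Y.H →L[ℂ] Y.H) (X.U t : X.H →L[ℂ] X.H) := by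
  rw [dualBraid, ContinuousLinearMap.comp_assoc, opTensor_flipOp,
    ← ContinuousLinearMap.comp_assoc, ← ContinuousLinearMap.comp_assoc]
  congr 1
  simp only [← ContinuousLinearMap.mul_def, Finset.mul_sum, Finset.sum_mul, mul_smul_comm,
    smul_mul_assoc, opTensor_mul, proj_comm]

theorem braid_comm (X : ZNAlg.{u} N) (Y : ZNAlg.{v} N) (t : Multiplicative (ZMod N)) :
    opTensor (Y.U t : Y.H →L[ℂ] Y.H) (X.U t : X.H →L[ℂ] X.H) ∘L braid ω X Y
      = braid ω X Y ∘L opTensor (X.U t : X.H →L[ℂ] X.H) (Y.U t : Y.H →L[ℂ] Y.H) := by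
  rw [braid, ContinuousLinearMap.comp_assoc, opTensor_flipOp,
    ← ContinuousLinearMap.comp_assoc, ← ContinuousLinearMap.comp_assoc]
  congr 1
  simp only [← ContinuousLinearMap.mul_def, Finset.mul_sum, Finset.sum_mul, mul_smul_comm,
    smul_mul_assoc, opTensor_mul, proj_comm]

theorem conj_opj₂ (X : ZNAlg.{u} N) (Y : ZNAlg.{v} N) (t : Multiplicative (ZMod N))
    (y : Y.H →L[ℂ] Y.H) :
    Unitary.conjStarAlgAut ℂ _ (unitaryTensor (X.U t) (Y.U t)) (opj₂ ω X Y y)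
      = opj₂ ω X Y (Unitary.conjStarAlgAut ℂ _ (Y.U t) y) := by
  have h : (unitaryTensor (X.U t) (Y.U t) : HTensor X.H Y.H →L[ℂ] HTensor X.H Y.H)
      * opj₂ ω X Y y = opj₂ ω X Y (Unitary.conjStarAlgAut ℂ _ (Y.U t) y)
        * (unitaryTensor (X.U t) (Y.U t) : HTensor X.H Y.H →L[ℂ] HTensor X.H Y.H) := by
    change opTensor _ _ ∘L (dualBraid ω X Y ∘L opTensor y 1 ∘L braid ω X Y)
      = (dualBraid ω X Y ∘L opTensor _ 1 ∘L braid ω X Y) ∘L opTensor _ _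
    rw [← ContinuousLinearMap.comp_assoc, dualBraid_comm, ContinuousLinearMap.comp_assoc,
      ContinuousLinearMap.comp_assoc, ContinuousLinearMap.comp_assoc, ← braid_comm,
      ← ContinuousLinearMap.comp_assoc (opTensor _ _) (opTensor y 1),
      ← ContinuousLinearMap.comp_assoc (opTensor _ 1) (opTensor _ _), opTensor_comp,
      opTensor_comp, Unitary.conjStarAlgAut_apply]
    congr 3
    simp only [← ContinuousLinearMap.mul_def, mul_assoc, Unitary.star_mul_self_of_mem (Y.U t).2,
      mul_one]
  rw [Unitary.conjStarAlgAut_apply, h, mul_assoc,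
    Unitary.mul_star_self_of_mem (unitaryTensor (X.U t) (Y.U t)).2, mul_one]

/-- The `C*`-algebra of operators underlying the braided tensor product, generated by the products
`j₁(x) j₂(y)`; equivalently, as `X` and `Y` are unital, by all `j₁(x)` and `j₂(y)`. -/
def boxAlg (X : ZNAlg.{u} N) (Y : ZNAlg.{v} N) :
    StarSubalgebra ℂ (HTensor X.H Y.H →L[ℂ] HTensor X.H Y.H) :=
  (StarAlgebra.adjoin ℂ (boxGens ω X Y)).topologicalClosure

theorem opj₁_mem (X : ZNAlg.{u} N) (Y : ZNAlg.{v} N) {x : X.H →L[ℂ] X.H} (hx : x ∈ X.A) :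
    opj₁ X Y x ∈ boxAlg ω X Y :=
  StarSubalgebra.le_topologicalClosure _ (StarAlgebra.subset_adjoin ℂ _ (Or.inl ⟨x, hx, rfl⟩))

theorem opj₂_mem (X : ZNAlg.{u} N) (Y : ZNAlg.{v} N) {y : Y.H →L[ℂ] Y.H} (hy : y ∈ Y.A) :
    opj₂ ω X Y y ∈ boxAlg ω X Y :=
  StarSubalgebra.le_topologicalClosure _ (StarAlgebra.subset_adjoin ℂ _ (Or.inr ⟨y, hy, rfl⟩))

theorem boxAlg_conj_mem (X : ZNAlg.{u} N) (Y : ZNAlg.{v} N) (t : Multiplicative (ZMod N))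
    (a : HTensor X.H Y.H →L[ℂ] HTensor X.H Y.H) (ha : a ∈ boxAlg ω X Y) :
    Unitary.conjStarAlgAut ℂ _ (unitaryTensor (X.U t) (Y.U t)) a ∈ boxAlg ω X Y := by
  refine conj_mem_closure (boxGens ω X Y) _ ?_ a ha
  rintro _ (⟨x, hx, rfl⟩ | ⟨y, hy, rfl⟩)
  · rw [conj_opj₁]
    exact opj₁_mem ω X Y (X.conj_mem t x hx)
  · rw [conj_opj₂]
    exact opj₂_mem ω X Y (Y.conj_mem t y hy)

/-- The tensor product of the unitary representations of `ℤ/N`. -/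
def boxU (X : ZNAlg.{u} N) (Y : ZNAlg.{v} N) :
    Multiplicative (ZMod N) →* unitary (HTensor X.H Y.H →L[ℂ] HTensor X.H Y.H) where
  toFun t := unitaryTensor (X.U t) (Y.U t)
  map_one' := by
    rw [map_one, map_one]
    exact Subtype.ext opTensor_one
  map_mul' s t := by
    rw [map_mul, map_mul]
    exact Subtype.ext (opTensor_mul _ _ _ _).symm

/-- The braided tensor product `X ⊠ Y`: the `C*`-algebra generated by the products `j₁(x) j₂(y)`,
with the action given by the tensor product of the unitary representations, for which `j₁` and
`j₂` are equivariant. -/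
def box (X : ZNAlg.{u} N) (Y : ZNAlg.{v} N) : ZNAlg.{max u v} N where
  H := HTensor X.H Y.H
  U := boxU X Y
  A := boxAlg ω X Y
  isClosed := StarSubalgebra.isClosed_topologicalClosure _
  conj_mem := boxAlg_conj_mem ω X Y

/-- The canonical embedding `j₁ : X → X ⊠ Y`. -/
def j₁ (X : ZNAlg.{u} N) (Y : ZNAlg.{v} N) (x : X.A) : (box ω X Y).A :=
  ⟨opj₁ X Y x, opj₁_mem ω X Y x.2⟩

/-- The canonical embedding `j₂ : Y → X ⊠ Y`. -/
def j₂ (X : ZNAlg.{u} N) (Y : ZNAlg.{v} N) (y : Y.A) : (box ω X Y).A :=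
  ⟨opj₂ ω X Y y, opj₂_mem ω X Y y.2⟩

end ZNAlg

/-! ### The `ℤ/N`-`C*`-algebras `C(ℤ/N)` and `C(S_N⁺(R))` -/

section CZ

variable (N : ℕ) [NeZero N]

/-- The representation of `C(ℤ/N)` on `ℓ²(ℤ/N)` by pointwise multiplication. -/
def mulOp : (ZMod N → ℂ) →⋆ₐ[ℂ]
    (EuclideanSpace ℂ (ZMod N) →L[ℂ] EuclideanSpace ℂ (ZMod N)) where
  toFun f := Matrix.toEuclideanCLM (𝕜 := ℂ) (Matrix.diagonal f)
  map_one' := by rw [Matrix.diagonal_one', map_one]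
  map_mul' f g := by
    rw [← map_mul, Matrix.diagonal_mul_diagonal]
    rfl
  map_zero' := by rw [Matrix.diagonal_zero', map_zero]
  map_add' f g := by
    rw [← map_add, Matrix.diagonal_add]
    rfl
  commutes' r := by
    rw [← AlgHomClass.commutes (Matrix.toEuclideanCLM (n := ZMod N) (𝕜 := ℂ)) r]
    rfl
  map_star' f := by rw [← map_star, Matrix.star_eq_conjTranspose, Matrix.diagonal_conjTranspose]

theorem mulOp_apply (f : ZMod N → ℂ) (ξ : EuclideanSpace ℂ (ZMod N)) (s : ZMod N) :
    mulOp N f ξ s = f s * ξ s := by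
  change (Matrix.diagonal f).mulVec ξ s = _
  rw [Matrix.mulVec_diagonal]

/-- The regular representation `(U t ξ)(s) = ξ(s + t)` of `ℤ/N` on `ℓ²(ℤ/N)`. -/
def regU : Multiplicative (ZMod N) →*
    unitary (EuclideanSpace ℂ (ZMod N) →L[ℂ] EuclideanSpace ℂ (ZMod N)) :=
  (Unitary.linearIsometryEquiv (𝕜 := ℂ)
    (H := EuclideanSpace ℂ (ZMod N))).symm.toMonoidHom.comp
    { toFun := fun t => LinearIsometryEquiv.piLpCongrLeft 2 ℂ ℂ (Equiv.subRight t.toAdd)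
      map_one' := by
        ext ξ s
        simp [LinearIsometryEquiv.piLpCongrLeft_apply]
      map_mul' := fun t t' => by
        ext ξ s
        simp [LinearIsometryEquiv.piLpCongrLeft_apply, add_assoc] }

theorem regU_apply (t : Multiplicative (ZMod N)) (ξ : EuclideanSpace ℂ (ZMod N)) (s : ZMod N) :
    (regU N t : EuclideanSpace ℂ (ZMod N) →L[ℂ] EuclideanSpace ℂ (ZMod N)) ξ s
      = ξ (s + t.toAdd) := rfl

theorem regU_conj (t : Multiplicative (ZMod N)) (f : ZMod N → ℂ) :
    Unitary.conjStarAlgAut ℂ _ (regU N t) (mulOp N f) = mulOp N (fun s => f (s + t.toAdd)) := by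
  have h : (regU N t : EuclideanSpace ℂ (ZMod N) →L[ℂ] EuclideanSpace ℂ (ZMod N)) * mulOp N f
      = mulOp N (fun s => f (s + t.toAdd)) * regU N t := by
    refine ContinuousLinearMap.ext fun ξ => PiLp.ext fun s => ?_
    rw [mul_apply_eq_comp, mul_apply_eq_comp, regU_apply, mulOp_apply,
      mulOp_apply, regU_apply]
  rw [Unitary.conjStarAlgAut_apply, h, mul_assoc, Unitary.mul_star_self_of_mem (regU N t).2,
    mul_one]

/-- The `ℤ/N`-`C*`-algebra `C(ℤ/N)`, acting on `ℓ²(ℤ/N)` by pointwise multiplication, with the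
action by translations `ρ_t(f)(s) = f(s + t)`, i.e. the coaction given by the comultiplication. -/
def CZ : ZNAlg.{0} N where
  H := EuclideanSpace ℂ (ZMod N)
  U := regU N
  A := (mulOp N).range
  isClosed := Submodule.closed_of_finiteDimensional
    (mulOp N).range.toSubalgebra.toSubmodule
  conj_mem := by
    rintro t _ ⟨f, rfl⟩
    exact ⟨_, (regU_conj N t f).symm⟩

/-- A function on `ℤ/N` as an element of `C(ℤ/N)`. -/
def CZ.ofFun (f : ZMod N → ℂ) : (CZ N).A := ⟨mulOp N f, ⟨f, rfl⟩⟩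

/-- The function `δ_t` on `ℤ/N`. -/
def CZ.delta (t : ZMod N) : (CZ N).A := CZ.ofFun N (fun s => if s = t then 1 else 0)

/-- The unitary generator `z` of `C(ℤ/N)`: the function `t ↦ ω ^ t`. -/
def CZ.z (ω : ℂ) : (CZ N).A := CZ.ofFun N (zpw ω)

end CZ

/-- A faithful `ℤ/N`-equivariant representation of `C(S_N⁺(R))` on a Hilbert space, where
`C(S_N⁺(R))` carries the action determined by `ρ_t(q i j) = ω ^ (t * (j - i)) q i j`. -/
structure EquivariantRep (N : ℕ) [NeZero N] (ω : ℂ) where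
  H : Type u
  [normedAddCommGroup : NormedAddCommGroup H]
  [innerProductSpace : InnerProductSpace ℂ H]
  [completeSpace : CompleteSpace H]
  U : Multiplicative (ZMod N) →* unitary (H →L[ℂ] H)
  π : CS N ω →⋆ₐ[ℂ] (H →L[ℂ] H)
  injective : Function.Injective π
  equivariant : ∀ t i j : ZMod N,
    Unitary.conjStarAlgAut ℂ (H →L[ℂ] H) (U (Multiplicative.ofAdd t)) (π (q ω i j))
      = zpw ω (t * (j - i)) • π (q ω i j)

attribute [instance] EquivariantRep.normedAddCommGroup EquivariantRep.innerProductSpace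
  EquivariantRep.completeSpace

namespace EquivariantRep

variable {N : ℕ} [NeZero N] {ω : ℂ} (L : EquivariantRep.{u} N ω)

theorem isClosed_range : IsClosed (L.π.range : Set (L.H →L[ℂ] L.H)) := by
  have h := (NonUnitalStarAlgHom.isometry L.π L.injective).isClosedEmbedding.isClosed_range
  have h' : (L.π.range : Set (L.H →L[ℂ] L.H)) = Set.range L.π := rfl
  rwa [h']

theorem conj_mem_range (t : Multiplicative (ZMod N)) (a : L.H →L[ℂ] L.H) (ha : a ∈ L.π.range) :
    Unitary.conjStarAlgAut ℂ (L.H →L[ℂ] L.H) (L.U t) a ∈ L.π.range := by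
  obtain ⟨a, rfl⟩ := ha
  let φ : CS N ω →⋆ₐ[ℂ] (L.H →L[ℂ] L.H) :=
    (Unitary.conjStarAlgAut ℂ (L.H →L[ℂ] L.H) (L.U t) :
      (L.H →L[ℂ] L.H) →⋆ₐ[ℂ] (L.H →L[ℂ] L.H)).comp L.π
  have hφ : Continuous φ := by
    have := (NonUnitalStarAlgHom.isometry L.π L.injective).continuous
    change Continuous fun a => (L.U t : L.H →L[ℂ] L.H) * L.π a *
      ((star (L.U t) : unitary (L.H →L[ℂ] L.H)) : L.H →L[ℂ] L.H)
    fun_prop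
  refine CS.induction (L.π.range.comap φ) (L.isClosed_range.preimage hφ) (fun i j => ?_) a
  refine ⟨zpw ω (t.toAdd * (j - i)) • q ω i j, ?_⟩
  have h := L.equivariant t.toAdd i j
  exact (map_smul L.π _ _).trans h.symm

/-- `C(S_N⁺(R))` as a `ℤ/N`-`C*`-algebra of operators. -/
def alg : ZNAlg.{u} N where
  H := L.H
  U := L.U
  A := L.π.range
  isClosed := L.isClosed_range
  conj_mem := L.conj_mem_range

/-- An element of `C(S_N⁺(R))` as an operator. -/
def op (a : CS N ω) : L.alg.A := ⟨L.π a, ⟨a, rfl⟩⟩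

/-! ### The bosonization -/

/-- `C(S_N⁺(R)) ⊠ C(S_N⁺(R))`. -/
abbrev double : ZNAlg.{u} N := ZNAlg.box ω L.alg L.alg

/-- `C(S_N⁺(R) ⋊ ℤ/N) = C(ℤ/N) ⊠ C(S_N⁺(R))`. -/
abbrev boson : ZNAlg.{u} N := ZNAlg.box ω (CZ N) L.alg

/-- `C(ℤ/N) ⊠ C(S_N⁺(R)) ⊠ C(S_N⁺(R))`. -/
abbrev triple : ZNAlg.{u} N := ZNAlg.box ω (CZ N) L.double

/-- The comultiplication of `S_N⁺(R)`: the unital `*`-homomorphism with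
`Δ(q i j) = ∑ k, j₁(q i k) j₂(q k j)`. -/
def IsBraidedComult (Δ : CS N ω →⋆ₐ[ℂ] L.double.A) : Prop :=
  ∀ i j, Δ (q ω i j)
    = ∑ k, ZNAlg.j₁ ω L.alg L.alg (L.op (q ω i k)) * ZNAlg.j₂ ω L.alg L.alg (L.op (q ω k j))

/-- `Φ = id ⊠ Δ`: the unital `*`-homomorphism with `Φ(j₁(x) j₂(a)) = j₁(x) j₂(Δ(a))`. -/
def IsIdBoxComult (Δ : CS N ω →⋆ₐ[ℂ] L.double.A) (Φ : L.boson.A →⋆ₐ[ℂ] L.triple.A) : Prop :=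
  ∀ (x : (CZ N).A) (a : CS N ω),
    Φ (ZNAlg.j₁ ω (CZ N) L.alg x * ZNAlg.j₂ ω (CZ N) L.alg (L.op a))
      = ZNAlg.j₁ ω (CZ N) L.double x * ZNAlg.j₂ ω (CZ N) L.double (Δ a)

/-- The unital `*`-homomorphism
`ψ : C(ℤ/N) ⊠ X ⊠ X → (C(ℤ/N) ⊠ X) ⊗ (C(ℤ/N) ⊠ X)`, `X = C(S_N⁺(R))`, with
`ψ(j₁(x)) = (j₁ ⊗ j₁)(Δ(x))`, `ψ(j₂(a)) = (j₂ ⊗ j₁)(ρ(a))` and `ψ(j₃(b)) = 1 ⊗ j₂(b)`, where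
`Δ(f) = ∑ s t, f(s + t) δ_s ⊗ δ_t` in `C(ℤ/N) ⊗ C(ℤ/N)` and
`ρ(a) = ∑ t, ρ_t(a) ⊗ δ_t` in `X ⊗ C(ℤ/N)`. -/
structure IsPsi (ψ : L.triple.A →⋆ₐ[ℂ] minTensor L.boson.A L.boson.A) : Prop where
  first : ∀ f : ZMod N → ℂ, ψ (ZNAlg.j₁ ω (CZ N) L.double (CZ.ofFun N f))
    = ∑ s, ∑ t, f (s + t) • minTensor.tmul (ZNAlg.j₁ ω (CZ N) L.alg (CZ.delta N s))
        (ZNAlg.j₁ ω (CZ N) L.alg (CZ.delta N t))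
  second : ∀ a : L.alg.A, ψ (ZNAlg.j₂ ω (CZ N) L.double (ZNAlg.j₁ ω L.alg L.alg a))
    = ∑ t, minTensor.tmul (ZNAlg.j₂ ω (CZ N) L.alg (L.alg.act t a))
        (ZNAlg.j₁ ω (CZ N) L.alg (CZ.delta N t))
  third : ∀ b : L.alg.A, ψ (ZNAlg.j₂ ω (CZ N) L.double (ZNAlg.j₂ ω L.alg L.alg b))
    = minTensor.tmul 1 (ZNAlg.j₂ ω (CZ N) L.alg b)

/-- The comultiplication `ψ ∘ (id ⊠ Δ)` of the bosonization `S_N⁺(R) ⋊ ℤ/N`. -/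
def IsBosonComult (D : L.boson.A →⋆ₐ[ℂ] minTensor L.boson.A L.boson.A) : Prop :=
  ∃ (Δ : CS N ω →⋆ₐ[ℂ] L.double.A) (Φ : L.boson.A →⋆ₐ[ℂ] L.triple.A)
    (ψ : L.triple.A →⋆ₐ[ℂ] minTensor L.boson.A L.boson.A),
    L.IsBraidedComult Δ ∧ L.IsIdBoxComult Δ Φ ∧ L.IsPsi ψ ∧ D = ψ.comp Φ

/-- The unitary `j₁(z)`. -/
def z : L.boson.A := ZNAlg.j₁ ω (CZ N) L.alg (CZ.z N ω)

/-- The matrix `t i j = j₁(z ^ i) j₂(q i j)`. -/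
def t : Matrix (ZMod N) (ZMod N) L.boson.A := fun i j =>
  ZNAlg.j₁ ω (CZ N) L.alg (CZ.z N ω ^ i.val) * ZNAlg.j₂ ω (CZ N) L.alg (L.op (q ω i j))

/-- The direct sum `z ⊕ t`. -/
def zt : Matrix (Unit ⊕ ZMod N) (Unit ⊕ ZMod N) L.boson.A :=
  Matrix.fromBlocks (fun _ _ => L.z) 0 0 L.t

end EquivariantRep

/-! ### Compact matrix quantum groups -/

section CMQG

variable {H : Type*} [NormedAddCommGroup H] [InnerProductSpace ℂ H] [CompleteSpace H]
  {n : Type*} [Fintype n] [DecidableEq n]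

/-- `u` is a finite-dimensional representation matrix for the comultiplication `D`:
`D(u i j) = ∑ k, u i k ⊗ u k j`. -/
def IsRepMatrix {A : StarSubalgebra ℂ (H →L[ℂ] H)} (D : A →⋆ₐ[ℂ] minTensor A A)
    (u : Matrix n n A) : Prop :=
  ∀ i j, D (u i j) = ∑ k, minTensor.tmul (u i k) (u k j)

/-- `u` is a finite-dimensional unitary representation for the comultiplication `D`. -/
def IsUnitaryRep {A : StarSubalgebra ℂ (H →L[ℂ] H)} (D : A →⋆ₐ[ℂ] minTensor A A)
    (u : Matrix n n A) : Prop :=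
  u ∈ unitary (Matrix n n A) ∧ IsRepMatrix D u

/-- The pair `(A, u)` is a compact matrix quantum group with comultiplication `D`: `A` is a unital
`C*`-algebra, the entries of the matrix `u` generate a dense `*`-subalgebra of `A`, the unital
`*`-homomorphism `D : A → A ⊗ A` satisfies `D(u i j) = ∑ k, u i k ⊗ u k j`, and the matrices `u`
and `ū = (u i j)*` are invertible. -/
structure IsCompactMatrixQuantumGroup (A : StarSubalgebra ℂ (H →L[ℂ] H))
    (D : A →⋆ₐ[ℂ] minTensor A A) (u : Matrix n n A) : Prop where
  isClosed : IsClosed (A : Set (H →L[ℂ] H))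
  dense : Dense (StarAlgebra.adjoin ℂ {a : A | ∃ i j, a = u i j} : Set A)
  rep : IsRepMatrix D u
  isUnit : IsUnit u
  isUnit_conj : IsUnit (u.map star)

end CMQG

end

/-! The action of ℤ/N splits everything into weights. Let P_m be the spectral projections and V_t
the implementing unitaries. The braiding then unfolds to j₂(y) = ∑ P_m ⊗ V_{-m} y V_m (`opj₂_eq`),
which is V_{-d} ⊗ y when y has degree d. Hence elements of degrees e and d in the two legs commute
up to the phase ω^{-de} (`j₂_mul_j₁`).

Existence of the comultiplication needs three maps. The map Δ comes from the universal property
(`AnyonicFamily.exists_hom`): the phases created by moving second-leg entries past first-leg entries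
are exactly those that make a matrix product of anyonic families anyonic again
(`AnyonicFamily.braidedMul`). For id ⊠ Δ, the Fourier basis of ℓ²(ℤ/N) turns operators on ℓ²(ℤ/N) ⊗
H into N × N matrices over the operators on H. There j₁ has scalar entries and j₂(y) is diagonal
with entries ρ_{-m}(y), so an equivariant homomorphism can be applied entrywise (`exists_id_box`); Δ
is equivariant because every term of Δ(q_{ij}) has degree j - i. Finally ψ is spatial: the
isometries `split X Y ω k` have orthogonal ranges filling (ℓ² ⊗ H_X) ⊗ (ℓ² ⊗ H_Y), and each
intertwines the generators of the triple product with their prescribed images. So ψ is an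
amplification of the identity representation (`exists_psi`).

The rest is computation on generators. One finds D(z) = z ⊗ z and D(j₂(q_{ij})) = ∑_k j₂(q_{ik}) ⊗
z^{k-i} j₂(q_{kj}) (`IsBosonComult.apply_r`), the factor z^{k-i} being the trace of the coaction.
These values determine D, and multiplying by z^i ⊗ z^i absorbs the extra factor and yields D(t_{ij})
= ∑_k t_{ik} ⊗ t_{kj}. The matrix t is diag(z^i) times the matrix of the j₂(q_{ij}), which is
unitary by the defining relations at index 0. Moreover t_{ij}* = t_{-i,-j} (`star_t_apply`), so the
conjugate of z ⊕ t is unitary as well, and j₂(q_{ij}) = z^{-i} t_{ij} gives density. -/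

noncomputable section

/-! ### Roots of unity -/

section zpw

variable {N : ℕ} {ω : ℂ}

theorem zpw_zero : zpw ω (0 : ZMod N) = 1 := by simp [zpw]

variable [NeZero N]

theorem zpw_eq_zmodChar (h : ω ^ N = 1) (a : ZMod N) : zpw ω a = AddChar.zmodChar N h a := rfl

theorem zpw_add (hω : IsPrimitiveRoot ω N) (a b : ZMod N) :
    zpw ω (a + b) = zpw ω a * zpw ω b := by
  simp only [zpw_eq_zmodChar hω.pow_eq_one, AddChar.map_add_eq_mul]

theorem zpw_neg_mul_self (hω : IsPrimitiveRoot ω N) (a : ZMod N) :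
    zpw ω (-a) * zpw ω a = 1 := by
  rw [← zpw_add hω, neg_add_cancel, zpw_zero]

theorem star_zpw (hω : IsPrimitiveRoot ω N) (a : ZMod N) : star (zpw ω a) = zpw ω (-a) := by
  have h1 : ‖zpw ω a‖ = 1 := by
    rw [zpw, norm_pow, hω.norm'_eq_one (NeZero.ne N), one_pow]
  have h2 : star (zpw ω a) * zpw ω a = 1 := by
    have := Complex.conj_mul' (zpw ω a)
    rw [h1] at this
    simpa using this
  have h3 : zpw ω a ≠ 0 := fun h => by simp [h] at h1
  exact mul_right_cancel₀ h3 (h2.trans (zpw_neg_mul_self hω a).symm)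

/-- Orthogonality of characters. Primitivity of ω makes a ↦ ω^{ab} a nontrivial character for every
b ≠ 0; all Fourier inversion below rests on this. -/
theorem sum_zpw (hω : IsPrimitiveRoot ω N) (b : ZMod N) :
    ∑ a : ZMod N, zpw ω (a * b) = if b = 0 then (N : ℂ) else 0 := by
  have := AddChar.sum_mulShift b (AddChar.zmodChar_primitive_of_primitive_root N hω)
  simp only [ZMod.card] at this
  exact_mod_cast this

end zpw

/-! ### `*`-homomorphisms of concrete `C*`-algebras -/

section StarHom

theorem StarAlgHom.continuous_of_cstar {A B : Type*} [CStarAlgebra A] [CStarAlgebra B]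
    (φ : A →⋆ₐ[ℂ] B) : Continuous φ :=
  AddMonoidHomClass.continuous_of_bound φ 1 fun a => by
    simpa using NonUnitalStarAlgHom.norm_apply_le φ a

/-- A norm-closed `*`-subalgebra is itself a C*-algebra, so the automatic contractivity of
`*`-homomorphisms applies to it. -/
theorem StarAlgHom.continuous_of_isClosed {A B : Type*} [CStarAlgebra A] [CStarAlgebra B]
    {S : StarSubalgebra ℂ A} (hS : IsClosed (S : Set A)) (φ : S →⋆ₐ[ℂ] B) : Continuous φ := by
  have : IsClosed (S : Set A) := hS
  exact StarAlgHom.continuous_of_cstar φ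

theorem StarAlgHom.continuous_of_isClosed' {A B : Type*} [CStarAlgebra A] [CStarAlgebra B]
    {S : StarSubalgebra ℂ A} (hS : IsClosed (S : Set A)) {T : StarSubalgebra ℂ B}
    (φ : S →⋆ₐ[ℂ] T) : Continuous φ :=
  continuous_induced_rng.mpr (StarAlgHom.continuous_of_isClosed hS (T.subtype.comp φ))

/-- To show that the values of a `*`-homomorphism on a generated `C*`-algebra lie in a closed
`*`-subalgebra, it suffices to look at the generators. -/
theorem StarAlgHom.mem_of_generators {A B : Type*} [CStarAlgebra A] [CStarAlgebra B] {s : Set A}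
    {C : StarSubalgebra ℂ B} (hC : IsClosed (C : Set B))
    (φ : (StarAlgebra.adjoin ℂ s).topologicalClosure →⋆ₐ[ℂ] B)
    (h : ∀ a (ha : a ∈ s), φ ⟨a, StarSubalgebra.le_topologicalClosure _
      (StarAlgebra.subset_adjoin ℂ s ha)⟩ ∈ C)
    (x : (StarAlgebra.adjoin ℂ s).topologicalClosure) : φ x ∈ C := by
  have hcl := StarSubalgebra.isClosed_topologicalClosure (StarAlgebra.adjoin ℂ s)
  have hφ := StarAlgHom.continuous_of_isClosed hcl φ
  -- The preimage of `C` is pushed back into `A`, where it is a closed `*`-subalgebra containing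
  -- `s`, so minimality of the closure applies.
  have hle : (StarAlgebra.adjoin ℂ s).topologicalClosure ≤
      (C.comap φ).map (StarSubalgebra.subtype _) := by
    refine StarSubalgebra.topologicalClosure_minimal (StarAlgebra.adjoin_le fun a ha => ?_) ?_
    · exact ⟨⟨a, _⟩, h a ha, rfl⟩
    · exact hcl.isClosedEmbedding_subtypeVal.isClosedMap _ (hC.preimage hφ)
  obtain ⟨y, hy, hyx⟩ := hle x.2
  obtain rfl : y = x := Subtype.ext hyx
  exact hy

theorem StarAlgHom.ext_of_generators {A B : Type*} [CStarAlgebra A] [CStarAlgebra B] {s : Set A}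
    {T : StarSubalgebra ℂ B} {φ ψ : (StarAlgebra.adjoin ℂ s).topologicalClosure →⋆ₐ[ℂ] T}
    (h : ∀ a (ha : a ∈ s), φ ⟨a, StarSubalgebra.le_topologicalClosure _
      (StarAlgebra.subset_adjoin ℂ s ha)⟩ = ψ ⟨a, StarSubalgebra.le_topologicalClosure _
      (StarAlgebra.subset_adjoin ℂ s ha)⟩) : φ = ψ := by
  have hcl := StarSubalgebra.isClosed_topologicalClosure (StarAlgebra.adjoin ℂ s)
  refine StarAlgHom.ext_topologicalClosure (StarAlgHom.continuous_of_isClosed' hcl φ)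
    (StarAlgHom.continuous_of_isClosed' hcl ψ) ?_
  refine StarAlgHom.ext_adjoin fun x hx => h x hx

end StarHom

/-! ### Operators on tensor products of Hilbert spaces -/

section OpTensor

variable {H H' : Type*} {K K' : Type*}
  [NormedAddCommGroup H] [InnerProductSpace ℂ H]
  [NormedAddCommGroup H'] [InnerProductSpace ℂ H']
  [NormedAddCommGroup K] [InnerProductSpace ℂ K]
  [NormedAddCommGroup K'] [InnerProductSpace ℂ K']

theorem HTensor.add_tmul (x x' : H) (y : K) :
    HTensor.tmul (x + x') y = HTensor.tmul x y + HTensor.tmul x' y := by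
  simp only [HTensor.tmul, TensorProduct.add_tmul, map_add]

theorem HTensor.tmul_add (x : H) (y y' : K) :
    HTensor.tmul x (y + y') = HTensor.tmul x y + HTensor.tmul x y' := by
  simp only [HTensor.tmul, TensorProduct.tmul_add, map_add]

theorem HTensor.smul_tmul (r : ℂ) (x : H) (y : K) :
    HTensor.tmul (r • x) y = r • HTensor.tmul x y := by
  rw [HTensor.tmul, HTensor.tmul, ← map_smul, TensorProduct.smul_tmul']

theorem HTensor.tmul_smul (r : ℂ) (x : H) (y : K) :
    HTensor.tmul x (r • y) = r • HTensor.tmul x y := by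
  simp only [HTensor.tmul, TensorProduct.tmul_smul, map_smul]

theorem HTensor.norm_tmul (x : H) (y : K) : ‖HTensor.tmul x y‖ = ‖x‖ * ‖y‖ := by
  rw [HTensor.tmul, LinearIsometry.norm_map, TensorProduct.norm_tmul]

/-- The tensor product of operators as a bilinear map. -/
def opTensorₗ (H H' K K' : Type*) [NormedAddCommGroup H] [InnerProductSpace ℂ H]
    [NormedAddCommGroup H'] [InnerProductSpace ℂ H'] [NormedAddCommGroup K]
    [InnerProductSpace ℂ K] [NormedAddCommGroup K'] [InnerProductSpace ℂ K'] :
    (H →L[ℂ] H') →ₗ[ℂ] (K →L[ℂ] K') →ₗ[ℂ] (HTensor H K →L[ℂ] HTensor H' K') :=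
  LinearMap.mk₂ ℂ opTensor
    (fun a a' b => HTensor.ext fun x y => by simp [HTensor.add_tmul])
    (fun r a b => HTensor.ext fun x y => by simp [HTensor.smul_tmul])
    (fun a b b' => HTensor.ext fun x y => by simp [HTensor.tmul_add])
    (fun r a b => HTensor.ext fun x y => by simp [HTensor.tmul_smul])

theorem opTensor_eq (a : H →L[ℂ] H') (b : K →L[ℂ] K') :
    opTensor a b = opTensorₗ H H' K K' a b := rfl

theorem opTensor_add_left (a a' : H →L[ℂ] H') (b : K →L[ℂ] K') :
    opTensor (a + a') b = opTensor a b + opTensor a' b := by simp [opTensor_eq]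

theorem opTensor_add_right (a : H →L[ℂ] H') (b b' : K →L[ℂ] K') :
    opTensor a (b + b') = opTensor a b + opTensor a b' := by simp [opTensor_eq]

theorem opTensor_smul_left (r : ℂ) (a : H →L[ℂ] H') (b : K →L[ℂ] K') :
    opTensor (r • a) b = r • opTensor a b := by simp [opTensor_eq]

theorem opTensor_smul_right (r : ℂ) (a : H →L[ℂ] H') (b : K →L[ℂ] K') :
    opTensor a (r • b) = r • opTensor a b := by simp [opTensor_eq]

theorem opTensor_zero_left (b : K →L[ℂ] K') : opTensor (0 : H →L[ℂ] H') b = 0 := by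
  simp [opTensor_eq]

theorem opTensor_zero_right (a : H →L[ℂ] H') : opTensor a (0 : K →L[ℂ] K') = 0 := by
  simp [opTensor_eq]

theorem opTensor_sum_left {ι : Type*} (s : Finset ι) (a : ι → H →L[ℂ] H') (b : K →L[ℂ] K') :
    opTensor (∑ i ∈ s, a i) b = ∑ i ∈ s, opTensor (a i) b := by simp [opTensor_eq]

theorem opTensor_sum_right {ι : Type*} (s : Finset ι) (a : H →L[ℂ] H') (b : ι → K →L[ℂ] K') :
    opTensor a (∑ i ∈ s, b i) = ∑ i ∈ s, opTensor a (b i) := by simp [opTensor_eq]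

theorem flipOp_comp_flipOp : flipOp K H ∘L flipOp H K = 1 :=
  HTensor.ext fun x y => by simp

theorem flipOp_opTensor_flipOp (a : H →L[ℂ] H') (b : K →L[ℂ] K') :
    flipOp H' K' ∘L opTensor a b ∘L flipOp K H = opTensor b a := by
  rw [← ContinuousLinearMap.comp_assoc, opTensor_flipOp, ContinuousLinearMap.comp_assoc,
    flipOp_comp_flipOp]
  rfl

theorem adjoint_opTensor [CompleteSpace H] [CompleteSpace H'] [CompleteSpace K] [CompleteSpace K']
    (a : H →L[ℂ] H') (b : K →L[ℂ] K') :
    ContinuousLinearMap.adjoint (opTensor a b)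
      = opTensor (ContinuousLinearMap.adjoint a) (ContinuousLinearMap.adjoint b) := by
  symm
  rw [ContinuousLinearMap.eq_adjoint_iff]
  intro v w
  induction v using HTensor.induction with
  | closed => exact isClosed_eq (by fun_prop) (by fun_prop)
  | zero => simp
  | add v v' hv hv' => rw [map_add, inner_add_left, inner_add_left, hv, hv']
  | tmul x y =>
    induction w using HTensor.induction with
    | closed => exact isClosed_eq (by fun_prop) (by fun_prop)
    | zero => simp
    | add w w' hw hw' => rw [map_add, inner_add_right, inner_add_right, hw, hw']
    | tmul x' y' => simp [ContinuousLinearMap.adjoint_inner_left, HTensor.inner_tmul]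

/-- The operator `η ↦ ξ ⊗ η`. -/
def ket (K : Type*) [NormedAddCommGroup K] [InnerProductSpace ℂ K] (x : H) :
    K →L[ℂ] HTensor H K :=
  LinearMap.mkContinuous
    { toFun := fun y => HTensor.tmul x y
      map_add' := HTensor.tmul_add x
      map_smul' := fun r y => HTensor.tmul_smul r x y } ‖x‖
    fun y => (HTensor.norm_tmul x y).le

@[simp] theorem ket_apply (x : H) (y : K) : ket K x y = HTensor.tmul x y := rfl

theorem opTensor_comp_ket (a : H →L[ℂ] H') (b : K →L[ℂ] K') (x : H) :
    opTensor a b ∘L ket K x = ket K' (a x) ∘L b :=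
  ContinuousLinearMap.ext fun y => by simp

theorem adjoint_ket_tmul [CompleteSpace K] (x x' : H) (y : K) :
    ContinuousLinearMap.adjoint (ket K x) (HTensor.tmul x' y) = inner ℂ x x' • y := by
  refine ext_inner_left ℂ fun v => ?_
  rw [ContinuousLinearMap.adjoint_inner_right, ket_apply, HTensor.inner_tmul, inner_smul_right]

theorem adjoint_ket_comp_ket [CompleteSpace K] (x x' : H) :
    ContinuousLinearMap.adjoint (ket K x) ∘L ket K x' = inner ℂ x x' • 1 :=
  ContinuousLinearMap.ext fun y => by simp [adjoint_ket_tmul]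

/-- On elementary tensors this is the expansion x = ∑ ⟨b_i, x⟩ b_i in the first factor. -/
theorem sum_ket_comp_adjoint_ket [CompleteSpace K] {ι : Type*} [Fintype ι]
    (b : OrthonormalBasis ι ℂ H) :
    ∑ i, ket K (b i) ∘L ContinuousLinearMap.adjoint (ket K (b i)) = 1 := by
  refine HTensor.ext fun x y => ?_
  have h : ∑ i, HTensor.tmul (inner ℂ (b i) x • b i) y = HTensor.tmul x y := by
    conv_rhs => rw [← b.sum_repr' x]
    exact (map_sum (⟨⟨fun x => HTensor.tmul x y, by simp [HTensor.tmul]⟩,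
      fun x x' => HTensor.add_tmul x x' y⟩ : H →+ HTensor H K) _ _).symm
  rw [one_apply_eq_self, sum_apply]
  refine Eq.trans (Finset.sum_congr rfl fun i _ => ?_) h
  simp [adjoint_ket_tmul, HTensor.smul_tmul]

end OpTensor

/-! ### Universal properties -/

section Universal

/-- The unital `*`-homomorphism from a free `*`-algebra with given values on the generators. -/
def FreeStarAlg.lift {G : Type} {B : Type*} [Ring B] [StarRing B] [Algebra ℂ B] [StarModule ℂ B]
    (b : G → B) : FreeStarAlg G →⋆ₐ[ℂ] B :=
  let φ : FreeStarAlg G →ₐ[ℂ] B :=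
    FreeAlgebra.lift ℂ (fun x : G ⊕ G => Sum.elim b (fun g => star (b g)) x)
  have hφ : ∀ x : G ⊕ G, φ (FreeStarAlg.letter x) = Sum.elim b (fun g => star (b g)) x :=
    fun x => FreeAlgebra.lift_ι_apply (R := ℂ) _ x
  { φ with
    map_star' := fun a => by
      change φ (star a) = star (φ a)
      induction a using FreeStarAlg.induction with
      | scalar r => rw [FreeStarAlg.star_algebraMap', AlgHom.commutes, AlgHom.commutes,
          algebraMap_star_comm]
      | letter x => rw [FreeStarAlg.star_letter, hφ, hφ]; cases x <;> simp
      | mul a b ha hb => rw [star_mul, map_mul, map_mul, star_mul, ha, hb]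
      | add a b ha hb => rw [star_add, map_add, map_add, star_add, ha, hb] }

theorem FreeStarAlg.lift_gen {G : Type} {B : Type*} [Ring B] [StarRing B] [Algebra ℂ B]
    [StarModule ℂ B] (b : G → B) (g : G) : FreeStarAlg.lift b (FreeStarAlg.gen g) = b g :=
  FreeAlgebra.lift_ι_apply (R := ℂ) (fun x : G ⊕ G => Sum.elim b (fun g => star (b g)) x)
    (Sum.inl g)

/-- The `C*`-seminorm pulled back along a `*`-homomorphism into a `C*`-algebra. -/
def CStarSeminorm.ofHom {F : Type} [Ring F] [StarRing F] [Algebra ℂ F] {B : Type*}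
    [CStarAlgebra B] (φ : F →⋆ₐ[ℂ] B) : CStarSeminorm F where
  toSeminorm := (normSeminorm ℂ B).comp (φ.toAlgHom.toLinearMap)
  mul_le' a b := by
    change ‖φ (a * b)‖ ≤ ‖φ a‖ * ‖φ b‖
    rw [map_mul]
    exact norm_mul_le _ _
  star_mul_self' a := by
    change ‖φ (star a * a)‖ = ‖φ a‖ * ‖φ a‖
    rw [map_mul, StarHomClass.map_star, CStarRing.norm_star_mul_self]

/-- A `*`-homomorphism into a `C*`-algebra that is contractive for a `C*`-seminorm extends to the
completion. -/
theorem CStarSeminorm.exists_extension {F : Type} [Ring F] [StarRing F] [Algebra ℂ F]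
    (p : CStarSeminorm F) {B : Type*} [CStarAlgebra B] (φ : F →⋆ₐ[ℂ] B)
    (h : ∀ a, ‖φ a‖ ≤ p.toSeminorm a) :
    ∃ Φ : p.Compl →⋆ₐ[ℂ] B, ∀ a, Φ (p.toCompl a) = φ a := by
  let φ₀ : p.Space →+* B := (φ : F →+* B)
  have hφ₀ : Continuous φ₀ :=
    AddMonoidHomClass.continuous_of_bound φ₀ 1 fun a => by
      rw [one_mul]
      exact h a
  let Φ : p.Compl →+* B := UniformSpace.Completion.extensionHom φ₀ hφ₀
  have hΦ : ∀ a : F, Φ (p.toCompl a) = φ a := fun a =>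
    UniformSpace.Completion.extensionHom_coe φ₀ hφ₀ a
  have hc : Continuous Φ := UniformSpace.Completion.continuous_extension
  exact ⟨{ Φ with
    commutes' := fun r => by
      change Φ (p.toCompl (algebraMap ℂ F r)) = _
      rw [hΦ, AlgHomClass.commutes]
    map_star' := fun x => by
      change Φ (star x) = star (Φ x)
      induction x using p.induction_on with
      | hc => exact isClosed_eq (by fun_prop) (by fun_prop)
      | h a => rw [p.star_toCompl, hΦ, hΦ, StarHomClass.map_star] }, hΦ⟩

variable {N : ℕ} [NeZero N] {ω : ℂ}

/-- The defining relations of the anyonic quantum permutation group, for a family of elements of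
a complex `*`-algebra. -/
structure AnyonicFamily (ω : ℂ) {B : Type*} [Ring B] [StarRing B] [Algebra ℂ B]
    (b : ZMod N → ZMod N → B) : Prop where
  zero_left : ∀ i, b 0 i = if i = 0 then 1 else 0
  zero_right : ∀ i, b i 0 = if i = 0 then 1 else 0
  adj : ∀ i j, star (b i j) = zpw ω (-(i * (i - j))) • b (-i) (-j)
  right : ∀ i j k, b k (i + j) = ∑ l, zpw ω (-(l * (i - k + l))) • (b (k - l) i * b l j)
  left : ∀ i j k, b (i + j) k = ∑ l, zpw ω (-(i * (l - j))) • (b j l * b i (k - l))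

/-- Universal property: the norm of `B` pulled back to the free algebra is one of the seminorms in
the supremum `maxSeminorm`, so the free homomorphism is contractive and extends to the completion.
-/
theorem AnyonicFamily.exists_hom {B : Type*} [CStarAlgebra B] {b : ZMod N → ZMod N → B}
    (hb : AnyonicFamily ω b) : ∃ φ : CS N ω →⋆ₐ[ℂ] B, ∀ i j, φ (q ω i j) = b i j := by
  let φ₀ : FreeQ N →⋆ₐ[ℂ] B := FreeStarAlg.lift fun g : ZMod N × ZMod N => b g.1 g.2
  have hφ₀ : ∀ i j, φ₀ (fq i j) = b i j := fun i j => FreeStarAlg.lift_gen _ (i, j)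
  have hrel : ∀ x y, AnyonicRel N ω x y → φ₀ x = φ₀ y := by
    rintro _ _ (i | i | ⟨i, j⟩ | ⟨i, j, k⟩ | ⟨i, j, k⟩)
    · rw [hφ₀, hb.zero_left]
      split_ifs <;> simp
    · rw [hφ₀, hb.zero_right]
      split_ifs <;> simp
    · rw [map_star, map_smul, hφ₀, hφ₀, hb.adj]
    · simp only [map_sum, map_smul, map_mul, hφ₀]
      exact hb.right i j k
    · simp only [map_sum, map_smul, map_mul, hφ₀]
      exact hb.left i j k
  let p : AnyonicSeminorm N ω := ⟨CStarSeminorm.ofHom φ₀, fun x y hxy => by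
    change ‖φ₀ (x - y)‖ = 0
    rw [map_sub, hrel x y hxy, sub_self, norm_zero]⟩
  have hp : ∀ a, ‖φ₀ a‖ ≤ (maxSeminorm N ω).toSeminorm a := fun a =>
    le_ciSup (AnyonicSeminorm.bddAbove (ω := ω) a) p
  obtain ⟨Φ, hΦ⟩ := (maxSeminorm N ω).exists_extension φ₀ hp
  exact ⟨Φ, fun i j => (hΦ (fq i j)).trans (hφ₀ i j)⟩

/-- Every seminorm in the supremum kills x - y, hence so does the supremum. -/
theorem toCompl_eq_of_anyonicRel {x y : FreeQ N} (h : AnyonicRel N ω x y) :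
    (maxSeminorm N ω).toCompl x = (maxSeminorm N ω).toCompl y := by
  rw [← sub_eq_zero, ← CStarSeminorm.toCompl_sub, ← norm_eq_zero, CStarSeminorm.norm_toCompl]
  refine le_antisymm (ciSup_le fun p => (p.2 x y h).le) (apply_nonneg _ _)

theorem anyonicFamily_q : AnyonicFamily ω (q (N := N) ω) := by
  have hsum := AnyonicSeminorm.toCompl_sum (maxSeminorm N ω)
  have hmul := (maxSeminorm N ω).toCompl_mul
  have hsmul := (maxSeminorm N ω).toCompl_smul
  refine ⟨fun i => ?_, fun i => ?_, fun i j => ?_, fun i j k => ?_, fun i j k => ?_⟩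
  · refine (toCompl_eq_of_anyonicRel (AnyonicRel.zero_left i)).trans ?_
    split_ifs <;> rfl
  · refine (toCompl_eq_of_anyonicRel (AnyonicRel.zero_right i)).trans ?_
    split_ifs <;> rfl
  · refine ((maxSeminorm N ω).star_toCompl _).trans
      ((toCompl_eq_of_anyonicRel (AnyonicRel.adj i j)).trans ?_)
    exact hsmul _ _
  · refine (toCompl_eq_of_anyonicRel (AnyonicRel.right i j k)).trans ?_
    simp only [hsum, hsmul, hmul]
    rfl
  · refine (toCompl_eq_of_anyonicRel (AnyonicRel.left i j k)).trans ?_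
    simp only [hsum, hsmul, hmul]
    rfl

theorem AnyonicFamily.map {B C : Type*} [Ring B] [StarRing B] [Algebra ℂ B] [Ring C] [StarRing C]
    [Algebra ℂ C] {b : ZMod N → ZMod N → B} (hb : AnyonicFamily ω b) (φ : B →⋆ₐ[ℂ] C) :
    AnyonicFamily ω fun i j => φ (b i j) where
  zero_left i := by rw [hb.zero_left]; split_ifs <;> simp
  zero_right i := by rw [hb.zero_right]; split_ifs <;> simp
  adj i j := by rw [← map_star, hb.adj, map_smul]
  right i j k := by rw [hb.right, map_sum]; simp only [map_smul, map_mul]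
  left i j k := by rw [hb.left, map_sum]; simp only [map_smul, map_mul]

theorem AnyonicFamily.sum_star_mul {B : Type*} [Ring B] [StarRing B] [Algebra ℂ B]
    {b : ZMod N → ZMod N → B} (hb : AnyonicFamily ω b) (i j : ZMod N) :
    ∑ k, star (b k i) * b k j = if i = j then 1 else 0 := by
  -- Row 0 of b is δ, so this relation evaluates a quadratic sum; the adjoint relation turns
  -- b_{-l,-i}, with its phase, into b_{l,i}*.
  have h := hb.right (-i) j 0
  rw [hb.zero_left] at h
  refine Eq.trans ?_ (h.symm.trans ?_)
  · refine Finset.sum_congr rfl fun k _ => ?_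
    rw [hb.adj, smul_mul_assoc]
    congr 2 <;> ring_nf
  · simp only [neg_add_eq_zero]

theorem AnyonicFamily.sum_mul_star {B : Type*} [Ring B] [StarRing B] [Algebra ℂ B]
    {b : ZMod N → ZMod N → B} (hω : IsPrimitiveRoot ω N) (hb : AnyonicFamily ω b)
    (i j : ZMod N) : ∑ k, b i k * star (b j k) = if i = j then 1 else 0 := by
  -- Here column 0 is used instead.
  have h := hb.left (-j) i 0
  rw [hb.zero_right] at h
  -- The phase of the adjoint relation differs from that of the quadratic relation by a factor
  -- independent of k; it is 1 for i = j and multiplies 0 otherwise.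
  have h2 : ∑ k, b i k * star (b j k)
      = zpw ω (j * i - j * j) • ∑ l, zpw ω (-(-j * (l - i))) • (b i l * b (-j) (0 - l)) := by
    rw [Finset.smul_sum]
    refine Finset.sum_congr rfl fun k _ => ?_
    rw [hb.adj, mul_smul_comm, smul_smul, ← zpw_add hω]
    congr 2 <;> ring_nf
  rw [h2, ← h]
  by_cases hij : i = j
  · simp [hij, zpw_zero]
  · rw [if_neg hij, if_neg, smul_zero]
    rwa [neg_add_eq_zero, eq_comm]

end Universal

/-! ### Spectral projections of actions of `ℤ/N` -/

namespace ZNAlg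

variable {N : ℕ} [NeZero N] {ω : ℂ}

/-- The unitary operator implementing `t ∈ ℤ/N`. -/
def V (X : ZNAlg.{u} N) (t : ZMod N) : X.H →L[ℂ] X.H := X.U (Multiplicative.ofAdd t)

variable (X : ZNAlg.{u} N) (Y : ZNAlg.{v} N)

omit [NeZero N] in
theorem V_zero : X.V 0 = 1 := by simp [V]

omit [NeZero N] in
theorem V_mul (s t : ZMod N) : X.V s * X.V t = X.V (s + t) := by
  simp [V]

omit [NeZero N] in
theorem star_V (t : ZMod N) : star (X.V t) = X.V (-t) := by
  rw [V, V, ofAdd_neg, map_inv, ← Unitary.coe_star, Unitary.star_eq_inv]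

omit [NeZero N] in
theorem conj_eq (t : ZMod N) (x : X.H →L[ℂ] X.H) :
    Unitary.conjStarAlgAut ℂ _ (X.U (Multiplicative.ofAdd t)) x = X.V t * x * X.V (-t) := by
  rw [← star_V, Unitary.conjStarAlgAut_apply]
  rfl

theorem proj_eq (m : ZMod N) :
    X.proj ω m = (N : ℂ)⁻¹ • ∑ t : ZMod N, zpw ω (-(t * m)) • X.V t := rfl

/-- Translate the summation variable of the averaging operator by t. -/
theorem proj_V (hω : IsPrimitiveRoot ω N) (m t : ZMod N) :
    X.proj ω m * X.V t = zpw ω (t * m) • X.proj ω m := by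
  simp only [proj_eq, smul_mul_assoc, Finset.sum_mul, V_mul, smul_comm _ (N : ℂ)⁻¹]
  congr 1
  rw [Finset.smul_sum, ← Equiv.sum_comp (Equiv.subRight t)]
  refine Finset.sum_congr rfl fun s _ => ?_
  rw [smul_smul, ← zpw_add hω]
  simp only [Equiv.subRight_apply, sub_add_cancel]
  congr 2
  ring

theorem V_proj (hω : IsPrimitiveRoot ω N) (m t : ZMod N) :
    X.V t * X.proj ω m = zpw ω (t * m) • X.proj ω m :=
  (proj_comm ω X (Multiplicative.ofAdd t) m).trans (X.proj_V hω m t)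

theorem sum_proj (hω : IsPrimitiveRoot ω N) : ∑ m, X.proj ω m = 1 := by
  simp only [proj_eq]
  rw [← Finset.smul_sum, Finset.sum_comm]
  simp only [← Finset.sum_smul]
  have h : ∀ t : ZMod N, ∑ m, zpw ω (-(t * m)) = if t = 0 then (N : ℂ) else 0 := fun t => by
    have h' := sum_zpw hω (-t)
    simp only [neg_eq_zero] at h'
    rw [← h']
    refine Finset.sum_congr rfl fun m _ => ?_
    congr 1
    ring
  simp only [h, ite_smul, zero_smul, Finset.sum_ite_eq', Finset.mem_univ, if_true, V_zero]
  rw [smul_smul, inv_mul_cancel₀ (NeZero.ne _), one_smul]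

/-- The spectral decomposition of the representation; it allows the double sums over weights in the
braiding to be resummed into the unitaries V_m. -/
theorem V_eq (hω : IsPrimitiveRoot ω N) (t : ZMod N) :
    X.V t = ∑ m, zpw ω (t * m) • X.proj ω m := by
  rw [← mul_one (X.V t), ← X.sum_proj hω, Finset.mul_sum]
  exact Finset.sum_congr rfl fun m _ => X.V_proj hω m t

theorem proj_mul_proj (hω : IsPrimitiveRoot ω N) (m n : ZMod N) :
    X.proj ω m * X.proj ω n = if m = n then X.proj ω m else 0 := by
  rw [proj_eq X n, mul_smul_comm, Finset.mul_sum]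
  simp only [mul_smul_comm, X.proj_V hω, smul_smul, ← zpw_add hω]
  rw [← Finset.sum_smul]
  have h : ∑ t : ZMod N, zpw ω (-(t * n) + t * m) = if m = n then (N : ℂ) else 0 := by
    have h' := sum_zpw hω (m - n)
    simp only [sub_eq_zero] at h'
    rw [← h']
    refine Finset.sum_congr rfl fun t _ => ?_
    congr 1
    ring
  rw [h]
  split_ifs
  · rw [smul_smul, inv_mul_cancel₀ (NeZero.ne _), one_smul]
  · simp

theorem star_proj (hω : IsPrimitiveRoot ω N) (m : ZMod N) :
    star (X.proj ω m) = X.proj ω m := by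
  simp only [proj_eq, star_smul, star_sum, star_V, star_zpw hω]
  rw [← Equiv.sum_comp (Equiv.neg _)]
  simp

/-! ### The embeddings into the braided tensor product -/

theorem braid_eq (hω : IsPrimitiveRoot ω N) :
    braid ω X Y = (∑ m, opTensor (Y.V m) (X.proj ω m)) ∘L flipOp X.H Y.H := by
  rw [braid]
  congr 1
  refine Finset.sum_congr rfl fun m _ => ?_
  rw [Y.V_eq hω, opTensor_sum_left]
  simp only [opTensor_smul_left]

theorem dualBraid_eq (hω : IsPrimitiveRoot ω N) :
    dualBraid ω X Y = (∑ m, opTensor (X.proj ω m) (Y.V (-m))) ∘L flipOp Y.H X.H := by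
  rw [dualBraid]
  congr 1
  refine Finset.sum_congr rfl fun m _ => ?_
  rw [Y.V_eq hω, opTensor_sum_right]
  simp only [opTensor_smul_right, neg_mul]

/-- Up to the flip, the braiding is the controlled unitary ∑ P_m ⊗ V_m. Conjugating 1 ⊗ y by it
leaves only diagonal terms, since P_m P_n = 0 for m ≠ n. -/
theorem opj₂_eq (hω : IsPrimitiveRoot ω N) (y : Y.H →L[ℂ] Y.H) :
    opj₂ ω X Y y = ∑ m, opTensor (X.proj ω m) (Y.V (-m) * y * Y.V m) := by
  have h : opj₂ ω X Y y = (∑ m, opTensor (X.proj ω m) (Y.V (-m))) * opTensor 1 y *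
      ∑ m, opTensor (X.proj ω m) (Y.V m) := by
    have h2 : flipOp Y.H X.H ∘L (∑ m, opTensor (Y.V m) (X.proj ω m)) ∘L flipOp X.H Y.H
        = ∑ m, opTensor (X.proj ω m) (Y.V m) := by
      rw [← ContinuousLinearMap.comp_assoc, ContinuousLinearMap.comp_finsetSum,
        ContinuousLinearMap.finsetSum_comp]
      refine Finset.sum_congr rfl fun m _ => ?_
      rw [ContinuousLinearMap.comp_assoc, flipOp_opTensor_flipOp]
    rw [opj₂, braid_eq X Y hω, dualBraid_eq X Y hω, ← h2]
    rw [ContinuousLinearMap.comp_assoc, ← ContinuousLinearMap.comp_assoc (flipOp _ _) (opTensor y 1),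
      opTensor_flipOp]
    rfl
  rw [h, Finset.sum_mul, Finset.sum_mul]
  refine Finset.sum_congr rfl fun m _ => ?_
  rw [Finset.mul_sum, Finset.sum_eq_single m]
  · rw [opTensor_mul, opTensor_mul, mul_one, X.proj_mul_proj hω, if_pos rfl]
  · intro n _ hn
    rw [opTensor_mul, opTensor_mul, mul_one, X.proj_mul_proj hω, if_neg hn.symm,
      opTensor_zero_left]
  · simp

end ZNAlg

/-! ### The braided comultiplication on generators -/

section BraidedProduct

variable {N : ℕ} [NeZero N] {ω : ℂ} {B : Type*} [Ring B] [StarRing B] [Algebra ℂ B]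
  {p r : ZMod N → ZMod N → B}

/-- The matrix product of two families satisfying the anyonic relations, whose entries commute up
to the braiding phases, satisfies the anyonic relations. -/
theorem AnyonicFamily.braidedMul (hω : IsPrimitiveRoot ω N) (hp : AnyonicFamily ω p)
    (hr : AnyonicFamily ω r)
    (hcomm : ∀ k j a b, r k j * p a b = zpw ω (-((j - k) * (b - a))) • (p a b * r k j)) :
    AnyonicFamily ω fun i j => ∑ k, p i k * r k j where
  zero_left i := by simp [hp.zero_left, hr.zero_left]
  zero_right i := by simp [hp.zero_right, hr.zero_right]
  adj i j := by
    -- The adjoint relation sends the inner index k to -k, so the target sum is reindexed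
    -- accordingly.
    rw [star_sum, Finset.smul_sum, ← Equiv.sum_comp (Equiv.neg (ZMod N))
      (fun k => zpw ω (-(i * (i - j))) • (p (-i) k * r k (-j)))]
    refine Finset.sum_congr rfl fun k _ => ?_
    rw [Equiv.neg_apply, star_mul, hr.adj, hp.adj, smul_mul_smul_comm, hcomm, smul_smul, ← zpw_add hω,
      ← zpw_add hω]
    congr 2
    ring
  right i j k := by
    -- The only use of the braiding in this relation: all p are brought to the left of all r.
    have key : ∀ l a b, (p (k - l) a * r a i) * (p l b * r b j)
        = zpw ω (-((i - a) * (b - l))) • ((p (k - l) a * p l b) * (r a i * r b j)) := by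
      intro l a b
      rw [mul_assoc, ← mul_assoc (r a i), hcomm, smul_mul_assoc, mul_smul_comm]
      simp only [mul_assoc]
    -- After `key`, the part of the phase depending on l is the one in the relation for p_{k,a+b},
    -- so the sum over l collapses.
    have hR : ∑ l, zpw ω (-(l * (i - k + l))) •
        ((∑ a, p (k - l) a * r a i) * ∑ b, p l b * r b j)
        = ∑ a, ∑ b, zpw ω (-((i - a) * b)) • (p k (a + b) * (r a i * r b j)) := by
      simp only [Finset.sum_mul_sum, Finset.smul_sum, key]
      simp only [hp.right, smul_smul, Finset.sum_mul, Finset.smul_sum, smul_mul_assoc, ← zpw_add hω]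
      refine Finset.sum_comm.trans (Finset.sum_congr rfl fun a _ => Finset.sum_comm.trans
        (Finset.sum_congr rfl fun b _ => Finset.sum_congr rfl fun l _ => ?_))
      congr 2
      ring
    have hL : ∑ m, p k m * r m (i + j)
        = ∑ b, ∑ a, zpw ω (-((i - a) * b)) • (p k (a + b) * (r a i * r b j)) := by
      simp only [hr.right, Finset.mul_sum, mul_smul_comm]
      refine Finset.sum_comm.trans (Finset.sum_congr rfl fun b _ => ?_)
      -- With m = a + b the relation for r_{m,i+j} takes the same normal form as `hR`.
      rw [← Equiv.sum_comp (Equiv.addRight b)]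
      refine Finset.sum_congr rfl fun a _ => ?_
      rw [Equiv.coe_addRight, add_sub_cancel_right]
      congr 2
      ring
    rw [hL, hR, Finset.sum_comm]
  left i j k := by
    have key : ∀ l a b, (p j a * r a l) * (p i b * r b (k - l))
        = zpw ω (-((l - a) * (b - i))) • ((p j a * p i b) * (r a l * r b (k - l))) := by
      intro l a b
      rw [mul_assoc, ← mul_assoc (r a l), hcomm, smul_mul_assoc, mul_smul_comm]
      simp only [mul_assoc]
    -- The roles are exchanged: now the sum over l is the relation expanding r_{b+a,k}, while `hL`
    -- expands p_{i+j,m}.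
    have hR : ∑ l, zpw ω (-(i * (l - j))) •
        ((∑ a, p j a * r a l) * ∑ b, p i b * r b (k - l))
        = ∑ a, ∑ b, zpw ω (-(i * (a - j))) • ((p j a * p i b) * r (b + a) k) := by
      simp only [Finset.sum_mul_sum, Finset.smul_sum, key]
      simp only [hr.left, smul_smul, Finset.mul_sum, Finset.smul_sum, mul_smul_comm, ← zpw_add hω]
      refine Finset.sum_comm.trans (Finset.sum_congr rfl fun a _ => Finset.sum_comm.trans
        (Finset.sum_congr rfl fun b _ => Finset.sum_congr rfl fun l _ => ?_))
      congr 2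
      ring
    have hL : ∑ m, p (i + j) m * r m k
        = ∑ a, ∑ b, zpw ω (-(i * (a - j))) • ((p j a * p i b) * r (b + a) k) := by
      simp only [hp.left, Finset.sum_mul, smul_mul_assoc]
      refine Finset.sum_comm.trans (Finset.sum_congr rfl fun a _ => ?_)
      rw [← Equiv.sum_comp (Equiv.addRight a)]
      refine Finset.sum_congr rfl fun b _ => ?_
      rw [Equiv.coe_addRight, add_sub_cancel_right]
    rw [hL, hR]

end BraidedProduct

/-! ### Homogeneous elements and braided commutation -/

namespace ZNAlg

variable {N : ℕ} (X : ZNAlg.{u} N)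

/-- The action of `t ∈ ℤ/N` as a `*`-homomorphism. -/
def actHom (t : ZMod N) : X.A →⋆ₐ[ℂ] X.A where
  toFun := X.act t
  map_one' := Subtype.ext (map_one _)
  map_mul' _ _ := Subtype.ext (map_mul _ _ _)
  map_zero' := Subtype.ext (map_zero _)
  map_add' _ _ := Subtype.ext (map_add _ _ _)
  commutes' r := Subtype.ext (AlgHomClass.commutes
    (Unitary.conjStarAlgAut ℂ (X.H →L[ℂ] X.H) (X.U (Multiplicative.ofAdd t))) r)
  map_star' a := Subtype.ext (map_star
    (Unitary.conjStarAlgAut ℂ (X.H →L[ℂ] X.H) (X.U (Multiplicative.ofAdd t))) (a : X.H →L[ℂ] X.H))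

theorem actHom_apply (t : ZMod N) (a : X.A) : X.actHom t a = X.act t a := rfl

theorem coe_act (t : ZMod N) (a : X.A) :
    (X.act t a : X.H →L[ℂ] X.H) = X.V t * a * X.V (-t) := X.conj_eq t a

variable (Y : ZNAlg.{v} N)

/-- The embedding `j₁` as a `*`-homomorphism. -/
def opj₁Hom : (X.H →L[ℂ] X.H) →⋆ₐ[ℂ] (HTensor X.H Y.H →L[ℂ] HTensor X.H Y.H) where
  toFun := opj₁ X Y
  map_one' := opTensor_one
  map_mul' a b := by simp [opj₁, opTensor_mul]
  map_zero' := opTensor_zero_left _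
  map_add' a b := opTensor_add_left a b 1
  commutes' r := by
    rw [Algebra.algebraMap_eq_smul_one, opj₁, opTensor_smul_left, opTensor_one,
      Algebra.algebraMap_eq_smul_one]
  map_star' a := by rw [opj₁, opj₁, star_opTensor, star_one]

variable [NeZero N] {ω : ℂ}

/-- The embedding `j₂` as a `*`-homomorphism. -/
def opj₂Hom (hω : IsPrimitiveRoot ω N) :
    (Y.H →L[ℂ] Y.H) →⋆ₐ[ℂ] (HTensor X.H Y.H →L[ℂ] HTensor X.H Y.H) where
  toFun := opj₂ ω X Y
  map_one' := by
    rw [opj₂_eq X Y hω]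
    simp only [mul_one, V_mul, neg_add_cancel, V_zero]
    rw [← opTensor_sum_left, X.sum_proj hω, opTensor_one]
  map_mul' a b := by
    simp only [opj₂_eq X Y hω, Finset.sum_mul_sum, opTensor_mul, X.proj_mul_proj hω]
    refine Finset.sum_congr rfl fun m _ => ?_
    rw [Finset.sum_eq_single m]
    · rw [if_pos rfl]
      congr 1
      simp only [mul_assoc]
      rw [← mul_assoc (Y.V m) (Y.V (-m)), V_mul, add_neg_cancel, V_zero, one_mul]
    · intro n _ hn
      rw [if_neg hn.symm, opTensor_zero_left]
    · simp
  map_zero' := by simp [opj₂_eq X Y hω, opTensor_zero_right]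
  map_add' a b := by
    simp [opj₂_eq X Y hω, mul_add, add_mul, opTensor_add_right, Finset.sum_add_distrib]
  commutes' r := by
    rw [opj₂_eq X Y hω]
    simp only [Algebra.algebraMap_eq_smul_one, mul_smul_comm, smul_mul_assoc, mul_one, V_mul,
      neg_add_cancel, V_zero, opTensor_smul_right]
    rw [← Finset.smul_sum, ← opTensor_sum_left, X.sum_proj hω, opTensor_one]
  map_star' a := by
    simp only [opj₂_eq X Y hω, star_sum, star_opTensor, star_mul, X.star_proj hω, star_V,
      neg_neg, mul_assoc]

/-- The embedding `j₁` into the braided tensor product as a `*`-homomorphism. -/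
def j₁Hom (ω : ℂ) : X.A →⋆ₐ[ℂ] (box ω X Y).A :=
  StarAlgHom.codRestrict ((opj₁Hom X Y).comp X.A.subtype) (box ω X Y).A
    fun x => opj₁_mem ω X Y x.2

theorem j₁Hom_apply (x : X.A) : j₁Hom X Y ω x = j₁ ω X Y x := rfl

/-- The embedding `j₂` into the braided tensor product as a `*`-homomorphism. -/
def j₂Hom (hω : IsPrimitiveRoot ω N) : Y.A →⋆ₐ[ℂ] (box ω X Y).A :=
  StarAlgHom.codRestrict ((opj₂Hom X Y hω).comp Y.A.subtype) (box ω X Y).A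
    fun y => opj₂_mem ω X Y y.2

theorem j₂Hom_apply (hω : IsPrimitiveRoot ω N) (y : Y.A) : j₂Hom X Y hω y = j₂ ω X Y y := rfl

theorem act_j₁ (t : ZMod N) (x : X.A) : (box ω X Y).act t (j₁ ω X Y x) = j₁ ω X Y (X.act t x) :=
  Subtype.ext (conj_opj₁ X Y _ _)

theorem act_j₂ (t : ZMod N) (y : Y.A) : (box ω X Y).act t (j₂ ω X Y y) = j₂ ω X Y (Y.act t y) :=
  Subtype.ext (conj_opj₂ ω X Y _ _)

variable {X Y}

/-- `a` is homogeneous of degree `d`. -/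
def IsHomogeneous (ω : ℂ) (a : X.A) (d : ZMod N) : Prop := ∀ t, X.act t a = zpw ω (t * d) • a

/-- Conjugation by V_{-m} multiplies y by ω^{-md}, and ∑ ω^{-md} P_m = V_{-d}. The braiding thus
only attaches a group unitary to y in the other leg. -/
theorem coe_j₂_of_isHomogeneous (hω : IsPrimitiveRoot ω N) {y : Y.A} {d : ZMod N}
    (hy : IsHomogeneous ω y d) :
    (j₂ ω X Y y : (box ω X Y).H →L[ℂ] (box ω X Y).H) = opTensor (X.V (-d)) (y : Y.H →L[ℂ] Y.H) := by
  change opj₂ ω X Y y = _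
  rw [opj₂_eq X Y hω, X.V_eq hω, opTensor_sum_left]
  refine Finset.sum_congr rfl fun m _ => ?_
  have h := congrArg Subtype.val (hy (-m))
  rw [coe_act, neg_neg] at h
  rw [h, opTensor_smul_left]
  change opTensor _ (zpw ω (-m * d) • (y : Y.H →L[ℂ] Y.H)) = _
  rw [opTensor_smul_right]
  congr 2
  ring

/-- The braided commutation relation. -/
theorem j₂_mul_j₁ (hω : IsPrimitiveRoot ω N) {x : X.A} {y : Y.A} {d e : ZMod N}
    (hx : IsHomogeneous ω x e) (hy : IsHomogeneous ω y d) :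
    j₂ ω X Y y * j₁ ω X Y x = zpw ω (-(d * e)) • (j₁ ω X Y x * j₂ ω X Y y) := by
  have h : X.V (-d) * (x : X.H →L[ℂ] X.H)
      = zpw ω (-(d * e)) • ((x : X.H →L[ℂ] X.H) * X.V (-d)) := by
    have h' := congrArg Subtype.val (hx (-d))
    rw [coe_act, neg_neg] at h'
    have h'' : X.V (-d) * (x : X.H →L[ℂ] X.H) = X.V (-d) * x * X.V d * X.V (-d) := by
      rw [mul_assoc _ (X.V d), V_mul, add_neg_cancel, V_zero, mul_one]
    rw [h'', h']
    change (zpw ω (-d * e) • (x : X.H →L[ℂ] X.H)) * _ = _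
    rw [smul_mul_assoc, neg_mul]
  refine Subtype.ext ?_
  have hy' : opj₂ ω X Y y = opTensor (X.V (-d)) (y : Y.H →L[ℂ] Y.H) :=
    coe_j₂_of_isHomogeneous hω hy
  change opj₂ ω X Y y * opj₁ X Y x = zpw ω (-(d * e)) • (opj₁ X Y x * opj₂ ω X Y y)
  rw [hy', opj₁, opTensor_mul, opTensor_mul, h, opTensor_smul_left, mul_one, one_mul]

theorem IsHomogeneous.mul (hω : IsPrimitiveRoot ω N) {a b : X.A} {d e : ZMod N}
    (ha : IsHomogeneous ω a d) (hb : IsHomogeneous ω b e) : IsHomogeneous ω (a * b) (d + e) := by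
  intro t
  rw [← actHom_apply, map_mul, actHom_apply, actHom_apply, ha, hb, smul_mul_smul_comm,
    ← zpw_add hω, mul_add]

omit [NeZero N] in
theorem IsHomogeneous.sum {ι : Type*} {s : Finset ι} {a : ι → X.A} {d : ZMod N}
    (ha : ∀ i ∈ s, IsHomogeneous ω (a i) d) : IsHomogeneous ω (∑ i ∈ s, a i) d := by
  intro t
  rw [← actHom_apply, map_sum, Finset.smul_sum]
  exact Finset.sum_congr rfl fun i hi => ha i hi t

theorem IsHomogeneous.j₁ {x : X.A} {d : ZMod N} (hx : IsHomogeneous ω x d) :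
    IsHomogeneous ω (X := box ω X Y) (j₁ ω X Y x) d := by
  intro t
  rw [act_j₁, hx, ← j₁Hom_apply, map_smul]
  rfl

theorem IsHomogeneous.j₂ (hω : IsPrimitiveRoot ω N) {y : Y.A} {d : ZMod N}
    (hy : IsHomogeneous ω y d) : IsHomogeneous ω (X := box ω X Y) (ZNAlg.j₂ ω X Y y) d := by
  intro t
  rw [act_j₂, hy, ← j₂Hom_apply X Y hω, map_smul]
  rfl

/-- Serves both to restrict codomains of maps built on all operators and, with φ the identity, to
prove density. -/
theorem box_mem {B : Type*} [CStarAlgebra B] {C : StarSubalgebra ℂ B} (hC : IsClosed (C : Set B))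
    (φ : (box ω X Y).A →⋆ₐ[ℂ] B) (h₁ : ∀ x, φ (ZNAlg.j₁ ω X Y x) ∈ C)
    (h₂ : ∀ y, φ (ZNAlg.j₂ ω X Y y) ∈ C) (a : (box ω X Y).A) : φ a ∈ C := by
  refine StarAlgHom.mem_of_generators (s := boxGens ω X Y) hC φ ?_ a
  rintro _ (⟨x, hx, rfl⟩ | ⟨y, hy, rfl⟩)
  · exact h₁ ⟨x, hx⟩
  · exact h₂ ⟨y, hy⟩

theorem box_ext {B : Type*} [CStarAlgebra B] {T : StarSubalgebra ℂ B}
    {φ ψ : (box ω X Y).A →⋆ₐ[ℂ] T} (h₁ : ∀ x, φ (ZNAlg.j₁ ω X Y x) = ψ (ZNAlg.j₁ ω X Y x))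
    (h₂ : ∀ y, φ (ZNAlg.j₂ ω X Y y) = ψ (ZNAlg.j₂ ω X Y y)) : φ = ψ := by
  refine StarAlgHom.ext_of_generators (s := boxGens ω X Y) ?_
  rintro _ (⟨x, hx, rfl⟩ | ⟨y, hy, rfl⟩)
  · exact h₁ ⟨x, hx⟩
  · exact h₂ ⟨y, hy⟩

end ZNAlg

/-! ### Existence and equivariance of the braided comultiplication -/

namespace EquivariantRep

variable {N : ℕ} [NeZero N] {ω : ℂ} (L : EquivariantRep.{u} N ω)

/-- The representation as an isomorphism onto its image. -/
def opEquiv : CS N ω ≃⋆ₐ[ℂ] L.alg.A := StarAlgEquiv.ofInjective L.π L.injective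

theorem opEquiv_apply (a : CS N ω) : L.opEquiv a = L.op a := rfl

theorem op_surjective : Function.Surjective L.op := L.opEquiv.surjective

theorem CS_hom_ext {B : Type*} [CStarAlgebra B] {φ ψ : CS N ω →⋆ₐ[ℂ] B}
    (h : ∀ i j, φ (q ω i j) = ψ (q ω i j)) : φ = ψ := by
  refine StarAlgHom.ext fun a => ?_
  exact CS.induction (StarAlgHom.equalizer φ ψ)
    (isClosed_eq (StarAlgHom.continuous_of_cstar φ) (StarAlgHom.continuous_of_cstar ψ)) h a

theorem isHomogeneous_op (i j : ZMod N) :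
    ZNAlg.IsHomogeneous ω (X := L.alg) (L.op (q ω i j)) (j - i) := fun t =>
  Subtype.ext (L.equivariant t i j)

theorem anyonicFamily_op : AnyonicFamily ω fun i j => L.op (q ω i j) :=
  anyonicFamily_q.map (L.opEquiv : CS N ω →⋆ₐ[ℂ] L.alg.A)

theorem exists_isBraidedComult (hω : IsPrimitiveRoot ω N) :
    ∃ Δ : CS N ω →⋆ₐ[ℂ] L.double.A, L.IsBraidedComult Δ := by
  -- Closedness makes `L.double.A` a C*-algebra, so that the universal property can be applied with
  -- it as target.
  have : IsClosed (L.double.A : Set (L.double.H →L[ℂ] L.double.H)) := L.double.isClosed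
  refine AnyonicFamily.exists_hom (B := L.double.A) (b := fun i j =>
    ∑ k, ZNAlg.j₁ ω L.alg L.alg (L.op (q ω i k)) * ZNAlg.j₂ ω L.alg L.alg (L.op (q ω k j))) ?_
  exact AnyonicFamily.braidedMul hω (L.anyonicFamily_op.map (ZNAlg.j₁Hom L.alg L.alg ω))
    (L.anyonicFamily_op.map (ZNAlg.j₂Hom L.alg L.alg hω)) fun k j a b =>
      ZNAlg.j₂_mul_j₁ hω (L.isHomogeneous_op a b) (L.isHomogeneous_op k j)

/-- The braided comultiplication is equivariant. -/
theorem IsBraidedComult.act (hω : IsPrimitiveRoot ω N) {Δ : CS N ω →⋆ₐ[ℂ] L.double.A}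
    (hΔ : L.IsBraidedComult Δ) (t : ZMod N) (a b : CS N ω) (h : L.alg.act t (L.op a) = L.op b) :
    L.double.act t (Δ a) = Δ b := by
  have : IsClosed (L.double.A : Set (L.double.H →L[ℂ] L.double.H)) := L.double.isClosed
  -- The action lives on `L.alg.A` and is transported to `CS N ω` along `opEquiv`; both sides are
  -- `*`-homomorphisms and can be compared on generators.
  have hext : (L.double.actHom t).comp Δ = Δ.comp (((L.opEquiv.symm : L.alg.A →⋆ₐ[ℂ] CS N ω).comp
      (L.alg.actHom t)).comp (L.opEquiv : CS N ω →⋆ₐ[ℂ] L.alg.A)) := by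
    refine CS_hom_ext fun i j => ?_
    change L.double.act t (Δ (q ω i j)) = Δ (L.opEquiv.symm (L.alg.act t (L.op (q ω i j))))
    have h1 : ZNAlg.IsHomogeneous ω (X := L.double) (Δ (q ω i j)) (j - i) := by
      rw [hΔ]
      refine ZNAlg.IsHomogeneous.sum fun k _ => ?_
      -- The degrees telescope: (k - i) + (j - k) = j - i.
      have := (L.isHomogeneous_op i k).j₁.mul hω ((L.isHomogeneous_op k j).j₂ hω)
      rwa [sub_add_sub_cancel'] at this
    rw [h1, L.isHomogeneous_op, map_smul, ← L.opEquiv_apply, StarAlgEquiv.symm_apply_apply,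
      map_smul]
  refine (DFunLike.congr_fun hext a).trans ?_
  change Δ (L.opEquiv.symm (L.alg.act t (L.op a))) = _
  rw [h, ← L.opEquiv_apply, StarAlgEquiv.symm_apply_apply]

end EquivariantRep

/-! ### Families of isometries with orthogonal ranges that add up to the whole space -/

section Decomposition

open ContinuousLinearMap (adjoint)

variable {ι : Type*} [Fintype ι] [DecidableEq ι]
  {K E K' E' : Type*} [NormedAddCommGroup K] [InnerProductSpace ℂ K] [CompleteSpace K]
  [NormedAddCommGroup E] [InnerProductSpace ℂ E] [CompleteSpace E]
  [NormedAddCommGroup K'] [InnerProductSpace ℂ K'] [CompleteSpace K']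
  [NormedAddCommGroup E'] [InnerProductSpace ℂ E'] [CompleteSpace E']

/-- The operators `κ i` are isometries whose ranges form an orthogonal decomposition. -/
structure IsDecomposition (κ : ι → K →L[ℂ] E) : Prop where
  adjoint_comp : ∀ i j, adjoint (κ i) ∘L κ j = if i = j then 1 else 0
  sum_comp : ∑ i, κ i ∘L adjoint (κ i) = 1

variable {κ : ι → K →L[ℂ] E} {κ' : ι → K' →L[ℂ] E'}

theorem IsDecomposition.comp_eq_sum (h : IsDecomposition κ) {F : Type*} [NormedAddCommGroup F]
    [InnerProductSpace ℂ F] (T : E →L[ℂ] F) : T = ∑ i, (T ∘L κ i) ∘L adjoint (κ i) := by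
  conv_lhs => rw [← ContinuousLinearMap.comp_id T]
  change T ∘L (1 : E →L[ℂ] E) = _
  rw [← h.sum_comp, ContinuousLinearMap.comp_finsetSum]
  rfl

theorem IsDecomposition.ext (h : IsDecomposition κ) {F : Type*} [NormedAddCommGroup F]
    [InnerProductSpace ℂ F] {S T : E →L[ℂ] F} (hST : ∀ i, S ∘L κ i = T ∘L κ i) : S = T := by
  rw [h.comp_eq_sum S, h.comp_eq_sum T]
  simp only [hST]

/-- Matrix multiplication, obtained by inserting ∑ κ_l κ_l* = 1 between S and T. -/
theorem IsDecomposition.adjoint_comp_mul_comp (h : IsDecomposition κ) (S T : E →L[ℂ] E)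
    (i j : ι) : adjoint (κ i) ∘L (S * T) ∘L κ j
      = ∑ l, (adjoint (κ i) ∘L S ∘L κ l) * (adjoint (κ l) ∘L T ∘L κ j) := by
  conv_lhs => rw [h.comp_eq_sum S]
  change adjoint (κ i) ∘L (((∑ l, (S ∘L κ l) ∘L adjoint (κ l)) ∘L T) ∘L κ j) = _
  rw [ContinuousLinearMap.finsetSum_comp, ContinuousLinearMap.finsetSum_comp,
    ContinuousLinearMap.comp_finsetSum]
  rfl

omit [Fintype ι] [DecidableEq ι] in
theorem adjoint_comp_star_comp (S : E →L[ℂ] E) (i j : ι) :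
    adjoint (κ i) ∘L star S ∘L κ j = star (adjoint (κ j) ∘L S ∘L κ i) := by
  simp only [ContinuousLinearMap.star_eq_adjoint, ContinuousLinearMap.adjoint_comp,
    ContinuousLinearMap.adjoint_adjoint, ContinuousLinearMap.comp_assoc]

theorem IsDecomposition.adjoint_comp_algebraMap_comp (h : IsDecomposition κ) (r : ℂ) (i j : ι) :
    adjoint (κ i) ∘L algebraMap ℂ (E →L[ℂ] E) r ∘L κ j
      = algebraMap ℂ (K →L[ℂ] K) (if i = j then r else 0) := by
  have h1 : adjoint (κ i) ∘L algebraMap ℂ (E →L[ℂ] E) r ∘L κ j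
      = r • (adjoint (κ i) ∘L κ j) := by
    rw [Algebra.algebraMap_eq_smul_one, ContinuousLinearMap.smul_comp,
      ContinuousLinearMap.comp_smul]
    rfl
  rw [h1, h.adjoint_comp]
  split_ifs
  · rw [Algebra.algebraMap_eq_smul_one]
  · rw [smul_zero, map_zero]

/-- The operators whose matrix entries with respect to an orthogonal decomposition belong to a
given algebra. -/
def IsDecomposition.matrixAlg (h : IsDecomposition κ) (A : StarSubalgebra ℂ (K →L[ℂ] K)) :
    StarSubalgebra ℂ (E →L[ℂ] E) where
  carrier := {T | ∀ i j, adjoint (κ i) ∘L T ∘L κ j ∈ A}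
  mul_mem' {S T} hS hT i j := by
    rw [h.adjoint_comp_mul_comp]
    exact sum_mem fun l _ => mul_mem (hS i l) (hT l j)
  add_mem' {S T} hS hT i j := by
    rw [ContinuousLinearMap.add_comp, ContinuousLinearMap.comp_add]
    exact add_mem (hS i j) (hT i j)
  algebraMap_mem' r i j := by
    rw [h.adjoint_comp_algebraMap_comp]
    exact A.algebraMap_mem _
  star_mem' {S} hS i j := by
    rw [adjoint_comp_star_comp]
    exact star_mem (hS j i)

theorem IsDecomposition.isClosed_matrixAlg (h : IsDecomposition κ)
    {A : StarSubalgebra ℂ (K →L[ℂ] K)} (hA : IsClosed (A : Set (K →L[ℂ] K))) :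
    IsClosed (h.matrixAlg A : Set (E →L[ℂ] E)) := by
  change IsClosed {T | ∀ i j, adjoint (κ i) ∘L T ∘L κ j ∈ A}
  simp only [Set.ofPred_forall]
  refine isClosed_iInter fun i => isClosed_iInter fun j => hA.preimage ?_
  fun_prop

theorem IsDecomposition.adjoint_comp_sum_comp (h : IsDecomposition κ) (c : ι → ι → K →L[ℂ] K)
    (i j : ι) : adjoint (κ i) ∘L (∑ a, ∑ b, κ a ∘L c a b ∘L adjoint (κ b)) ∘L κ j = c i j := by
  have h1 : ∀ a b, adjoint (κ i) ∘L (κ a ∘L c a b ∘L adjoint (κ b)) ∘L κ j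
      = (adjoint (κ i) ∘L κ a) ∘L c a b ∘L (adjoint (κ b) ∘L κ j) := fun a b => rfl
  simp only [ContinuousLinearMap.finsetSum_comp, ContinuousLinearMap.comp_finsetSum, h1,
    h.adjoint_comp]
  rw [Finset.sum_eq_single i, Finset.sum_eq_single j, if_pos rfl, if_pos rfl]
  · rfl
  · intro b _ hb
    rw [if_neg hb, ContinuousLinearMap.comp_zero, ContinuousLinearMap.comp_zero]
  · simp
  · intro a _ ha
    simp only [if_neg ha.symm, ContinuousLinearMap.zero_comp, Finset.sum_const_zero]
  · simp

/-- The resolution of the identity, inserted on both sides, recovers an operator from its matrix. -/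
theorem IsDecomposition.ext_entries (h : IsDecomposition κ) {S T : E →L[ℂ] E}
    (hST : ∀ i j, adjoint (κ i) ∘L S ∘L κ j = adjoint (κ i) ∘L T ∘L κ j) : S = T := by
  refine h.ext fun j => ?_
  have key : ∀ R : E →L[ℂ] E, R ∘L κ j = ∑ i, κ i ∘L (adjoint (κ i) ∘L R ∘L κ j) := fun R => by
    have h1 : R ∘L κ j = (∑ i, κ i ∘L adjoint (κ i)) ∘L (R ∘L κ j) := by
      rw [h.sum_comp]
      rfl
    conv_lhs => rw [h1, ContinuousLinearMap.finsetSum_comp]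
    rfl
  rw [key S, key T]
  simp only [hST]

/-- The entrywise application of a `*`-homomorphism to operator matrices. -/
def IsDecomposition.matrixHom (h : IsDecomposition κ) (h' : IsDecomposition κ')
    {A : StarSubalgebra ℂ (K →L[ℂ] K)} (f : A →⋆ₐ[ℂ] (K' →L[ℂ] K')) :
    h.matrixAlg A →⋆ₐ[ℂ] (E' →L[ℂ] E') :=
  let F (T : h.matrixAlg A) : E' →L[ℂ] E' :=
    ∑ i, ∑ j, κ' i ∘L f ⟨adjoint (κ i) ∘L (T : E →L[ℂ] E) ∘L κ j, T.2 i j⟩ ∘L adjoint (κ' j)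
  have hF (T : h.matrixAlg A) (i j : ι) : adjoint (κ' i) ∘L F T ∘L κ' j
      = f ⟨adjoint (κ i) ∘L (T : E →L[ℂ] E) ∘L κ j, T.2 i j⟩ := h'.adjoint_comp_sum_comp _ i j
  have hc (r : ℂ) : F (algebraMap ℂ _ r) = algebraMap ℂ _ r := by
    refine h'.ext_entries fun i j => ?_
    rw [hF, h'.adjoint_comp_algebraMap_comp]
    refine Eq.trans ?_ (AlgHomClass.commutes f _)
    exact congrArg f (Subtype.ext (h.adjoint_comp_algebraMap_comp r i j))
  { toFun := F
    map_one' := by simpa using hc 1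
    map_mul' := fun S T => by
      refine h'.ext_entries fun i j => ?_
      rw [h'.adjoint_comp_mul_comp, hF]
      simp only [hF, ← map_mul, ← map_sum]
      refine congrArg f (Subtype.ext ((h.adjoint_comp_mul_comp _ _ i j).trans ?_))
      simp
    map_zero' := by simpa using hc 0
    map_add' := fun S T => by
      refine h'.ext_entries fun i j => ?_
      rw [ContinuousLinearMap.add_comp, ContinuousLinearMap.comp_add, hF, hF, hF, ← map_add]
      refine congrArg f (Subtype.ext ?_)
      change adjoint (κ i) ∘L ((S : E →L[ℂ] E) + (T : E →L[ℂ] E)) ∘L κ j = _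
      rw [ContinuousLinearMap.add_comp, ContinuousLinearMap.comp_add]
      rfl
    commutes' := hc
    map_star' := fun S => by
      refine h'.ext_entries fun i j => ?_
      rw [adjoint_comp_star_comp, hF, hF, ← map_star]
      exact congrArg f (Subtype.ext (adjoint_comp_star_comp _ i j)) }

theorem IsDecomposition.adjoint_comp_matrixHom_comp (h : IsDecomposition κ)
    (h' : IsDecomposition κ') {A : StarSubalgebra ℂ (K →L[ℂ] K)} (f : A →⋆ₐ[ℂ] (K' →L[ℂ] K'))
    (T : h.matrixAlg A) (i j : ι) : adjoint (κ' i) ∘L h.matrixHom h' f T ∘L κ' j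
      = f ⟨adjoint (κ i) ∘L (T : E →L[ℂ] E) ∘L κ j, T.2 i j⟩ :=
  h'.adjoint_comp_sum_comp _ i j

theorem IsDecomposition.sum_comp_comp (h : IsDecomposition κ) (T : K →L[ℂ] K) (j : ι) :
    (∑ i, κ i ∘L T ∘L adjoint (κ i)) ∘L κ j = κ j ∘L T := by
  rw [ContinuousLinearMap.finsetSum_comp, Finset.sum_eq_single j]
  · change κ j ∘L T ∘L (adjoint (κ j) ∘L κ j) = _
    rw [h.adjoint_comp, if_pos rfl]
    rfl
  · intro i _ hi
    change κ i ∘L T ∘L (adjoint (κ i) ∘L κ j) = _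
    rw [h.adjoint_comp, if_neg hi, ContinuousLinearMap.comp_zero, ContinuousLinearMap.comp_zero]
  · simp

/-- The amplification of an operator along an orthogonal decomposition into isometric images. -/
def IsDecomposition.ampl (h : IsDecomposition κ) : (K →L[ℂ] K) →⋆ₐ[ℂ] (E →L[ℂ] E) where
  toFun T := ∑ i, κ i ∘L T ∘L adjoint (κ i)
  map_one' := h.sum_comp
  map_mul' S T := by
    refine h.ext fun j => ?_
    rw [h.sum_comp_comp, ContinuousLinearMap.mul_def (∑ i, κ i ∘L S ∘L adjoint (κ i)),
      ContinuousLinearMap.comp_assoc, h.sum_comp_comp, ← ContinuousLinearMap.comp_assoc,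
      h.sum_comp_comp]
    rfl
  map_zero' := by simp
  map_add' S T := by
    simp [Finset.sum_add_distrib]
  commutes' r := by
    refine h.ext fun j => ?_
    rw [h.sum_comp_comp, Algebra.algebraMap_eq_smul_one, Algebra.algebraMap_eq_smul_one,
      ContinuousLinearMap.smul_comp, ContinuousLinearMap.comp_smul]
    rfl
  map_star' S := by
    simp only [ContinuousLinearMap.star_eq_adjoint, map_sum, ContinuousLinearMap.adjoint_comp,
      ContinuousLinearMap.adjoint_adjoint, ContinuousLinearMap.comp_assoc]

/-- G = ∑ G κ_i κ_i* = ∑ κ_i T κ_i*. Intertwining relations alone therefore identify an amplified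
operator, without computing any adjoint. -/
theorem IsDecomposition.ampl_eq (h : IsDecomposition κ) {T : K →L[ℂ] K} {G : E →L[ℂ] E}
    (hG : ∀ i, G ∘L κ i = κ i ∘L T) : h.ampl T = G := by
  refine Eq.trans ?_ (h.comp_eq_sum G).symm
  simp only [hG]
  rfl

end Decomposition

/-! ### The Fourier basis of `ℓ²(ℤ/N)` -/

section Fourier

open ContinuousLinearMap (adjoint)

variable {N : ℕ} [NeZero N] {ω : ℂ}

/-- The normalized characters of `ℤ/N`. -/
def chi (ω : ℂ) (m : ZMod N) : EuclideanSpace ℂ (ZMod N) :=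
  ((Real.sqrt N : ℝ) : ℂ)⁻¹ • WithLp.toLp 2 fun s => zpw ω (m * s)

omit [NeZero N] in
theorem chi_apply (m s : ZMod N) : chi ω m s = ((Real.sqrt N : ℝ) : ℂ)⁻¹ * zpw ω (m * s) := rfl

theorem orthonormal_chi (hω : IsPrimitiveRoot ω N) : Orthonormal ℂ (chi (N := N) ω) := by
  rw [orthonormal_iff_ite]
  intro m n
  have hN : (((Real.sqrt N : ℝ) : ℂ)⁻¹ * ((Real.sqrt N : ℝ) : ℂ)⁻¹) * (N : ℂ) = 1 := by
    rw [← mul_inv, ← Complex.ofReal_mul, Real.mul_self_sqrt (Nat.cast_nonneg N),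
      Complex.ofReal_natCast, inv_mul_cancel₀ (NeZero.ne _)]
  have h := sum_zpw hω (n - m)
  simp only [PiLp.inner_apply, chi_apply, RCLike.inner_apply, map_mul, map_inv₀,
    Complex.conj_ofReal]
  have h2 : ∀ s : ZMod N, ((Real.sqrt N : ℝ) : ℂ)⁻¹ * zpw ω (n * s)
      * (((Real.sqrt N : ℝ) : ℂ)⁻¹ * (starRingEnd ℂ) (zpw ω (m * s)))
      = (((Real.sqrt N : ℝ) : ℂ)⁻¹ * ((Real.sqrt N : ℝ) : ℂ)⁻¹) * zpw ω (s * (n - m)) := by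
    intro s
    have h3 : (starRingEnd ℂ) (zpw ω (m * s)) = zpw ω (-(m * s)) := star_zpw hω _
    rw [h3, mul_mul_mul_comm, ← zpw_add hω]
    congr 2
    ring
  simp only [h2]
  rw [← Finset.mul_sum, h]
  by_cases hmn : m = n
  · rw [if_pos hmn, if_pos (by rw [hmn, sub_self]), hN]
  · rw [if_neg hmn, if_neg (sub_ne_zero.mpr (Ne.symm hmn)), mul_zero]

/-- The Fourier basis. -/
def chiBasis (hω : IsPrimitiveRoot ω N) :
    OrthonormalBasis (ZMod N) ℂ (EuclideanSpace ℂ (ZMod N)) :=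
  (basisOfOrthonormalOfCardEqFinrank (orthonormal_chi hω) (by simp)).toOrthonormalBasis
    (by simpa using orthonormal_chi hω)

theorem chiBasis_apply (hω : IsPrimitiveRoot ω N) (m : ZMod N) : chiBasis hω m = chi ω m := by
  simp [chiBasis]

/-- The operators `ξ ↦ χ_m ⊗ ξ`. -/
def chiKet (ω : ℂ) (K : Type*) [NormedAddCommGroup K] [InnerProductSpace ℂ K] (m : ZMod N) :
    K →L[ℂ] HTensor (CZ N).H K :=
  ket (H := (CZ N).H) K (chi ω m : EuclideanSpace ℂ (ZMod N))

variable {K : Type*} [NormedAddCommGroup K] [InnerProductSpace ℂ K]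

theorem isDecomposition_chiKet [CompleteSpace K] (hω : IsPrimitiveRoot ω N) :
    IsDecomposition (chiKet (N := N) ω K) where
  adjoint_comp i j := by
    refine (adjoint_ket_comp_ket (H := (CZ N).H) _ _).trans ?_
    have h := orthonormal_iff_ite.mp (orthonormal_chi hω) i j
    rw [show inner ℂ (show (CZ N).H from chi ω i) (show (CZ N).H from chi ω j) = _ from h]
    split_ifs <;> simp
  sum_comp := by
    have h := sum_ket_comp_adjoint_ket (K := K) (chiBasis hω)
    simp only [chiBasis_apply] at h
    exact h

/-- The Fourier basis diagonalizes the regular representation, with χ_m of weight m, while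
multiplication by a character permutes it (`mulOp_chi`). -/
theorem V_chi (hω : IsPrimitiveRoot ω N) (m t : ZMod N) :
    (CZ N).V t (chi ω m : EuclideanSpace ℂ (ZMod N)) = zpw ω (t * m) • chi ω m := by
  refine PiLp.ext fun s => ?_
  refine (regU_apply N (Multiplicative.ofAdd t) (chi ω m) s).trans ?_
  rw [PiLp.smul_apply, chi_apply, chi_apply, smul_eq_mul, mul_left_comm, ← zpw_add hω,
    toAdd_ofAdd]
  congr 2
  ring

theorem ZNAlg.proj_apply_of_eigenvector (hω : IsPrimitiveRoot ω N) (X : ZNAlg.{v} N)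
    {n : ZMod N} {ξ : X.H} (hξ : ∀ t, X.V t ξ = zpw ω (t * n) • ξ) (m : ZMod N) :
    X.proj ω m ξ = if m = n then ξ else 0 := by
  have h := sum_zpw hω (n - m)
  simp only [sub_eq_zero, eq_comm (a := n)] at h
  have h1 : X.proj ω m ξ = ((N : ℂ)⁻¹ * ∑ t : ZMod N, zpw ω (t * (n - m))) • ξ := by
    rw [ZNAlg.proj_eq, smul_apply, sum_apply, mul_smul, Finset.sum_smul]
    refine congrArg _ (Finset.sum_congr rfl fun t _ => ?_)
    rw [smul_apply, hξ, smul_smul, ← zpw_add hω]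
    congr 2
    ring
  rw [h1, h]
  split_ifs
  · rw [inv_mul_cancel₀ (NeZero.ne _), one_smul]
  · rw [mul_zero, zero_smul]

theorem proj_chi (hω : IsPrimitiveRoot ω N) (m n : ZMod N) :
    (CZ N).proj ω m (chi ω n : EuclideanSpace ℂ (ZMod N)) = if m = n then chi ω n else 0 :=
  ZNAlg.proj_apply_of_eigenvector hω (CZ N) (V_chi hω n) m

theorem mulOp_chi (hω : IsPrimitiveRoot ω N) (d m : ZMod N) :
    mulOp N (fun s => zpw ω (d * s)) (chi ω m) = chi ω (m + d) := by
  refine PiLp.ext fun s => ?_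
  rw [mulOp_apply, chi_apply, chi_apply, mul_left_comm, ← zpw_add hω]
  congr 2
  ring

/-- The functions `s ↦ ω ^ (d * s)` span the functions on `ℤ/N`. -/
theorem fun_eq_sum_zpw (hω : IsPrimitiveRoot ω N) (f : ZMod N → ℂ) :
    f = ∑ d : ZMod N, ((N : ℂ)⁻¹ * ∑ t, f t * zpw ω (-(d * t))) • fun s => zpw ω (d * s) := by
  funext s
  have h : ∀ t, ∑ d : ZMod N, zpw ω (-(d * t)) * zpw ω (d * s) = if t = s then (N : ℂ) else 0 := by
    intro t
    have h' := sum_zpw hω (s - t)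
    simp only [sub_eq_zero, eq_comm (a := s)] at h'
    rw [← h']
    refine Finset.sum_congr rfl fun d _ => ?_
    rw [← zpw_add hω]
    congr 1
    ring
  simp only [Finset.sum_apply, Pi.smul_apply, smul_eq_mul, mul_assoc, Finset.sum_mul]
  rw [← Finset.mul_sum, Finset.sum_comm]
  simp only [← Finset.mul_sum, h, mul_ite, mul_zero, Finset.sum_ite_eq', Finset.mem_univ, if_true]
  rw [mul_comm (f s), inv_mul_cancel_left₀ (NeZero.ne _)]

/-! ### The two embeddings in the Fourier basis -/

namespace ZNAlg

variable (Y : ZNAlg.{v} N)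

theorem opj₁_comp_chiKet (hω : IsPrimitiveRoot ω N) (d m : ZMod N) :
    opj₁ (CZ N) Y (mulOp N fun s => zpw ω (d * s)) ∘L chiKet ω Y.H m = chiKet ω Y.H (m + d) := by
  refine (opTensor_comp_ket _ _ _).trans ?_
  have h := mulOp_chi hω d m
  exact congrArg (fun v => ket (H := (CZ N).H) Y.H v) h

/-- Since χ_m has weight m, a single term of ∑ P_n ⊗ V_{-n} y V_n survives. -/
theorem opj₂_comp_chiKet (hω : IsPrimitiveRoot ω N) (y : Y.H →L[ℂ] Y.H) (m : ZMod N) :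
    opj₂ ω (CZ N) Y y ∘L chiKet ω Y.H m = chiKet ω Y.H m ∘L (Y.V (-m) * y * Y.V m) := by
  rw [opj₂_eq _ _ hω, ContinuousLinearMap.finsetSum_comp, Finset.sum_eq_single m]
  · refine (opTensor_comp_ket _ _ _).trans ?_
    have h := proj_chi hω m m
    rw [if_pos rfl] at h
    exact congrArg (fun v => ket (H := (CZ N).H) Y.H v ∘L _) h
  · intro n _ hn
    refine (opTensor_comp_ket _ _ _).trans ?_
    have h := proj_chi hω n m
    rw [if_neg hn] at h
    refine (congrArg (fun v => ket (H := (CZ N).H) Y.H v ∘L _) h).trans ?_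
    refine ContinuousLinearMap.ext fun v => ?_
    exact (congrArg (HTensor.incl _ _) (TensorProduct.zero_tmul _ _)).trans (map_zero _)
  · simp

end ZNAlg

end Fourier

/-! ### The homomorphism `id ⊠ f` -/

namespace ZNAlg

open ContinuousLinearMap (adjoint)

variable {N : ℕ} [NeZero N] {ω : ℂ} (X : ZNAlg.{u} N) (Y : ZNAlg.{v} N)

theorem adjoint_comp_opj₁_comp (x : (CZ N).H →L[ℂ] (CZ N).H) (i j : ZMod N) :
    adjoint (chiKet ω X.H i) ∘L opj₁ (CZ N) X x ∘L chiKet ω X.H j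
      = algebraMap ℂ (X.H →L[ℂ] X.H)
        (inner ℂ (show (CZ N).H from chi ω i) (x (show (CZ N).H from chi ω j))) := by
  have h : opj₁ (CZ N) X x ∘L chiKet ω X.H j
      = ket X.H (x (show (CZ N).H from chi ω j)) := opTensor_comp_ket _ _ _
  rw [h, Algebra.algebraMap_eq_smul_one]
  exact adjoint_ket_comp_ket _ _

theorem adjoint_comp_opj₂_comp (hω : IsPrimitiveRoot ω N) (y : X.H →L[ℂ] X.H) (i j : ZMod N) :
    adjoint (chiKet ω X.H i) ∘L opj₂ ω (CZ N) X y ∘L chiKet ω X.H j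
      = if i = j then X.V (-j) * y * X.V j else 0 := by
  rw [opj₂_comp_chiKet X hω, ← ContinuousLinearMap.comp_assoc,
    (isDecomposition_chiKet hω).adjoint_comp]
  split_ifs
  · rfl
  · exact ContinuousLinearMap.zero_comp _

theorem adjoint_comp_opj₂_comp_mem (hω : IsPrimitiveRoot ω N) (y : X.A) (i j : ZMod N) :
    adjoint (chiKet ω X.H i) ∘L opj₂ ω (CZ N) X y ∘L chiKet ω X.H j
      = ((if i = j then X.act (-j) y else 0 : X.A) : X.H →L[ℂ] X.H) := by
  rw [adjoint_comp_opj₂_comp X hω]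
  split_ifs
  · rw [coe_act, neg_neg]
  · rfl

/-- Scalars and the translates ρ_{-m}(y) all lie in `X.A`, so the generators have entries there;
operators with entries in a closed algebra form a closed algebra. -/
theorem box_le_matrixAlg (hω : IsPrimitiveRoot ω N) :
    (box ω (CZ N) X).A ≤ (isDecomposition_chiKet (K := X.H) hω).matrixAlg X.A := by
  intro a ha
  refine box_mem ((isDecomposition_chiKet (K := X.H) hω).isClosed_matrixAlg X.isClosed)
    (box ω (CZ N) X).A.subtype (fun x => ?_) (fun y => ?_) ⟨a, ha⟩
  · intro i j
    have h := adjoint_comp_opj₁_comp (ω := ω) X x i j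
    exact h ▸ X.A.algebraMap_mem _
  · intro i j
    have h := adjoint_comp_opj₂_comp_mem X hω y i j
    exact h ▸ Subtype.property _

variable {X Y}

/-- An equivariant `*`-homomorphism `f : X → Y` induces `id ⊠ f : C(ℤ/N) ⊠ X → C(ℤ/N) ⊠ Y`. -/
theorem exists_id_box (hω : IsPrimitiveRoot ω N) (f : X.A →⋆ₐ[ℂ] Y.A)
    (hf : ∀ t a, f (X.act t a) = Y.act t (f a)) :
    ∃ Φ : (box ω (CZ N) X).A →⋆ₐ[ℂ] (box ω (CZ N) Y).A,
      (∀ x, Φ (j₁ ω (CZ N) X x) = j₁ ω (CZ N) Y x) ∧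
      ∀ a, Φ (j₂ ω (CZ N) X a) = j₂ ω (CZ N) Y (f a) := by
  have hX := isDecomposition_chiKet (K := X.H) hω
  have hY := isDecomposition_chiKet (K := Y.H) hω
  let Φ₀ : (box ω (CZ N) X).A →⋆ₐ[ℂ] (HTensor (CZ N).H Y.H →L[ℂ] HTensor (CZ N).H Y.H) :=
    (hX.matrixHom hY (Y.A.subtype.comp f)).comp
      (StarSubalgebra.inclusion (box_le_matrixAlg X hω))
  have h₁ : ∀ x : (CZ N).A, Φ₀ (j₁ ω (CZ N) X x) = opj₁ (CZ N) Y x := fun x => by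
    refine hY.ext_entries fun i j => (hX.adjoint_comp_matrixHom_comp hY _ _ i j).trans ?_
    rw [adjoint_comp_opj₁_comp]
    refine Eq.trans ?_ (AlgHomClass.commutes (Y.A.subtype.comp f) _)
    exact congrArg _ (Subtype.ext (adjoint_comp_opj₁_comp (ω := ω) X x i j))
  have h₂ : ∀ a : X.A, Φ₀ (j₂ ω (CZ N) X a) = opj₂ ω (CZ N) Y (f a) := fun a => by
    refine hY.ext_entries fun i j => (hX.adjoint_comp_matrixHom_comp hY _ _ i j).trans ?_
    rw [adjoint_comp_opj₂_comp_mem Y hω]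
    -- Equivariance enters here: f must carry the diagonal entry ρ_{-j}(a) to ρ_{-j}(f(a)).
    have h : (Y.A.subtype.comp f) (if i = j then X.act (-j) a else 0)
        = ((if i = j then Y.act (-j) (f a) else 0 : Y.A) : Y.H →L[ℂ] Y.H) := by
      rw [← hf, StarAlgHom.comp_apply]
      split_ifs
      · rfl
      · rw [map_zero]; rfl
    rw [← h]
    exact congrArg _ (Subtype.ext (adjoint_comp_opj₂_comp_mem X hω a i j))
  have hmem : ∀ a, Φ₀ a ∈ (box ω (CZ N) Y).A :=
    box_mem (box ω (CZ N) Y).isClosed Φ₀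
      (fun x => (h₁ x).symm ▸ opj₁_mem ω (CZ N) Y x.2)
      (fun y => (h₂ y).symm ▸ opj₂_mem ω (CZ N) Y (f y).2)
  exact ⟨StarAlgHom.codRestrict Φ₀ _ hmem, fun x => Subtype.ext (h₁ x), fun a => Subtype.ext (h₂ a)⟩

/-! ### The homomorphism `C(ℤ/N) ⊠ X ⊠ Y → (C(ℤ/N) ⊠ X) ⊗ (C(ℤ/N) ⊠ Y)` -/

variable (X Y)

/-- The operator `ξ ⊗ η ↦ (χ_m ⊗ P_n ξ) ⊗ (χ_{m + n + k} ⊗ V_{-k} η)`. -/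
def splitBlock (ω : ℂ) (k m n : ZMod N) :
    HTensor X.H Y.H →L[ℂ] HTensor (HTensor (CZ N).H X.H) (HTensor (CZ N).H Y.H) :=
  opTensor (chiKet ω X.H m ∘L X.proj ω n) (chiKet ω Y.H (m + n + k) ∘L Y.V (-k))

/-- The isometry sending `χ_m ⊗ ξ ⊗ η` to `∑ n, (χ_m ⊗ P_n ξ) ⊗ (χ_{m + n + k} ⊗ V_{-k} η)`. -/
def split (ω : ℂ) (k : ZMod N) :
    HTensor (CZ N).H (HTensor X.H Y.H) →L[ℂ]
      HTensor (HTensor (CZ N).H X.H) (HTensor (CZ N).H Y.H) :=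
  ∑ m, (∑ n, splitBlock X Y ω k m n) ∘L adjoint (chiKet ω (HTensor X.H Y.H) m)

theorem split_comp_chiKet (hω : IsPrimitiveRoot ω N) (k m : ZMod N) :
    split X Y ω k ∘L chiKet ω (HTensor X.H Y.H) m = ∑ n, splitBlock X Y ω k m n := by
  rw [split, ContinuousLinearMap.finsetSum_comp, Finset.sum_eq_single m]
  · rw [ContinuousLinearMap.comp_assoc, (isDecomposition_chiKet hω).adjoint_comp, if_pos rfl]
    rfl
  · intro i _ hi
    rw [ContinuousLinearMap.comp_assoc, (isDecomposition_chiKet hω).adjoint_comp, if_neg hi,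
      ContinuousLinearMap.comp_zero]
  · simp

theorem adjoint_splitBlock (hω : IsPrimitiveRoot ω N) (k m n : ZMod N) :
    adjoint (splitBlock X Y ω k m n) = opTensor (X.proj ω n ∘L adjoint (chiKet ω X.H m))
      (Y.V k ∘L adjoint (chiKet ω Y.H (m + n + k))) := by
  have h1 : adjoint (X.proj ω n) = X.proj ω n := X.star_proj hω n
  have h2 : adjoint (Y.V (-k)) = Y.V k := by
    have := Y.star_V (-k)
    rwa [neg_neg] at this
  rw [splitBlock, adjoint_opTensor, ContinuousLinearMap.adjoint_comp,
    ContinuousLinearMap.adjoint_comp, h1, h2]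

/-- The first leg separates m and n. Once these agree, the characters χ_{m+n+k} in the second leg
separate k. -/
theorem adjoint_splitBlock_comp (hω : IsPrimitiveRoot ω N) (k m n k' m' n' : ZMod N) :
    adjoint (splitBlock X Y ω k m n) ∘L splitBlock X Y ω k' m' n'
      = if m = m' ∧ n = n' ∧ k = k' then opTensor (X.proj ω n) 1 else 0 := by
  rw [adjoint_splitBlock X Y hω, splitBlock, opTensor_comp]
  have h1 : (X.proj ω n ∘L adjoint (chiKet ω X.H m)) ∘L chiKet ω X.H m' ∘L X.proj ω n'
      = if m = m' ∧ n = n' then X.proj ω n else 0 := by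
    change X.proj ω n ∘L (adjoint (chiKet ω X.H m) ∘L chiKet ω X.H m') ∘L X.proj ω n' = _
    rw [(isDecomposition_chiKet hω).adjoint_comp]
    by_cases hm : m = m'
    · rw [if_pos hm]
      refine (X.proj_mul_proj hω n n').trans ?_
      simp [hm]
    · simp [hm]
  rw [h1]
  by_cases hmn : m = m' ∧ n = n'
  · obtain ⟨rfl, rfl⟩ := hmn
    change opTensor _ (Y.V k ∘L (adjoint (chiKet ω Y.H (m + n + k)) ∘L
      chiKet ω Y.H (m + n + k')) ∘L Y.V (-k')) = _
    rw [(isDecomposition_chiKet hω).adjoint_comp]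
    by_cases hk : k = k'
    · subst hk
      have h2 : Y.V k ∘L (1 : Y.H →L[ℂ] Y.H) ∘L Y.V (-k) = 1 := by
        refine (Y.V_mul k (-k)).trans ?_
        rw [add_neg_cancel, V_zero]
      simp [h2]
    · simp [hk, opTensor_zero_right]
  · rw [if_neg hmn, opTensor_zero_left, if_neg]
    exact fun h => hmn ⟨h.1, h.2.1⟩

/-- For fixed m and n, the characters χ_{m+n+k} run through the whole Fourier basis as k varies.
Summing over k, then n, then m exhausts the second leg, the weights of X and the first Fourier
basis. -/
theorem isDecomposition_split (hω : IsPrimitiveRoot ω N) :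
    IsDecomposition (split X Y ω) where
  adjoint_comp k l := by
    refine (isDecomposition_chiKet (K := HTensor X.H Y.H) hω).ext_entries fun i j => ?_
    have h : adjoint (chiKet ω (HTensor X.H Y.H) i) ∘L (adjoint (split X Y ω k) ∘L split X Y ω l)
        ∘L chiKet ω (HTensor X.H Y.H) j
        = adjoint (∑ n, splitBlock X Y ω k i n) ∘L ∑ n, splitBlock X Y ω l j n := by
      rw [← split_comp_chiKet X Y hω, ← split_comp_chiKet X Y hω,
        ContinuousLinearMap.adjoint_comp]
      rfl
    rw [h, map_sum, ContinuousLinearMap.finsetSum_comp]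
    simp only [ContinuousLinearMap.comp_finsetSum, adjoint_splitBlock_comp X Y hω]
    by_cases hkl : k = l
    · by_cases hij : i = j
      · simp only [hkl, hij, and_true, true_and, Finset.sum_ite_eq, Finset.mem_univ, if_true]
        rw [← opTensor_sum_left, X.sum_proj hω, opTensor_one]
        exact (((isDecomposition_chiKet hω).adjoint_comp j j).trans (if_pos rfl)).symm
      · simp only [hij, false_and, if_false, Finset.sum_const_zero, hkl, if_true]
        exact (((isDecomposition_chiKet hω).adjoint_comp i j).trans (if_neg hij)).symm
    · simp [hkl]
  sum_comp := by
    have h : ∀ k, split X Y ω k ∘L adjoint (split X Y ω k)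
        = ∑ m, ∑ n, opTensor (chiKet ω X.H m ∘L X.proj ω n ∘L adjoint (chiKet ω X.H m))
          (chiKet ω Y.H (m + n + k) ∘L adjoint (chiKet ω Y.H (m + n + k))) := fun k => by
      refine (congrArg (fun T => T ∘L adjoint (split X Y ω k))
        ((isDecomposition_chiKet hω).comp_eq_sum (split X Y ω k))).trans ?_
      rw [ContinuousLinearMap.finsetSum_comp]
      refine Finset.sum_congr rfl fun m _ => ?_
      rw [ContinuousLinearMap.comp_assoc, ← ContinuousLinearMap.adjoint_comp,
        split_comp_chiKet X Y hω, map_sum, ContinuousLinearMap.finsetSum_comp]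
      refine Finset.sum_congr rfl fun n _ => ?_
      rw [ContinuousLinearMap.comp_finsetSum, Finset.sum_eq_single n]
      · rw [adjoint_splitBlock X Y hω, splitBlock, opTensor_comp]
        congr 1
        · change chiKet ω X.H m ∘L (X.proj ω n * X.proj ω n) ∘L adjoint (chiKet ω X.H m) = _
          rw [X.proj_mul_proj hω, if_pos rfl]
        · change chiKet ω Y.H (m + n + k) ∘L (Y.V (-k) * Y.V k) ∘L _ = _
          rw [V_mul, neg_add_cancel, V_zero]
          rfl
      · intro n' _ hn
        rw [adjoint_splitBlock X Y hω, splitBlock, opTensor_comp]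
        have h0 : (chiKet ω X.H m ∘L X.proj ω n) ∘L X.proj ω n' ∘L adjoint (chiKet ω X.H m) = 0 := by
          change chiKet ω X.H m ∘L (X.proj ω n * X.proj ω n') ∘L adjoint (chiKet ω X.H m) = _
          rw [X.proj_mul_proj hω, if_neg hn.symm, ContinuousLinearMap.zero_comp,
            ContinuousLinearMap.comp_zero]
        rw [h0, opTensor_zero_left]
      · simp
    simp only [h]
    rw [Finset.sum_comm]
    have h3 : ∀ m n : ZMod N, ∑ k, opTensor
        (chiKet ω X.H m ∘L X.proj ω n ∘L adjoint (chiKet ω X.H m))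
        (chiKet ω Y.H (m + n + k) ∘L adjoint (chiKet ω Y.H (m + n + k)))
        = opTensor (chiKet ω X.H m ∘L X.proj ω n ∘L adjoint (chiKet ω X.H m)) 1 := fun m n => by
      rw [← opTensor_sum_right]
      congr 1
      exact (Equiv.sum_comp (Equiv.addLeft (m + n)) (fun k => chiKet ω Y.H k ∘L
        adjoint (chiKet ω Y.H k))).trans (isDecomposition_chiKet hω).sum_comp
    have h4 : ∀ m : ZMod N, ∑ n, opTensor
        (chiKet ω X.H m ∘L X.proj ω n ∘L adjoint (chiKet ω X.H m))
        (1 : HTensor (CZ N).H Y.H →L[ℂ] HTensor (CZ N).H Y.H)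
        = opTensor (chiKet ω X.H m ∘L adjoint (chiKet ω X.H m)) 1 := fun m => by
      rw [← opTensor_sum_left, ← ContinuousLinearMap.comp_finsetSum,
        ← ContinuousLinearMap.finsetSum_comp, X.sum_proj hω]
      rfl
    refine (Finset.sum_congr rfl fun m _ => Finset.sum_comm.trans
      ((Finset.sum_congr rfl fun n _ => h3 m n).trans (h4 m))).trans ?_
    rw [← opTensor_sum_left, (isDecomposition_chiKet hω).sum_comp, opTensor_one]

/-- Replacing m by m + d shifts both character indices m and m + n + k by d, which is the group-like
coproduct of a character. -/
theorem chi_shift_comp_split (hω : IsPrimitiveRoot ω N) (d k : ZMod N) :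
    opTensor (opj₁ (CZ N) X (mulOp N fun s => zpw ω (d * s)))
      (opj₁ (CZ N) Y (mulOp N fun s => zpw ω (d * s))) ∘L split X Y ω k
      = split X Y ω k ∘L opj₁ (CZ N) (box ω X Y) (mulOp N fun s => zpw ω (d * s)) := by
  refine (isDecomposition_chiKet (K := HTensor X.H Y.H) hω).ext fun m => ?_
  have h : opj₁ (CZ N) (box ω X Y) (mulOp N fun s => zpw ω (d * s)) ∘L
      chiKet ω (HTensor X.H Y.H) m = chiKet ω (HTensor X.H Y.H) (m + d) :=
    opj₁_comp_chiKet (box ω X Y) hω d m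
  refine Eq.trans ?_ (congrArg (fun T => split X Y ω k ∘L T) h).symm
  rw [ContinuousLinearMap.comp_assoc, split_comp_chiKet X Y hω, split_comp_chiKet X Y hω,
    ContinuousLinearMap.comp_finsetSum]
  refine Finset.sum_congr rfl fun n _ => ?_
  rw [splitBlock, splitBlock, opTensor_comp, ← ContinuousLinearMap.comp_assoc,
    ← ContinuousLinearMap.comp_assoc, opj₁_comp_chiKet X hω, opj₁_comp_chiKet Y hω]
  congr 3
  ring

theorem opj₂_opj₁_comp_chiKet (hω : IsPrimitiveRoot ω N) (a : X.H →L[ℂ] X.H) (m : ZMod N) :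
    opj₂ ω (CZ N) (box ω X Y) (opj₁ X Y a) ∘L chiKet ω (HTensor X.H Y.H) m
      = chiKet ω (HTensor X.H Y.H) m ∘L opTensor (X.V (-m) * a * X.V m) 1 := by
  refine (opj₂_comp_chiKet (box ω X Y) hω (opj₁ X Y a) m).trans
    (congrArg (fun T => chiKet ω (HTensor X.H Y.H) m ∘L T) ?_)
  have h := (box ω X Y).conj_eq (-m) (opj₁ X Y a)
  have h' := X.conj_eq (-m) a
  rw [neg_neg] at h h'
  refine h.symm.trans ((conj_opj₁ X Y _ a).trans ?_)
  rw [h']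
  rfl

theorem opj₂_opj₂_comp_chiKet (hω : IsPrimitiveRoot ω N) (b : Y.H →L[ℂ] Y.H) (m : ZMod N) :
    opj₂ ω (CZ N) (box ω X Y) (opj₂ ω X Y b) ∘L chiKet ω (HTensor X.H Y.H) m
      = chiKet ω (HTensor X.H Y.H) m ∘L opj₂ ω X Y (Y.V (-m) * b * Y.V m) := by
  refine (opj₂_comp_chiKet (box ω X Y) hω (opj₂ ω X Y b) m).trans
    (congrArg (fun T => chiKet ω (HTensor X.H Y.H) m ∘L T) ?_)
  have h := (box ω X Y).conj_eq (-m) (opj₂ ω X Y b)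
  have h' := Y.conj_eq (-m) b
  rw [neg_neg] at h h'
  refine h.symm.trans ((conj_opj₂ ω X Y _ b).trans ?_)
  rw [h']

/-- In the source, b is conjugated by V_{-(m+n)}, with m from the outer braiding and n from the
inner one. In the target χ_{m+n+k} conjugates it by V_{-(m+n+k)}, and the factor V_{-k} in
`splitBlock` makes up the difference. -/
theorem third_comp_split (hω : IsPrimitiveRoot ω N) (b : Y.H →L[ℂ] Y.H) (k : ZMod N) :
    opTensor 1 (opj₂ ω (CZ N) Y b) ∘L split X Y ω k
      = split X Y ω k ∘L opj₂ ω (CZ N) (box ω X Y) (opj₂ ω X Y b) := by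
  refine (isDecomposition_chiKet (K := HTensor X.H Y.H) hω).ext fun m => ?_
  refine Eq.trans ?_
    (congrArg (fun T => split X Y ω k ∘L T) (opj₂_opj₂_comp_chiKet X Y hω b m)).symm
  rw [ContinuousLinearMap.comp_assoc, ← ContinuousLinearMap.comp_assoc (split X Y ω k),
    split_comp_chiKet X Y hω, ContinuousLinearMap.comp_finsetSum,
    ContinuousLinearMap.finsetSum_comp]
  refine Finset.sum_congr rfl fun n _ => ?_
  rw [opj₂_eq X Y hω, ContinuousLinearMap.comp_finsetSum, Finset.sum_eq_single n]
  · rw [splitBlock, opTensor_comp, opTensor_comp, ← ContinuousLinearMap.comp_assoc (opj₂ _ _ _ _),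
      opj₂_comp_chiKet Y hω]
    congr 1
    · change _ = chiKet ω X.H m ∘L (X.proj ω n * X.proj ω n)
      rw [X.proj_mul_proj hω, if_pos rfl]
      rfl
    · change chiKet ω Y.H (m + n + k) ∘L (Y.V (-(m + n + k)) * b * Y.V (m + n + k) * Y.V (-k))
        = chiKet ω Y.H (m + n + k) ∘L (Y.V (-k) * (Y.V (-n) * (Y.V (-m) * b * Y.V m) * Y.V n))
      congr 1
      rw [mul_assoc _ _ (Y.V (-k)), V_mul]
      simp only [← mul_assoc, V_mul]
      rw [mul_assoc _ (Y.V m), V_mul,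
        show -(m + n + k) = -k + (-n + -m) by ring, show m + n + k + -k = m + n by ring]
  · intro n' _ hn
    rw [splitBlock, opTensor_comp]
    have h0 : (chiKet ω X.H m ∘L X.proj ω n) ∘L X.proj ω n' = 0 := by
      change chiKet ω X.H m ∘L (X.proj ω n * X.proj ω n') = 0
      rw [X.proj_mul_proj hω, if_neg hn.symm, ContinuousLinearMap.comp_zero]
    rw [h0, opTensor_zero_left]
  · simp

/-- The component of a from weight n to weight n' is an eigenvector of ρ_t with eigenvalue
ω^{t(n'-n)}. -/
theorem conj_mul_proj (hω : IsPrimitiveRoot ω N) (a : X.H →L[ℂ] X.H) (t n : ZMod N) :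
    X.V t * a * X.V (-t) * X.proj ω n
      = ∑ n', zpw ω (t * (n' - n)) • (X.proj ω n' * a * X.proj ω n) := by
  rw [mul_assoc, X.V_proj hω, X.V_eq hω, Finset.sum_mul, Finset.sum_mul]
  refine Finset.sum_congr rfl fun n' _ => ?_
  rw [smul_mul_assoc, smul_mul_smul_comm, ← zpw_add hω]
  congr 2
  ring

omit [NeZero N] in
theorem conj_conj (a : X.H →L[ℂ] X.H) (s t : ZMod N) :
    X.V s * (X.V t * a * X.V (-t)) * X.V (-s) = X.V t * (X.V s * a * X.V (-s)) * X.V (-t) := by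
  simp only [← mul_assoc, V_mul]
  simp only [mul_assoc, V_mul, add_comm s t, add_comm (-s) (-t)]

/-- The functions `δ_t` sum up to characters. -/
theorem sum_zpw_smul_opj₁_delta (d : ZMod N) :
    ∑ t : ZMod N, zpw ω (t * d) • opj₁ (CZ N) Y (mulOp N fun s => if s = t then 1 else 0)
      = opj₁ (CZ N) Y (mulOp N fun s => zpw ω (d * s)) := by
  let φ := (opj₁Hom (CZ N) Y).comp (show (ZMod N → ℂ) →⋆ₐ[ℂ] ((CZ N).H →L[ℂ] (CZ N).H) from mulOp N)
  have h : (fun s => zpw ω (d * s) : ZMod N → ℂ)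
      = ∑ t : ZMod N, zpw ω (t * d) • fun s => if s = t then (1 : ℂ) else 0 := by
    funext s
    simp [Finset.sum_apply, mul_comm d]
  change ∑ t : ZMod N, zpw ω (t * d) • φ (fun s => if s = t then 1 else 0) = φ _
  rw [h, map_sum]
  simp only [map_smul]

/-- The coaction attaches the character of degree n' - n to the component of a from weight n to
weight n'. It moves χ_{m+n+k} to χ_{m+n'+k}, which is why the second index in `splitBlock` contains
n. -/
theorem second_comp_split (hω : IsPrimitiveRoot ω N) (a : X.H →L[ℂ] X.H) (k : ZMod N) :
    (∑ t : ZMod N, opTensor (opj₂ ω (CZ N) X (X.V t * a * X.V (-t)))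
      (opj₁ (CZ N) Y (mulOp N fun s => if s = t then 1 else 0))) ∘L split X Y ω k
      = split X Y ω k ∘L opj₂ ω (CZ N) (box ω X Y) (opj₁ X Y a) := by
  refine (isDecomposition_chiKet (K := HTensor X.H Y.H) hω).ext fun m => ?_
  refine Eq.trans ?_
    (congrArg (fun T => split X Y ω k ∘L T) (opj₂_opj₁_comp_chiKet X Y hω a m)).symm
  rw [ContinuousLinearMap.comp_assoc, ← ContinuousLinearMap.comp_assoc (split X Y ω k),
    split_comp_chiKet X Y hω, ContinuousLinearMap.comp_finsetSum,
    ContinuousLinearMap.finsetSum_comp]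
  -- What the outer braiding makes of a on χ_m, both in the source and in the first leg of the
  -- target.
  set c := X.V (-m) * a * X.V m with hc
  have h1 : ∀ n, (∑ t : ZMod N, opTensor (opj₂ ω (CZ N) X (X.V t * a * X.V (-t)))
      (opj₁ (CZ N) Y (mulOp N fun s => if s = t then 1 else 0))) ∘L splitBlock X Y ω k m n
      = ∑ n', splitBlock X Y ω k m n' ∘L opTensor (c * X.proj ω n) 1 := fun n => by
    have h2 : ∀ t, opTensor (opj₂ ω (CZ N) X (X.V t * a * X.V (-t)))
        (opj₁ (CZ N) Y (mulOp N fun s => if s = t then 1 else 0)) ∘L splitBlock X Y ω k m n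
        = ∑ n', opTensor (chiKet ω X.H m ∘L (X.proj ω n' * c * X.proj ω n))
          ((zpw ω (t * (n' - n)) • opj₁ (CZ N) Y (mulOp N fun s => if s = t then 1 else 0)) ∘L
            chiKet ω Y.H (m + n + k) ∘L Y.V (-k)) := fun t => by
      have h3 : opj₂ ω (CZ N) X (X.V t * a * X.V (-t)) ∘L chiKet ω X.H m ∘L X.proj ω n
          = ∑ n', zpw ω (t * (n' - n)) • (chiKet ω X.H m ∘L (X.proj ω n' * c * X.proj ω n)) := by
        rw [← ContinuousLinearMap.comp_assoc, opj₂_comp_chiKet X hω]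
        have h4 := X.conj_conj a (-m) t
        rw [neg_neg, ← hc] at h4
        rw [h4]
        refine (congrArg (fun T => chiKet ω X.H m ∘L T) (X.conj_mul_proj hω c t n)).trans ?_
        rw [ContinuousLinearMap.comp_finsetSum]
        simp only [ContinuousLinearMap.comp_smul]
      rw [splitBlock, opTensor_comp, h3, opTensor_sum_left]
      refine Finset.sum_congr rfl fun n' _ => ?_
      rw [opTensor_smul_left, ContinuousLinearMap.smul_comp, opTensor_smul_right]
    rw [ContinuousLinearMap.finsetSum_comp]
    simp only [h2]
    rw [Finset.sum_comm]
    refine Finset.sum_congr rfl fun n' _ => ?_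
    rw [← opTensor_sum_right, ← ContinuousLinearMap.finsetSum_comp, sum_zpw_smul_opj₁_delta,
      ← ContinuousLinearMap.comp_assoc, opj₁_comp_chiKet Y hω, splitBlock, opTensor_comp,
      show m + n + k + (n' - n) = m + n' + k by ring]
    rfl
  simp only [h1]
  rw [Finset.sum_comm]
  refine Finset.sum_congr rfl fun n' _ => ?_
  rw [← ContinuousLinearMap.comp_finsetSum, ← opTensor_sum_left, ← Finset.mul_sum, X.sum_proj hω,
    mul_one]

end ZNAlg

/-! ### Elementary tensors and characters -/

section MinTensor

variable {H K : Type*} [NormedAddCommGroup H] [InnerProductSpace ℂ H] [CompleteSpace H]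
  [NormedAddCommGroup K] [InnerProductSpace ℂ K] [CompleteSpace K]
  {A : StarSubalgebra ℂ (H →L[ℂ] H)} {B : StarSubalgebra ℂ (K →L[ℂ] K)}

/-- Elementary tensors as a bilinear map. -/
def minTensor.tmulₗ (A : StarSubalgebra ℂ (H →L[ℂ] H)) (B : StarSubalgebra ℂ (K →L[ℂ] K)) :
    A →ₗ[ℂ] B →ₗ[ℂ] minTensor A B :=
  LinearMap.mk₂ ℂ minTensor.tmul
    (fun _ _ _ => Subtype.ext (opTensor_add_left _ _ _))
    (fun _ _ _ => Subtype.ext (opTensor_smul_left _ _ _))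
    (fun _ _ _ => Subtype.ext (opTensor_add_right _ _ _))
    (fun _ _ _ => Subtype.ext (opTensor_smul_right _ _ _))

theorem minTensor.tmul_eq (a : A) (b : B) :
    minTensor.tmul a b = minTensor.tmulₗ A B a b := rfl

theorem minTensor.smul_tmul (c : ℂ) (a : A) (b : B) :
    minTensor.tmul (c • a) b = minTensor.tmul a (c • b) := by
  simp only [minTensor.tmul_eq, map_smul, LinearMap.smul_apply]

theorem minTensor.tmul_zero (a : A) : minTensor.tmul a (0 : B) = 0 :=
  (minTensor.tmulₗ A B a).map_zero

theorem minTensor.tmul_sum {ι : Type*} (s : Finset ι) (a : A) (b : ι → B) :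
    minTensor.tmul a (∑ i ∈ s, b i) = ∑ i ∈ s, minTensor.tmul a (b i) :=
  map_sum (minTensor.tmulₗ A B a) b s

theorem minTensor.zero_tmul (b : B) : minTensor.tmul (0 : A) b = 0 :=
  LinearMap.map_zero₂ (minTensor.tmulₗ A B) b

theorem minTensor.tmul_mul_tmul (a a' : A) (b b' : B) :
    minTensor.tmul a b * minTensor.tmul a' b' = minTensor.tmul (a * a') (b * b') :=
  Subtype.ext (opTensor_mul _ _ _ _)

theorem minTensor.isClosed (A : StarSubalgebra ℂ (H →L[ℂ] H)) (B : StarSubalgebra ℂ (K →L[ℂ] K)) :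
    IsClosed (minTensor A B : Set (HTensor H K →L[ℂ] HTensor H K)) :=
  StarSubalgebra.isClosed_topologicalClosure _

end MinTensor

/-! ### The characters of ℤ/N as elements of C(ℤ/N) -/

namespace CZ

variable {N : ℕ} [NeZero N] {ω : ℂ}

/-- The inclusion of functions into `C(ℤ/N)` as a linear map. -/
def ofFunₗ (N : ℕ) [NeZero N] : (ZMod N → ℂ) →ₗ[ℂ] (CZ N).A where
  toFun := ofFun N
  map_add' f g := Subtype.ext (map_add (mulOp N) f g)
  map_smul' r f := Subtype.ext (map_smul (mulOp N) r f)

/-- The character `s ↦ ω ^ (d * s)`. -/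
def char (ω : ℂ) (d : ZMod N) : (CZ N).A := ofFun N fun s => zpw ω (d * s)

theorem char_zero : char (N := N) ω 0 = 1 := by
  refine Subtype.ext ((congrArg (mulOp N) ?_).trans (map_one (mulOp N)))
  funext s
  simp [zpw_zero]

theorem char_add (hω : IsPrimitiveRoot ω N) (d e : ZMod N) :
    char ω (d + e) = char ω d * char ω e := by
  refine Subtype.ext ((congrArg (mulOp N) ?_).trans (map_mul (mulOp N) _ _))
  funext s
  simp [add_mul, zpw_add hω]

theorem star_char (hω : IsPrimitiveRoot ω N) (d : ZMod N) :
    star (char ω d) = char ω (-d) := by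
  refine Subtype.ext ((map_star (mulOp N) _).symm.trans (congrArg (mulOp N) ?_))
  funext s
  simp [neg_mul, ← star_zpw hω]

/-- Links the powers with representative exponents in the definition of `t` to characters, whose
exponents add modulo N. -/
theorem char_eq_pow (hω : IsPrimitiveRoot ω N) (d : ZMod N) :
    char ω d = z N ω ^ d.val := by
  have h : ∀ n : ℕ, char ω (n : ZMod N) = z N ω ^ n := fun n => by
    induction n with
    | zero => rw [Nat.cast_zero, char_zero, pow_zero]
    | succ n ih =>
      rw [Nat.cast_succ, char_add hω, ih, pow_succ]
      congr 1
      refine congrArg (ofFun N) ?_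
      funext s
      rw [one_mul]
  rw [← h, ZMod.natCast_zmod_val]

theorem isHomogeneous_char (hω : IsPrimitiveRoot ω N) (d : ZMod N) :
    ZNAlg.IsHomogeneous ω (X := CZ N) (char ω d) d := by
  intro t
  refine Subtype.ext ((regU_conj N (Multiplicative.ofAdd t) _).trans
    ((congrArg (mulOp N) ?_).trans (map_smul (mulOp N) _ _)))
  funext s
  simp only [toAdd_ofAdd, Pi.smul_apply, smul_eq_mul, ← zpw_add hω]
  congr 1
  ring

theorem char_eq_sum_delta (d : ZMod N) :
    char ω d = ∑ t : ZMod N, zpw ω (t * d) • delta N t := by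
  have h : (fun s => zpw ω (d * s) : ZMod N → ℂ)
      = ∑ t : ZMod N, zpw ω (t * d) • fun s => if s = t then (1 : ℂ) else 0 := by
    funext s
    simp [Finset.sum_apply, mul_comm d]
  change ofFunₗ N _ = ∑ t : ZMod N, zpw ω (t * d) • ofFunₗ N _
  rw [h, map_sum]
  simp only [map_smul]

/-- By Fourier inversion the characters span, so formulas linear in f need checking only where the
coproduct is group-like. -/
theorem linearMap_ext (hω : IsPrimitiveRoot ω N) {M : Type*} [AddCommGroup M] [Module ℂ M]
    {S T : (ZMod N → ℂ) →ₗ[ℂ] M}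
    (h : ∀ d : ZMod N, S (fun s => zpw ω (d * s)) = T fun s => zpw ω (d * s)) : S = T := by
  refine LinearMap.ext fun f => ?_
  rw [fun_eq_sum_zpw hω f, map_sum, map_sum]
  simp only [map_smul, h]

theorem mem_of_char_mem (hω : IsPrimitiveRoot ω N) (C : Submodule ℂ (CZ N).A)
    (h : ∀ d : ZMod N, char ω d ∈ C) (x : (CZ N).A) : x ∈ C := by
  obtain ⟨_, f, rfl⟩ := x
  change ofFunₗ N f ∈ C
  rw [fun_eq_sum_zpw hω f, map_sum]
  refine sum_mem fun d _ => ?_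
  rw [map_smul]
  exact C.smul_mem _ (h d)

end CZ

/-! ### Construction of ψ as an amplification -/

namespace ZNAlg

variable {N : ℕ} [NeZero N] {ω : ℂ} (X : ZNAlg.{u} N) (Y : ZNAlg.{v} N)

theorem tmul_j₁_char (hω : IsPrimitiveRoot ω N) (d : ZMod N) :
    minTensor.tmul (j₁ ω (CZ N) X (CZ.char ω d)) (j₁ ω (CZ N) Y (CZ.char ω d))
      = ∑ s, ∑ t, zpw ω (d * (s + t)) • minTensor.tmul (j₁ ω (CZ N) X (CZ.delta N s))
        (j₁ ω (CZ N) Y (CZ.delta N t)) := by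
  simp only [← j₁Hom_apply, CZ.char_eq_sum_delta, minTensor.tmul_eq, map_sum, map_smul,
    LinearMap.sum_apply, LinearMap.smul_apply]
  simp only [Finset.smul_sum, smul_smul, ← zpw_add hω]
  rw [Finset.sum_comm]
  refine Finset.sum_congr rfl fun s _ => Finset.sum_congr rfl fun t _ => ?_
  congr 2
  ring

/-- The homomorphism `ψ : C(ℤ/N) ⊠ X ⊠ Y → (C(ℤ/N) ⊠ X) ⊗ (C(ℤ/N) ⊠ Y)`. -/
theorem exists_psi (hω : IsPrimitiveRoot ω N) :
    ∃ ψ : (box ω (CZ N) (box ω X Y)).A →⋆ₐ[ℂ] minTensor (box ω (CZ N) X).A (box ω (CZ N) Y).A,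
      (∀ f : ZMod N → ℂ, ψ (j₁ ω (CZ N) (box ω X Y) (CZ.ofFun N f))
        = ∑ s, ∑ t, f (s + t) • minTensor.tmul (j₁ ω (CZ N) X (CZ.delta N s))
            (j₁ ω (CZ N) Y (CZ.delta N t))) ∧
      (∀ a : X.A, ψ (j₂ ω (CZ N) (box ω X Y) (j₁ ω X Y a))
        = ∑ t, minTensor.tmul (j₂ ω (CZ N) X (X.act t a)) (j₁ ω (CZ N) Y (CZ.delta N t))) ∧
      ∀ b : Y.A, ψ (j₂ ω (CZ N) (box ω X Y) (j₂ ω X Y b))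
        = minTensor.tmul 1 (j₂ ω (CZ N) Y b) := by
  have hS := isDecomposition_split X Y hω
  let T := minTensor (box ω (CZ N) X).A (box ω (CZ N) Y).A
  have hT := minTensor.isClosed (box ω (CZ N) X).A (box ω (CZ N) Y).A
  let ψ₀ : (box ω (CZ N) (box ω X Y)).A →⋆ₐ[ℂ]
      (HTensor (HTensor (CZ N).H X.H) (HTensor (CZ N).H Y.H) →L[ℂ]
        HTensor (HTensor (CZ N).H X.H) (HTensor (CZ N).H Y.H)) :=
    hS.ampl.comp (box ω (CZ N) (box ω X Y)).A.subtype
  have h₁ : ∀ f : ZMod N → ℂ, ψ₀ (j₁ ω (CZ N) (box ω X Y) (CZ.ofFun N f))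
      = T.subtype (∑ s, ∑ t, f (s + t) • minTensor.tmul (j₁ ω (CZ N) X (CZ.delta N s))
            (j₁ ω (CZ N) Y (CZ.delta N t))) := fun f => by
    -- The right-hand side as a linear map of f, so that it can be compared on characters.
    let W : (ZMod N → ℂ) →ₗ[ℂ] T := ∑ s, ∑ t, (LinearMap.proj (s + t)).smulRight
      (minTensor.tmul (j₁ ω (CZ N) X (CZ.delta N s)) (j₁ ω (CZ N) Y (CZ.delta N t)))
    have hW : ∀ f, W f = ∑ s, ∑ t, f (s + t) • minTensor.tmul (j₁ ω (CZ N) X (CZ.delta N s))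
        (j₁ ω (CZ N) Y (CZ.delta N t)) := fun f => by
      simp only [W, LinearMap.sum_apply, LinearMap.smulRight_apply, LinearMap.proj_apply]
    rw [← hW]
    refine LinearMap.congr_fun (CZ.linearMap_ext hω
      (S := ψ₀.toAlgHom.toLinearMap ∘ₗ (j₁Hom (CZ N) (box ω X Y) ω).toAlgHom.toLinearMap ∘ₗ
        CZ.ofFunₗ N) (T := T.subtype.toAlgHom.toLinearMap ∘ₗ W) fun d => ?_) f
    refine (hS.ampl_eq (chi_shift_comp_split X Y hω d)).trans ?_
    change _ = T.subtype (W fun s => zpw ω (d * s))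
    rw [hW]
    exact congrArg Subtype.val (tmul_j₁_char X Y hω d)
  have h₂ : ∀ a : X.A, ψ₀ (j₂ ω (CZ N) (box ω X Y) (j₁ ω X Y a))
      = T.subtype (∑ t, minTensor.tmul (j₂ ω (CZ N) X (X.act t a))
        (j₁ ω (CZ N) Y (CZ.delta N t))) := fun a => by
    refine hS.ampl_eq fun k => ?_
    refine Eq.trans ?_ (second_comp_split X Y hω a k)
    rw [map_sum]
    refine congrArg (fun G => G ∘L split X Y ω k) (Finset.sum_congr rfl fun t _ => ?_)
    change opTensor (opj₂ ω (CZ N) X (X.act t a)) _ = _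
    rw [coe_act]
    rfl
  have h₃ : ∀ b : Y.A, ψ₀ (j₂ ω (CZ N) (box ω X Y) (j₂ ω X Y b))
      = T.subtype (minTensor.tmul 1 (j₂ ω (CZ N) Y b)) := fun b =>
    hS.ampl_eq fun k => third_comp_split X Y hω b k
  have hmem : ∀ a, ψ₀ a ∈ T := by
    refine box_mem hT ψ₀ ?_ fun y => ?_
    · rintro ⟨_, f, rfl⟩
      exact (h₁ f).symm ▸ Subtype.property _
    -- The second leg is itself a braided product, so the reduction to generators is repeated inside
    -- it.
    · refine box_mem hT (ψ₀.comp (j₂Hom (CZ N) (box ω X Y) hω)) (fun a => ?_) (fun b => ?_) y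
      · exact (h₂ a).symm ▸ Subtype.property _
      · exact (h₃ b).symm ▸ Subtype.property _
  exact ⟨StarAlgHom.codRestrict ψ₀ T hmem, fun f => Subtype.ext (h₁ f),
    fun a => Subtype.ext (h₂ a), fun b => Subtype.ext (h₃ b)⟩

end ZNAlg

/-! ### Existence of the comultiplication of the bosonization -/

namespace EquivariantRep

variable {N : ℕ} [NeZero N] {ω : ℂ} (L : EquivariantRep.{u} N ω)

theorem exists_isBosonComult (hω : IsPrimitiveRoot ω N) :
    ∃ D : L.boson.A →⋆ₐ[ℂ] minTensor L.boson.A L.boson.A, L.IsBosonComult D := by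
  obtain ⟨Δ, hΔ⟩ := L.exists_isBraidedComult hω
  obtain ⟨Φ, hΦ₁, hΦ₂⟩ := ZNAlg.exists_id_box (X := L.alg) (Y := L.double) hω
    (Δ.comp (L.opEquiv.symm : L.alg.A →⋆ₐ[ℂ] CS N ω)) fun t a => by
      obtain ⟨a, rfl⟩ := L.opEquiv.surjective a
      refine (IsBraidedComult.act L hω hΔ t _ _ ?_).symm
      change L.alg.act t (L.opEquiv (L.opEquiv.symm (L.opEquiv a)))
        = L.opEquiv (L.opEquiv.symm (L.alg.act t (L.opEquiv a)))
      rw [StarAlgEquiv.apply_symm_apply, StarAlgEquiv.apply_symm_apply]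
  obtain ⟨ψ, hψ₁, hψ₂, hψ₃⟩ := ZNAlg.exists_psi L.alg L.alg hω
  refine ⟨ψ.comp Φ, Δ, Φ, ψ, hΔ, fun x a => ?_, ⟨hψ₁, hψ₂, hψ₃⟩, rfl⟩
  rw [map_mul, hΦ₁, hΦ₂]
  change _ * ZNAlg.j₂ ω (CZ N) L.double (Δ (L.opEquiv.symm (L.opEquiv a))) = _
  rw [StarAlgEquiv.symm_apply_apply]

end EquivariantRep

/-! ### Unitary matrices over a `*`-ring -/

section UnitaryMatrix

variable {m n R : Type*} [Fintype m] [Fintype n] [DecidableEq m] [DecidableEq n] [Ring R]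
  [StarRing R]

theorem Matrix.fromBlocks_mem_unitary {A : Matrix m m R} {B : Matrix n n R}
    (hA : A ∈ unitary (Matrix m m R)) (hB : B ∈ unitary (Matrix n n R)) :
    Matrix.fromBlocks A 0 0 B ∈ unitary (Matrix (m ⊕ n) (m ⊕ n) R) := by
  rw [Unitary.mem_iff] at *
  simp only [Matrix.star_eq_conjTranspose] at *
  rw [Matrix.fromBlocks_conjTranspose, Matrix.fromBlocks_multiply, Matrix.fromBlocks_multiply]
  simp [hA, hB]

theorem Matrix.submatrix_mem_unitary {A : Matrix m m R} (hA : A ∈ unitary (Matrix m m R))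
    (e : m ≃ m) : A.submatrix e e ∈ unitary (Matrix m m R) := by
  rw [Unitary.mem_iff] at *
  simp only [Matrix.star_eq_conjTranspose] at *
  rw [Matrix.conjTranspose_submatrix, Matrix.submatrix_mul_equiv, Matrix.submatrix_mul_equiv,
    hA.1, hA.2, Matrix.submatrix_one_equiv]
  exact ⟨rfl, rfl⟩

theorem Matrix.of_unit_mem_unitary {a : R} (ha : a ∈ unitary R) :
    Matrix.of (fun _ _ : Unit => a) ∈ unitary (Matrix Unit Unit R) := by
  rw [Unitary.mem_iff] at *
  constructor <;> ext1 i j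
  · simpa [Matrix.mul_apply] using ha.1
  · simpa [Matrix.mul_apply] using ha.2

end UnitaryMatrix

namespace EquivariantRep

variable {N : ℕ} [NeZero N] {ω : ℂ} {L : EquivariantRep.{u} N ω}

/-! ### The comultiplication of the bosonization on generators -/

theorem op_one (L : EquivariantRep.{u} N ω) : L.op 1 = 1 := map_one L.opEquiv

/-- The defining condition concerns products j₁(x) j₂(a); setting a = 1, and x = 1 in the next
lemma, separates the two factors. -/
theorem IsIdBoxComult.apply_j₁ (hω : IsPrimitiveRoot ω N) {Δ : CS N ω →⋆ₐ[ℂ] L.double.A}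
    {Φ : L.boson.A →⋆ₐ[ℂ] L.triple.A} (h : L.IsIdBoxComult Δ Φ) (x : (CZ N).A) :
    Φ (ZNAlg.j₁ ω (CZ N) L.alg x) = ZNAlg.j₁ ω (CZ N) L.double x := by
  have := h x 1
  rwa [op_one, map_one, ← ZNAlg.j₂Hom_apply _ _ hω, ← ZNAlg.j₂Hom_apply _ _ hω, map_one, map_one,
    mul_one, mul_one] at this

theorem IsIdBoxComult.apply_j₂ {Δ : CS N ω →⋆ₐ[ℂ] L.double.A}
    {Φ : L.boson.A →⋆ₐ[ℂ] L.triple.A} (h : L.IsIdBoxComult Δ Φ) (a : CS N ω) :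
    Φ (ZNAlg.j₂ ω (CZ N) L.alg (L.op a)) = ZNAlg.j₂ ω (CZ N) L.double (Δ a) := by
  have := h 1 a
  rwa [← ZNAlg.j₁Hom_apply, ← ZNAlg.j₁Hom_apply, map_one, map_one, one_mul, one_mul] at this

/-- The element `j₁(z ^ d)`. -/
def zp (L : EquivariantRep.{u} N ω) (d : ZMod N) : L.boson.A :=
  ZNAlg.j₁ ω (CZ N) L.alg (CZ.char ω d)

/-- The element `j₂(q i j)`. -/
def r (L : EquivariantRep.{u} N ω) (i j : ZMod N) : L.boson.A :=
  ZNAlg.j₂ ω (CZ N) L.alg (L.op (q ω i j))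

theorem zp_zero : L.zp 0 = 1 := by
  rw [zp, CZ.char_zero, ← ZNAlg.j₁Hom_apply, map_one]

theorem zp_mul (hω : IsPrimitiveRoot ω N) (d e : ZMod N) : L.zp d * L.zp e = L.zp (d + e) := by
  simp only [zp, CZ.char_add hω, ← ZNAlg.j₁Hom_apply, map_mul]

theorem star_zp (hω : IsPrimitiveRoot ω N) (d : ZMod N) : star (L.zp d) = L.zp (-d) := by
  simp only [zp, ← CZ.star_char hω, ← ZNAlg.j₁Hom_apply, map_star]

theorem zp_eq_pow (hω : IsPrimitiveRoot ω N) (d : ZMod N) : L.zp d = L.z ^ d.val := by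
  simp only [zp, z, CZ.char_eq_pow hω, ← ZNAlg.j₁Hom_apply, map_pow]

theorem z_eq_zp : L.z = L.zp 1 := by
  simp only [z, zp, CZ.char, one_mul]
  rfl

theorem anyonicFamily_r (hω : IsPrimitiveRoot ω N) : AnyonicFamily ω L.r :=
  L.anyonicFamily_op.map (ZNAlg.j₂Hom (CZ N) L.alg hω)

theorem r_mul_zp (hω : IsPrimitiveRoot ω N) (i j d : ZMod N) :
    L.r i j * L.zp d = zpw ω (-((j - i) * d)) • (L.zp d * L.r i j) :=
  ZNAlg.j₂_mul_j₁ hω (CZ.isHomogeneous_char hω d) (L.isHomogeneous_op i j)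

theorem t_apply (hω : IsPrimitiveRoot ω N) (i j : ZMod N) : L.t i j = L.zp i * L.r i j := by
  rw [t, zp, CZ.char_eq_pow hω, r]

variable {D D' : L.boson.A →⋆ₐ[ℂ] minTensor L.boson.A L.boson.A}

theorem IsBosonComult.apply_j₁ (hω : IsPrimitiveRoot ω N) (hD : L.IsBosonComult D)
    (f : ZMod N → ℂ) : D (ZNAlg.j₁ ω (CZ N) L.alg (CZ.ofFun N f))
      = ∑ s, ∑ t, f (s + t) • minTensor.tmul (ZNAlg.j₁ ω (CZ N) L.alg (CZ.delta N s))
        (ZNAlg.j₁ ω (CZ N) L.alg (CZ.delta N t)) := by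
  obtain ⟨Δ, Φ, ψ, -, hΦ, hψ, rfl⟩ := hD
  rw [StarAlgHom.comp_apply, hΦ.apply_j₁ hω, hψ.first]

theorem IsBosonComult.apply_zp (hω : IsPrimitiveRoot ω N) (hD : L.IsBosonComult D) (d : ZMod N) :
    D (L.zp d) = minTensor.tmul (L.zp d) (L.zp d) :=
  (hD.apply_j₁ hω _).trans (ZNAlg.tmul_j₁_char L.alg L.alg hω d).symm

/-- Since q_{ik} has degree k - i, its coaction is q_{ik} ⊗ ∑_t ω^{t(k-i)} δ_t, and the sum is
z^{k-i}. -/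
theorem IsBosonComult.apply_r (hω : IsPrimitiveRoot ω N) (hD : L.IsBosonComult D) (i j : ZMod N) :
    D (L.r i j) = ∑ k, minTensor.tmul (L.r i k) (L.zp (k - i) * L.r k j) := by
  obtain ⟨Δ, Φ, ψ, hΔ, hΦ, hψ, rfl⟩ := hD
  rw [StarAlgHom.comp_apply, r, hΦ.apply_j₂, hΔ, ← ZNAlg.j₂Hom_apply _ _ hω, map_sum, map_sum]
  refine Finset.sum_congr rfl fun k _ => ?_
  rw [map_mul, map_mul, ZNAlg.j₂Hom_apply, ZNAlg.j₂Hom_apply, hψ.second, hψ.third, Finset.sum_mul]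
  have h : ∀ t : ZMod N, minTensor.tmul
      (ZNAlg.j₂ ω (CZ N) L.alg (L.alg.act t (L.op (q ω i k))))
      (ZNAlg.j₁ ω (CZ N) L.alg (CZ.delta N t)) *
        minTensor.tmul 1 (ZNAlg.j₂ ω (CZ N) L.alg (L.op (q ω k j)))
      = minTensor.tmul (L.r i k)
        ((zpw ω (t * (k - i)) • ZNAlg.j₁ ω (CZ N) L.alg (CZ.delta N t)) * L.r k j) := fun t => by
    have h' : ZNAlg.j₂ ω (CZ N) L.alg (L.alg.act t (L.op (q ω i k)))
        = zpw ω (t * (k - i)) • L.r i k := by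
      rw [L.isHomogeneous_op]
      exact map_smul (ZNAlg.j₂Hom (CZ N) L.alg hω) _ _
    rw [h', minTensor.tmul_mul_tmul, mul_one, minTensor.smul_tmul, smul_mul_assoc]
    rfl
  rw [zp, CZ.char_eq_sum_delta, ← ZNAlg.j₁Hom_apply, map_sum, Finset.sum_mul, minTensor.tmul_sum]
  refine Finset.sum_congr rfl fun t _ => ?_
  rw [map_smul]
  exact h t

/-- The values on j₁(f) and on j₂(q_{ij}) do not involve the chosen Δ, Φ, ψ, and these elements
generate. -/
theorem IsBosonComult.unique (hω : IsPrimitiveRoot ω N) (hD : L.IsBosonComult D)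
    (hD' : L.IsBosonComult D') : D = D' := by
  refine ZNAlg.box_ext (fun x => ?_) fun y => ?_
  · obtain ⟨_, f, rfl⟩ := x
    exact (hD.apply_j₁ hω f).trans (hD'.apply_j₁ hω f).symm
  · obtain ⟨a, rfl⟩ := L.op_surjective y
    let T := minTensor L.boson.A L.boson.A
    let ι : CS N ω →⋆ₐ[ℂ] L.boson.A :=
      (ZNAlg.j₂Hom (CZ N) L.alg hω).comp (L.opEquiv : CS N ω →⋆ₐ[ℂ] L.alg.A)
    have h : (T.subtype.comp D).comp ι = (T.subtype.comp D').comp ι :=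
      CS_hom_ext fun i j => congrArg T.subtype
        ((hD.apply_r hω i j).trans (hD'.apply_r hω i j).symm)
    exact Subtype.ext (DFunLike.congr_fun h a)

theorem IsBosonComult.isRepMatrix_t (hω : IsPrimitiveRoot ω N) (hD : L.IsBosonComult D) :
    IsRepMatrix D L.t := by
  intro i j
  rw [t_apply hω, map_mul, hD.apply_zp hω, hD.apply_r hω, Finset.mul_sum]
  refine Finset.sum_congr rfl fun k _ => ?_
  -- The factor z^i in the second leg combines with z^{k-i} to the z^k required by t_{kj}.
  rw [minTensor.tmul_mul_tmul, t_apply hω, t_apply hω, ← mul_assoc (L.zp i), zp_mul hω,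
    add_sub_cancel]

theorem zt_inl_inl (i j : Unit) : L.zt (Sum.inl i) (Sum.inl j) = L.z := rfl

theorem zt_inl_inr (i : Unit) (j : ZMod N) : L.zt (Sum.inl i) (Sum.inr j) = 0 := rfl

theorem zt_inr_inl (i : ZMod N) (j : Unit) : L.zt (Sum.inr i) (Sum.inl j) = 0 := rfl

theorem zt_inr_inr (i j : ZMod N) : L.zt (Sum.inr i) (Sum.inr j) = L.t i j := rfl

theorem IsBosonComult.isRepMatrix_zt (hω : IsPrimitiveRoot ω N) (hD : L.IsBosonComult D) :
    IsRepMatrix D L.zt := by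
  rintro (i | i) (j | j)
  · simp only [Fintype.sum_sum_type, zt_inl_inl, zt_inl_inr, zt_inr_inl, minTensor.tmul_zero,
      Finset.sum_const_zero, add_zero, Finset.univ_unique, Finset.sum_singleton]
    rw [z_eq_zp, hD.apply_zp hω]
  · simp only [Fintype.sum_sum_type, zt_inl_inr, minTensor.tmul_zero, minTensor.zero_tmul,
      Finset.sum_const_zero, add_zero, map_zero]
  · simp only [Fintype.sum_sum_type, zt_inr_inl, minTensor.tmul_zero, minTensor.zero_tmul,
      Finset.sum_const_zero, add_zero, map_zero]
  · simp only [Fintype.sum_sum_type, zt_inr_inr, zt_inl_inr, zt_inr_inl, minTensor.tmul_zero,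
      Finset.sum_const_zero, zero_add]
    exact hD.isRepMatrix_t hω i j

/-! ### Unitarity and density -/

theorem t_mem_unitary (hω : IsPrimitiveRoot ω N) (L : EquivariantRep.{u} N ω) :
    L.t ∈ unitary (Matrix (ZMod N) (ZMod N) L.boson.A) := by
  have hr := anyonicFamily_r (L := L) hω
  rw [Unitary.mem_iff]
  constructor
  · ext1 i j
    rw [Matrix.mul_apply, Matrix.one_apply, ← hr.sum_star_mul]
    refine Finset.sum_congr rfl fun k _ => ?_
    rw [Matrix.star_apply, t_apply hω, t_apply hω, star_mul, mul_assoc, ← mul_assoc (star (L.zp k)),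
      star_zp hω, zp_mul hω, neg_add_cancel, zp_zero, one_mul]
  · ext1 i j
    have h : ∑ k, L.t i k * star (L.t j k)
        = L.zp i * (∑ k, L.r i k * star (L.r j k)) * star (L.zp j) := by
      rw [Finset.mul_sum, Finset.sum_mul]
      refine Finset.sum_congr rfl fun k _ => ?_
      rw [t_apply hω, t_apply hω, star_mul]
      simp only [mul_assoc]
    rw [Matrix.mul_apply, Matrix.one_apply]
    refine h.trans ?_
    rw [hr.sum_mul_star hω]
    split_ifs with hij
    · rw [hij, mul_one, star_zp hω, zp_mul hω, add_neg_cancel, zp_zero]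
    · rw [mul_zero, zero_mul]

/-- The conjugate of `t` is `t` up to a permutation of the indices. -/
theorem star_t_apply (hω : IsPrimitiveRoot ω N) (i j : ZMod N) :
    star (L.t i j) = L.t (-i) (-j) := by
  rw [t_apply hω, star_mul, (anyonicFamily_r hω).adj, star_zp hω, smul_mul_assoc, r_mul_zp hω,
    smul_smul, ← zpw_add hω, ← t_apply hω]
  -- The phase of the adjoint relation cancels the one from moving z^{-i} past q_{-i,-j}; this is
  -- what the twist by z^i achieves.
  rw [show -(i * (i - j)) + -((-j - -i) * -i) = 0 by ring, zpw_zero, one_smul]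

theorem z_mem_unitary (hω : IsPrimitiveRoot ω N) (L : EquivariantRep.{u} N ω) :
    L.z ∈ unitary L.boson.A := by
  rw [Unitary.mem_iff, z_eq_zp, star_zp hω, zp_mul hω, zp_mul hω, add_neg_cancel, neg_add_cancel,
    zp_zero]
  exact ⟨rfl, rfl⟩

theorem zt_mem_unitary (hω : IsPrimitiveRoot ω N) (L : EquivariantRep.{u} N ω) :
    L.zt ∈ unitary (Matrix (Unit ⊕ ZMod N) (Unit ⊕ ZMod N) L.boson.A) :=
  Matrix.fromBlocks_mem_unitary (Matrix.of_unit_mem_unitary (L.z_mem_unitary hω))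
    (L.t_mem_unitary hω)

theorem zt_map_star_mem_unitary (hω : IsPrimitiveRoot ω N) (L : EquivariantRep.{u} N ω) :
    L.zt.map star ∈ unitary (Matrix (Unit ⊕ ZMod N) (Unit ⊕ ZMod N) L.boson.A) := by
  have h : L.zt.map star = Matrix.fromBlocks (fun _ _ => star L.z) 0 0
      (L.t.submatrix (Equiv.neg (ZMod N)) (Equiv.neg (ZMod N))) := by
    ext1 i j
    rcases i with i | i <;> rcases j with j | j
    · rfl
    · exact star_zero _
    · exact star_zero _
    · exact star_t_apply hω i j
  rw [h]
  exact Matrix.fromBlocks_mem_unitary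
    (Matrix.of_unit_mem_unitary (Unitary.star_mem (L.z_mem_unitary hω)))
    (Matrix.submatrix_mem_unitary (L.t_mem_unitary hω) _)

theorem dense_adjoin_zt (hω : IsPrimitiveRoot ω N) (L : EquivariantRep.{u} N ω) :
    Dense (StarAlgebra.adjoin ℂ {a : L.boson.A | ∃ i j, a = L.zt i j} : Set L.boson.A) := by
  set C := (StarAlgebra.adjoin ℂ {a : L.boson.A | ∃ i j, a = L.zt i j}).topologicalClosure with hC
  have hcl : IsClosed (C : Set L.boson.A) := StarSubalgebra.isClosed_topologicalClosure _
  have hzt : ∀ i j, L.zt i j ∈ C := fun i j =>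
    StarSubalgebra.le_topologicalClosure _ (StarAlgebra.subset_adjoin ℂ _ ⟨i, j, rfl⟩)
  have hzp : ∀ d, L.zp d ∈ C := fun d => by
    rw [zp_eq_pow hω]
    exact pow_mem (hzt (Sum.inl ()) (Sum.inl ())) _
  have hr : ∀ i j, L.r i j ∈ C := fun i j => by
    -- The summand z of z ⊕ t is what allows the twist by z^i to be undone.
    have h : L.r i j = L.zp (-i) * L.t i j := by
      rw [t_apply hω, ← mul_assoc, zp_mul hω, neg_add_cancel, zp_zero, one_mul]
    rw [h]
    exact mul_mem (hzp _) (hzt (Sum.inr i) (Sum.inr j))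
  have : IsClosed (L.boson.A : Set (L.boson.H →L[ℂ] L.boson.H)) := L.boson.isClosed
  have hall : ∀ a, a ∈ C := by
    refine ZNAlg.box_mem (B := L.boson.A) (C := C) hcl (StarAlgHom.id ℂ L.boson.A) (fun x => ?_)
      fun y => ?_
    · exact CZ.mem_of_char_mem hω (C.toSubalgebra.toSubmodule.comap
        (ZNAlg.j₁Hom (CZ N) L.alg ω).toAlgHom.toLinearMap) hzp x
    · obtain ⟨a, rfl⟩ := L.op_surjective y
      let ι : CS N ω →⋆ₐ[ℂ] L.boson.A :=
        (ZNAlg.j₂Hom (CZ N) L.alg hω).comp (L.opEquiv : CS N ω →⋆ₐ[ℂ] L.alg.A)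
      exact CS.induction (C.comap ι) (hcl.preimage (StarAlgHom.continuous_of_cstar ι)) hr a
  intro a
  exact hall a

end EquivariantRep

end

/-! ### The main theorem -/

theorem corollary3 (N : ℕ) [NeZero N] (ω : ℂ) (hω : IsPrimitiveRoot ω N)
    (L : EquivariantRep.{u} N ω) :
    (∃! D : L.boson.A →⋆ₐ[ℂ] minTensor L.boson.A L.boson.A, L.IsBosonComult D) ∧
      ∀ D : L.boson.A →⋆ₐ[ℂ] minTensor L.boson.A L.boson.A, L.IsBosonComult D →
        IsUnitaryRep D L.t ∧ IsCompactMatrixQuantumGroup L.boson.A D L.zt := by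
  obtain ⟨D₀, hD₀⟩ := L.exists_isBosonComult hω
  refine ⟨⟨D₀, hD₀, fun D hD => hD.unique hω hD₀⟩, fun D hD =>
    ⟨⟨L.t_mem_unitary hω, hD.isRepMatrix_t hω⟩, ?_⟩⟩
  exact
    { isClosed := L.boson.isClosed
      dense := L.dense_adjoin_zt hω
      rep := hD.isRepMatrix_zt hω
      isUnit := ⟨Unitary.toUnits ⟨L.zt, L.zt_mem_unitary hω⟩, rfl⟩
      isUnit_conj := ⟨Unitary.toUnits ⟨_, L.zt_map_star_mem_unitary hω⟩, rfl⟩ }
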